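/- Let $q\ge 1$ and $k\ge 1$ be fixed integers. For each $n$ let $K_n\le P_n$ be non-negative integers and $p_n\in[0,1]$. The random graph $\mathbb{G}_q=\mathbb{G}_q(n,K_n,P_n,p_n)$ on $n$ nodes $v_1,\dots,v_n$ is defined as follows: each node $v_i$ independently receives a key ring $S_i$, uniformly distributed over all $K_n$-element subsets of a pool of $P_n$ keys; independently of the key rings, each pair of distinct nodes independently has an "on" channel with probability $p_n$; and two distinct nodes $v_i,v_j$ are adjacent if and only if $|S_i\cap S_j|\ge q$ and their channel is on. Let $p_{e,q}$ denote the probability that two given distinct nodes are adjacent in $\mathbb{G}_q$, and let $\delta$ be the minimum degree of $\mathbb{G}_q$. Assume that, as $n\to\infty$, $K_n\to\infty$ and $K_n^2/P_n\to 0$, and that $(\alpha_n)$ is a real sequence such that, for all sufficiently large $n$, $$p_{e,q}=\frac{\ln n+(k-1)\ln\ln n+\alpha_n}{n}.$$ If $\lim_{n\to\infty}\alpha_n$ exists in $[-\infty,\infty]$, then $$\lim_{n\to\infty}\mathbb{P}[\delta\ge k]=\begin{cases}e^{-\frac{e^{-\alpha^*}}{(k-1)!}} & \text{if }\lim_{n\to\infty}\alpha_n=\alpha^*\in(-\infty,\infty),\\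 1 & \text{if }\lim_{n\to\infty}\alpha_n=\infty,\\ 0 & \text{if }\lim_{n\to\infty}\alpha_n=-\infty.\end{cases}$$ -/

import Mathlib

open MeasureTheory ProbabilityTheory Filter Topology

noncomputable section

namespace QComposite

/-- A key ring: a set of exactly `K` different keys taken from a pool of `P` keys. -/
def KeyRing (P K : ℕ) : Type := {s : Finset (Fin P) // s.card = K}

instance (P K : ℕ) : Fintype (KeyRing P K) :=
  inferInstanceAs (Fintype {s : Finset (Fin P) // s.card = K})

instance (P K : ℕ) : MeasurableSpace (KeyRing P K) := ⊤

instance (P K : ℕ) : DiscreteMeasurableSpace (KeyRing P K) := ⟨fun _ => trivial⟩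

theorem KeyRing.nonempty {P K : ℕ} (h : K ≤ P) : Nonempty (KeyRing P K) := by
  obtain ⟨s, -, hs⟩ := Finset.exists_subset_card_eq
    (s := (Finset.univ : Finset (Fin P))) (n := K) (by simpa using h)
  exact ⟨⟨s, hs⟩⟩

/-- The graph in which two different nodes are adjacent when their key rings
share at least `q` keys. -/
def keyGraph (q : ℕ) {n P K : ℕ} (S : Fin n → KeyRing P K) : SimpleGraph (Fin n) where
  Adj i j := i ≠ j ∧ q ≤ ((S i).1 ∩ (S j).1).card
  symm := ⟨fun i j h => ⟨h.1.symm, by simpa only [Finset.inter_comm] using h.2⟩⟩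
  loopless := ⟨fun _ h => h.1 rfl⟩

/-- The joint law of the key rings, which are independent and uniformly distributed over all
`K`-element subsets of the pool, and of the graph of `on` channels, which is an independent
binomial (Erdős–Rényi) random graph with parameter `p`. -/
def jointLaw (n K P : ℕ) (p : unitInterval) :
    Measure ((Fin n → KeyRing P K) × SimpleGraph (Fin n)) :=
  (Measure.pi fun _ : Fin n => uniformOn (Set.univ : Set (KeyRing P K))).prod
    (SimpleGraph.binomialRandom (Fin n) p)

/-- The random graph `𝔾_q(n, K, P, p)`: the law of the intersection of the key graph and
the graph of `on` channels. -/
def graphLaw (q n K P : ℕ) (p : unitInterval) : Measure (SimpleGraph (Fin n)) :=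
  (jointLaw n K P p).map fun ω => keyGraph q ω.1 ⊓ ω.2

theorem measurableSingletonClass_simpleGraph (n : ℕ) :
    MeasurableSingletonClass (SimpleGraph (Fin n)) := by
  refine ⟨fun G => ?_⟩
  have h : ({G} : Set (SimpleGraph (Fin n))) = SimpleGraph.edgeSet ⁻¹' {G.edgeSet} := by
    ext H
    simp
  rw [h]
  exact SimpleGraph.measurable_edgeSet (measurableSet_singleton _)

/-- The sample space is finite and discrete, so the intersection graph is a random variable. -/
theorem measurable_inter (q n K P : ℕ) :
    Measurable fun ω : (Fin n → KeyRing P K) × SimpleGraph (Fin n) => keyGraph q ω.1 ⊓ ω.2 := by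
  have := measurableSingletonClass_simpleGraph n
  exact measurable_of_finite _

theorem isProbabilityMeasure_graphLaw (q n : ℕ) {K P : ℕ} (h : K ≤ P) (p : unitInterval) :
    IsProbabilityMeasure (graphLaw q n K P p) := by
  have := KeyRing.nonempty h
  have : IsProbabilityMeasure (uniformOn (Set.univ : Set (KeyRing P K))) :=
    isProbabilityMeasure_uniformOn Set.finite_univ Set.univ_nonempty
  have : IsProbabilityMeasure (jointLaw n K P p) := by
    unfold jointLaw; infer_instance
  exact Measure.isProbabilityMeasure_map (measurable_inter q n K P).aemeasurable

open scoped Classical in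
/-- The minimum degree of a graph on `n` nodes. -/
def minDeg {n : ℕ} (G : SimpleGraph (Fin n)) : ℕ := G.minDegree

end QComposite

end

/-! Let N be the number of nodes of degree below k, so that the event in question is N = 0, and let
y be n times the link probability π. For a fixed set R of r nodes, the probability that all of R
have degree below k is asymptotically `poisLow k y ^ r`, uniformly in R: the degrees behave like
independent Poisson(y) variables. Hence the j-th binomial moment of N is asymptotic to (n · `poisLow
k y`)^j / j! (`tendsto_lowMoment_div`). At the given scaling, n · `poisLow k y` tends to c =
e^{-α*}/(k-1)!, to 0 or to ∞. Bonferroni's inequalities then give e^{-c} in the first case, the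
first moment gives 1 in the second and Chebyshev's inequality gives 0 in the third.

The work lies in the joint estimate for R. Given the key rings of R, the other nodes choose their
neighbour sets in R independently with a common law ν (`nbrWeight`), and the probability that every
node of R is chosen fewer than k times is `lowSum`. If sets of size at least 2 are negligible,
`lowSum` factors over R into truncated binomial sums, which are compared with `poisLow`.

For the upper bound, n times the probability of choosing two given nodes must be small. Write x =
K²/P and l = ln n, where y ≤ 2l. If p ≤ 1/l², the second channel supplies this: n · pπ ≤ 2/l. If p >
1/l², two rings share q keys with probability at most 2l³/n, which forces x ≤ n^{-1/(2q)}
(`eventually_sq_div_le_exp`). The rings of R are then treated in three classes. Disjoint rings make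
the pair probability at most 2xπ. Rings with small overlaps have probability O(x), and a Chernoff
bound loses only a factor of order n^{1/(4q)}. Rings with an overlap of at least t keys have
probability O(x^t), negligible against `poisLow k y ^ r` for a suitable constant t.

For the lower bound, only disjoint rings are kept; since q ≥ 1 there are then no edges inside R, and
x → 0 suffices. -/

noncomputable section

namespace QComposite

/-! ### Weights of families that cover every point fewer than k times -/

section LowSum

open Finset

variable {ι W : Type*} [Fintype ι] [DecidableEq ι] [Fintype W] [DecidableEq W]

/-- The families `a` of subsets of `ι` in which every element of `ι` is covered fewer than `k`
times. -/
def lowSet (ι W : Type*) [Fintype ι] [DecidableEq ι] [Fintype W] [DecidableEq W] (k : ℕ) :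
    Finset (W → Finset ι) :=
  univ.filter fun a => ∀ i, (univ.filter fun w => i ∈ a w).card < k

/-- The weight of `lowSet` when the members of the family are independent with weights `ν`. -/
def lowSum (W : Type*) [Fintype W] [DecidableEq W] (k : ℕ) (ν : Finset ι → ℝ) : ℝ :=
  ∑ a ∈ lowSet ι W k, ∏ w, ν (a w)

/-- The truncated binomial sum `∑_{d < k} C(m, d) t ^ d`. -/
def binSum (k m : ℕ) (t : ℝ) : ℝ := ∑ d ∈ range k, (m.choose d : ℝ) * t ^ d

lemma mem_lowSet {k : ℕ} {a : W → Finset ι} :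
    a ∈ lowSet ι W k ↔ ∀ i, (univ.filter fun w => i ∈ a w).card < k := by
  simp [lowSet]

lemma sum_pow_card_lt (k : ℕ) (t : ℝ) :
    ∑ D ∈ (univ : Finset (Finset W)).filter (fun D => D.card < k), t ^ D.card =
      binSum k (Fintype.card W) t := by
  have h := Finset.sum_powerset_apply_card (f := fun d => if d < k then t ^ d else 0)
    (x := (univ : Finset W))
  rw [powerset_univ] at h
  rw [sum_filter, h, card_univ, binSum]
  simp only [nsmul_eq_mul, mul_ite, mul_zero]
  rw [← sum_filter]
  have : ∀ s : Finset ℕ, (∀ d ∈ range k, d ∈ s ∨ Fintype.card W < d) → (s ⊆ range k) →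
      ∑ d ∈ s, ((Fintype.card W).choose d : ℝ) * t ^ d =
        ∑ d ∈ range k, ((Fintype.card W).choose d : ℝ) * t ^ d := by
    intro s h1 h2
    refine sum_subset h2 fun d hd hds => ?_
    rcases h1 d hd with h | h
    · exact absurd h hds
    · rw [Nat.choose_eq_zero_of_lt h]; simp
  apply this
  · intro d hd
    simp only [mem_filter, mem_range] at hd ⊢
    omega
  · intro d hd
    simp only [mem_filter, mem_range] at hd ⊢
    omega

/-- Transposing the incidence relation turns subsets of `ι` indexed by `W` into subsets of `W`
indexed by `ι`. The covering condition becomes a separate size condition on each of them, and the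
weight only counts incidences, so the sum factors over `ι`. -/
lemma sum_lowSet_prod_pow_card (k : ℕ) (t : ℝ) :
    ∑ a ∈ lowSet ι W k, ∏ w, t ^ (a w).card =
      binSum k (Fintype.card W) t ^ Fintype.card ι := by
  rw [← sum_pow_card_lt (W := W) k t, ← card_univ (α := ι), ← prod_const,
    ← sum_prod_piFinset]
  refine sum_nbij' (fun a i => univ.filter fun w => i ∈ a w)
    (fun D w => univ.filter fun i => w ∈ D i) ?_ ?_ ?_ ?_ ?_
  · intro a ha
    simpa [mem_lowSet] using ha
  · intro D hD
    simpa [mem_lowSet] using hD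
  · intro a _; ext w i; simp
  · intro a _; ext w i; simp
  · intro a _
    rw [prod_pow_eq_pow_sum, prod_pow_eq_pow_sum]
    congr 1
    simp only [card_eq_sum_ones, sum_filter]
    rw [sum_comm]
    refine sum_congr rfl fun w _ => ?_
    simp

/-- Splitting off the coordinate `w₀` leaves a factor `E` that depends on `ψ` alone. The same `E`
serves every `φ`, which permits comparing a large value at `w₀` with the empty one. -/
lemma sum_update_mul (w₀ : W) (ψ : (W → Finset ι) → ℝ) :
    ∃ E : ℝ, (∀ φ : Finset ι → ℝ,
      ∑ a, φ (a w₀) * ψ (Function.update a w₀ ∅) = (∑ A, φ A) * E) ∧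
        ((∀ a, 0 ≤ ψ a) → 0 ≤ E) := by
  refine ⟨∑ b : {j // j ≠ w₀} → Finset ι, ψ ((Equiv.funSplitAt w₀ (Finset ι)).symm (∅, b)),
    fun φ => ?_, fun h => sum_nonneg fun _ _ => h _⟩
  rw [← (Equiv.funSplitAt w₀ (Finset ι)).symm.sum_comp, Fintype.sum_prod_type, sum_mul_sum]
  refine sum_congr rfl fun A _ => sum_congr rfl fun b _ => ?_
  congr 1
  · simp [Equiv.funSplitAt, Equiv.piSplitAt]
  · congr 1
    ext w i
    by_cases h : w = w₀
    · subst h; simp [Equiv.funSplitAt, Equiv.piSplitAt]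
    · simp [Equiv.funSplitAt, Equiv.piSplitAt, Function.update, h]

lemma update_empty_mem_lowSet {k : ℕ} {a : W → Finset ι} (ha : a ∈ lowSet ι W k) (w₀ : W) :
    Function.update a w₀ ∅ ∈ lowSet ι W k := by
  rw [mem_lowSet] at ha ⊢
  intro i
  refine lt_of_le_of_lt (card_le_card fun w hw => ?_) (ha i)
  simp only [mem_filter, mem_univ, true_and] at hw ⊢
  by_cases h : w = w₀
  · subst h; simp at hw
  · simpa [Function.update, h] using hw

/-- Making the member `w₀` of a low family empty leaves it low, so the families with a large
member are controlled by the total weight of the low families. -/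
lemma sum_lowSet_two_le_mul_le (k : ℕ) (ν : Finset ι → ℝ) (hν : ∀ A, 0 ≤ ν A) (w₀ : W)
    {η θ : ℝ} (hη : ∑ A with 2 ≤ A.card, ν A ≤ η) (hθ : η ≤ θ * ν ∅) (h0 : 0 ≤ θ) :
    ∑ a ∈ (lowSet ι W k).filter (fun a => 2 ≤ (a w₀).card), ∏ w, ν (a w) ≤
      θ * lowSum W k ν := by
  classical
  obtain ⟨E, hE, hE0⟩ := sum_update_mul w₀ (fun a =>
    if a ∈ lowSet ι W k then ∏ w ∈ univ.erase w₀, ν (a w) else 0)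
  have hE0' : 0 ≤ E := hE0 fun a => by
    split_ifs
    · exact prod_nonneg fun _ _ => hν _
    · exact le_rfl
  have key : ∀ a : W → Finset ι, ∏ w ∈ univ.erase w₀, ν (Function.update a w₀ ∅ w) =
      ∏ w ∈ univ.erase w₀, ν (a w) := fun a => prod_congr rfl fun w hw => by
    rw [Function.update_of_ne (ne_of_mem_erase hw)]
  have h1 : ∑ a ∈ (lowSet ι W k).filter (fun a => 2 ≤ (a w₀).card), ∏ w, ν (a w) ≤ η * E := by
    calc _ ≤ ∑ a : W → Finset ι, (fun A : Finset ι => if 2 ≤ A.card then ν A else 0) (a w₀) *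
          (if Function.update a w₀ ∅ ∈ lowSet ι W k then
            ∏ w ∈ univ.erase w₀, ν (Function.update a w₀ ∅ w) else 0) := by
          rw [← sum_filter_add_sum_filter_not univ
            (fun a => a ∈ (lowSet ι W k).filter (fun a => 2 ≤ (a w₀).card)), filter_univ_mem]
          refine le_add_of_le_of_nonneg (le_of_eq ?_) (sum_nonneg fun a _ => ?_)
          · refine sum_congr rfl fun a ha => ?_
            rw [mem_filter] at ha
            rw [if_pos (update_empty_mem_lowSet ha.1 w₀), key, ← mul_prod_erase univ _ (mem_univ w₀)]
            simp [ha.2]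
          · refine mul_nonneg ?_ ?_
            · dsimp only; split_ifs
              · exact hν _
              · exact le_rfl
            · split_ifs
              · exact prod_nonneg fun _ _ => hν _
              · exact le_rfl
      _ = (∑ A : Finset ι, if 2 ≤ A.card then ν A else 0) * E := hE (fun A : Finset ι => if 2 ≤ A.card then ν A else 0)
      _ ≤ η * E := by
          refine mul_le_mul_of_nonneg_right ?_ hE0'
          rwa [← sum_filter]
  -- Taking `φ` concentrated at `∅` identifies `ν ∅ * E` with the part of `lowSum` in which the
  -- member at `w₀` is empty.
  have h2 : ν ∅ * E ≤ lowSum W k ν := by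
    have h := hE (fun A => if A = ∅ then ν A else 0)
    rw [sum_ite_eq' univ ∅ ν, if_pos (mem_univ _)] at h
    have h' : lowSum W k ν = ∑ a, if a ∈ lowSet ι W k then ∏ w, ν (a w) else 0 := by
      rw [lowSum, ← sum_filter, filter_univ_mem]
    rw [← h, h']
    refine sum_le_sum fun a _ => ?_
    by_cases ha : a w₀ = ∅
    · have hu : Function.update a w₀ ∅ = a := by rw [← ha]; exact Function.update_eq_self _ _
      rw [hu, if_pos ha]
      split_ifs
      · rw [mul_prod_erase univ (fun w => ν (a w)) (mem_univ w₀)]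
      · simp
    · rw [if_neg ha, zero_mul]
      split_ifs
      · exact prod_nonneg fun _ _ => hν _
      · exact le_rfl
  calc _ ≤ η * E := h1
    _ ≤ θ * ν ∅ * E := mul_le_mul_of_nonneg_right hθ hE0'
    _ = θ * (ν ∅ * E) := by ring
    _ ≤ _ := mul_le_mul_of_nonneg_left h2 h0

lemma lowSum_nonneg (k : ℕ) {ν : Finset ι → ℝ} (hν : ∀ A, 0 ≤ ν A) : 0 ≤ lowSum W k ν :=
  sum_nonneg fun _ _ => prod_nonneg fun _ _ => hν _

/-- Union bound over the index of a member with at least two elements; each index accounts for at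
most a fraction `θ` of the total. -/
lemma lowSum_sub_le (k : ℕ) (ν : Finset ι → ℝ) (hν : ∀ A, 0 ≤ ν A)
    {η θ : ℝ} (hη : ∑ A with 2 ≤ A.card, ν A ≤ η) (hθ : η ≤ θ * ν ∅) (h0 : 0 ≤ θ) :
    (1 - Fintype.card W * θ) * lowSum W k ν ≤
      ∑ a ∈ (lowSet ι W k).filter (fun a => ∀ w, (a w).card ≤ 1), ∏ w, ν (a w) := by
  have h1 : ∑ a ∈ (lowSet ι W k).filter (fun a => ¬ ∀ w, (a w).card ≤ 1), ∏ w, ν (a w) ≤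
      ∑ w₀, ∑ a ∈ (lowSet ι W k).filter (fun a => 2 ≤ (a w₀).card), ∏ w, ν (a w) := by
    simp only [sum_filter]
    rw [sum_comm]
    refine sum_le_sum fun a _ => ?_
    have hp : 0 ≤ ∏ w, ν (a w) := prod_nonneg fun _ _ => hν _
    split_ifs with h
    · exact sum_nonneg fun w _ => by split_ifs <;> simp [hp]
    · push Not at h
      obtain ⟨w, hw⟩ := h
      have := single_le_sum (f := fun w => if 2 ≤ (a w).card then ∏ w, ν (a w) else 0)
        (fun w _ => by split_ifs <;> simp [hp]) (mem_univ w)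
      rw [if_pos (by omega)] at this
      exact this
  have h2 := sum_filter_add_sum_filter_not (lowSet ι W k)
    (fun a => ∀ w, (a w).card ≤ 1) (fun a => ∏ w, ν (a w))
  have h3 : ∑ w₀ : W, ∑ a ∈ (lowSet ι W k).filter (fun a => 2 ≤ (a w₀).card), ∏ w, ν (a w) ≤
      ∑ _w₀ : W, θ * lowSum W k ν :=
    sum_le_sum fun w₀ _ => sum_lowSet_two_le_mul_le k ν hν w₀ hη hθ h0
  rw [sum_const, card_univ, nsmul_eq_mul] at h3
  rw [← lowSum] at h2
  linarith

/-- On sets of size at most 1, `ν` is dominated by e^{-c} (ρ e^{c'})^{|A|}, where e^{c'} offsets the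
factor e^{-c} charged to singletons too. For these weights the size restriction can be dropped and
`sum_lowSet_prod_pow_card` evaluates the sum. -/
lemma lowSum_le (k : ℕ) (ν : Finset ι → ℝ) (hν : ∀ A, 0 ≤ ν A)
    {η θ c c' ρ : ℝ} (hη : ∑ A with 2 ≤ A.card, ν A ≤ η) (hθ : η ≤ θ * ν ∅) (h0 : 0 ≤ θ)
    (hc : ν ∅ ≤ Real.exp (-c)) (hcc : c ≤ c') (hρ : 0 ≤ ρ) (h1 : ∀ i, ν {i} ≤ ρ) :
    (1 - Fintype.card W * θ) * lowSum W k ν ≤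
      Real.exp (-(c * Fintype.card W)) *
        binSum k (Fintype.card W) (ρ * Real.exp c') ^ Fintype.card ι := by
  refine (lowSum_sub_le k ν hν hη hθ h0).trans ?_
  rw [← sum_lowSet_prod_pow_card, mul_sum]
  have hsub := sum_le_sum_of_subset_of_nonneg
    (f := fun a => Real.exp (-(c * Fintype.card W)) * ∏ w, (ρ * Real.exp c') ^ (a w).card)
    (filter_subset (fun a : W → Finset ι => ∀ w, (a w).card ≤ 1) (lowSet ι W k))
    fun a _ _ => by positivity
  refine le_trans (sum_le_sum fun a ha => ?_) hsub
  have : Real.exp (-(c * Fintype.card W)) = ∏ _w : W, Real.exp (-c) := by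
    rw [prod_const, card_univ, ← Real.exp_nat_mul]; ring_nf
  rw [this, ← prod_mul_distrib]
  refine prod_le_prod (fun _ _ => hν _) fun w _ => ?_
  have hw := (mem_filter.1 ha).2 w
  rcases Nat.le_one_iff_eq_zero_or_eq_one.1 hw with h | h
  · rw [card_eq_zero.1 h]; simpa using hc
  · obtain ⟨i, hi⟩ := card_eq_one.1 h
    rw [hi, card_singleton, pow_one, mul_left_comm, ← Real.exp_add]
    refine (h1 i).trans (le_mul_of_one_le_right hρ ?_)
    exact Real.one_le_exp (by linarith)

/-- On sets of size at most 1, `ν` dominates `ν ∅` · ρ^{|A|}. The restriction to such sets is paid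
for by `lowSum_sub_le`, applied to the weights ρ^{|A|} themselves: there are at most 2^{|ι|} larger
sets, each of weight at most ρ². -/
lemma le_lowSum (k : ℕ) (ν : Finset ι → ℝ) (hν : ∀ A, 0 ≤ ν A) {ρ : ℝ}
    (h0 : ν ∅ ≤ 1) (hρ : 0 ≤ ρ) (hρ1 : ρ ≤ 1) (h1 : ∀ i, ρ ≤ ν {i}) :
    ν ∅ ^ Fintype.card W * ((1 - Fintype.card W * (2 ^ Fintype.card ι * ρ ^ 2)) *
        binSum k (Fintype.card W) ρ ^ Fintype.card ι) ≤ lowSum W k ν := by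
  have hη : ∑ A : Finset ι with 2 ≤ A.card, ρ ^ A.card ≤ 2 ^ Fintype.card ι * ρ ^ 2 := by
    calc _ ≤ ∑ A : Finset ι with 2 ≤ A.card, ρ ^ 2 :=
          sum_le_sum fun A hA => pow_le_pow_of_le_one hρ hρ1 (mem_filter.1 hA).2
      _ ≤ ∑ A : Finset ι, ρ ^ 2 :=
          sum_le_sum_of_subset_of_nonneg (filter_subset _ _) fun _ _ _ => by positivity
      _ = _ := by simp
  have h := lowSum_sub_le (W := W) k (fun A : Finset ι => ρ ^ A.card) (fun A => by positivity)
    hη (θ := 2 ^ Fintype.card ι * ρ ^ 2) (by simp) (by positivity)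
  rw [lowSum, sum_lowSet_prod_pow_card] at h
  refine (mul_le_mul_of_nonneg_left h (pow_nonneg (hν _) _)).trans ?_
  rw [mul_sum]
  have hsub := sum_le_sum_of_subset_of_nonneg (f := fun a => ∏ w, ν (a w))
    (filter_subset (fun a : W → Finset ι => ∀ w, (a w).card ≤ 1) (lowSet ι W k))
    fun a _ _ => prod_nonneg fun _ _ => hν _
  refine le_trans (sum_le_sum fun a ha => ?_) hsub
  have : ν ∅ ^ Fintype.card W = ∏ _w : W, ν ∅ := by rw [prod_const, card_univ]
  rw [this, ← prod_mul_distrib]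
  refine prod_le_prod (fun _ _ => mul_nonneg (hν _) (by positivity)) fun w _ => ?_
  have hw := (mem_filter.1 ha).2 w
  rcases Nat.le_one_iff_eq_zero_or_eq_one.1 hw with h | h
  · rw [card_eq_zero.1 h]; simp
  · obtain ⟨i, hi⟩ := card_eq_one.1 h
    rw [hi, card_singleton, pow_one]
    exact (mul_le_of_le_one_left hρ h0).trans (h1 i)

/-- Chernoff's method: a low family has at most |ι|·k nonempty members, so weighting each of them by
z and multiplying by z^{-|ι|k} can only increase the sum, which then factors over `W`. Nothing is
assumed about large members of the family. -/
lemma lowSum_le_exp (k : ℕ) (ν : Finset ι → ℝ) (hν : ∀ A, 0 ≤ ν A) (h1 : ∑ A, ν A = 1) {z : ℝ}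
    (hz : 0 < z) (hz1 : z ≤ 1) :
    lowSum W k ν ≤ (z⁻¹) ^ (Fintype.card ι * k) *
      Real.exp (-(Fintype.card W * ((1 - z) * (1 - ν ∅)))) := by
  have hz' : 1 ≤ z⁻¹ := (one_le_inv₀ hz).2 hz1
  have hsum : ∑ A, ν A * (if A = ∅ then 1 else z) = ν ∅ + z * (1 - ν ∅) := by
    have : ∀ A : Finset ι, ν A * (if A = ∅ then 1 else z) =
        z * ν A + (if A = ∅ then (1 - z) * ν A else 0) := by
      intro A; split_ifs <;> ring
    rw [sum_congr rfl fun A _ => this A, sum_add_distrib, ← mul_sum, h1, sum_ite_eq' univ ∅,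
      if_pos (mem_univ _)]
    ring
  have hle : ν ∅ + z * (1 - ν ∅) ≤ Real.exp (-((1 - z) * (1 - ν ∅))) := by
    have := Real.add_one_le_exp (-((1 - z) * (1 - ν ∅)))
    linarith
  have h0 : 0 ≤ ν ∅ + z * (1 - ν ∅) := by
    rw [← hsum]
    exact sum_nonneg fun A _ => mul_nonneg (hν A) (by split_ifs <;> [norm_num; exact hz.le])
  calc lowSum W k ν ≤ ∑ a : W → Finset ι, (z⁻¹) ^ (Fintype.card ι * k) *
        ∏ w, (ν (a w) * (if a w = ∅ then 1 else z)) := by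
        rw [lowSum]
        refine le_trans (sum_le_sum fun a ha => ?_) (sum_le_sum_of_subset_of_nonneg
          (subset_univ (lowSet ι W k)) fun a _ _ => ?_)
        · rw [prod_mul_distrib, mul_left_comm]
          refine le_mul_of_one_le_right (prod_nonneg fun _ _ => hν _) ?_
          have h2 : ∏ w, (if a w = ∅ then 1 else z) =
              z ^ (univ.filter fun w => ¬ a w = ∅).card := by
            rw [prod_ite]; simp
          have h3 : (univ.filter fun w => ¬ a w = ∅).card ≤ Fintype.card ι * k := by
            have : (univ.filter fun w => ¬ a w = ∅) ⊆
                univ.biUnion fun i => univ.filter fun w => i ∈ a w := by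
              intro w hw
              simp only [mem_filter, mem_univ, true_and, mem_biUnion] at hw ⊢
              exact nonempty_iff_ne_empty.2 hw
            refine (card_le_card this).trans (card_biUnion_le.trans ?_)
            rw [← card_univ (α := ι), ← smul_eq_mul]
            exact sum_le_card_nsmul _ _ _ fun i _ => (mem_lowSet.1 ha i).le
          rw [h2]
          calc (1 : ℝ) = (z⁻¹) ^ (univ.filter fun w => ¬ a w = ∅).card *
                z ^ (univ.filter fun w => ¬ a w = ∅).card := by
                rw [← mul_pow, inv_mul_cancel₀ hz.ne', one_pow]
            _ ≤ _ := by
                gcongr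
        · refine mul_nonneg (by positivity) (prod_nonneg fun w _ => mul_nonneg (hν _) ?_)
          split_ifs <;> [norm_num; exact hz.le]
    _ = (z⁻¹) ^ (Fintype.card ι * k) * (ν ∅ + z * (1 - ν ∅)) ^ Fintype.card W := by
        rw [← mul_sum, ← hsum, ← card_univ (α := W), ← prod_const, prod_univ_sum]
        simp
    _ ≤ _ := by
        refine mul_le_mul_of_nonneg_left ?_ (by positivity)
        refine (pow_le_pow_left₀ h0 hle _).trans (le_of_eq ?_)
        rw [← Real.exp_nat_mul]; ring_nf

end LowSum

/-! ### Uniform key rings and the probability of shared keys -/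

section Counting

open Finset

/-- The expectation of `f` over a uniformly random key ring. -/
def ringAvg {P K : ℕ} (f : KeyRing P K → ℝ) : ℝ := (∑ T, f T) / (P.choose K : ℝ)

/-- The probability that a fixed set of `t` keys is part of a random key ring. -/
def inclProb (P K t : ℕ) : ℝ := (K.choose t : ℝ) / (P.choose t : ℝ)

lemma card_keyRing (P K : ℕ) : Fintype.card (KeyRing P K) = P.choose K := by
  have := Fintype.card_finset_len (α := Fin P) K
  rw [Fintype.card_fin] at this
  rw [← this]
  exact Fintype.card_congr (Equiv.refl _)

section Avg

variable {P K : ℕ} {f g : KeyRing P K → ℝ}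

lemma ringAvg_mono (h : ∀ T, f T ≤ g T) : ringAvg f ≤ ringAvg g := by
  unfold ringAvg
  gcongr with T
  exact h T

lemma ringAvg_nonneg (h : ∀ T, 0 ≤ f T) : 0 ≤ ringAvg f :=
  div_nonneg (sum_nonneg fun T _ => h T) (Nat.cast_nonneg _)

lemma ringAvg_add : ringAvg (fun T => f T + g T) = ringAvg f + ringAvg g := by
  simp only [ringAvg, sum_add_distrib, add_div]

lemma ringAvg_sum {ι : Type*} (s : Finset ι) (F : ι → KeyRing P K → ℝ) :
    ringAvg (fun T => ∑ i ∈ s, F i T) = ∑ i ∈ s, ringAvg (F i) := by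
  simp only [ringAvg]
  rw [sum_comm, sum_div]

lemma ringAvg_mul_left (c : ℝ) : ringAvg (fun T => c * f T) = c * ringAvg f := by
  simp only [ringAvg, ← mul_sum, mul_div_assoc]

lemma ringAvg_const (h : K ≤ P) (c : ℝ) : ringAvg (fun _ : KeyRing P K => c) = c := by
  have : (0 : ℝ) < P.choose K := by exact_mod_cast Nat.choose_pos h
  rw [ringAvg, sum_const, card_univ, card_keyRing, nsmul_eq_mul]
  field_simp

end Avg

lemma sum_keyRing {P K : ℕ} (f : Finset (Fin P) → ℝ) :
    ∑ T : KeyRing P K, f T.1 = ∑ T ∈ powersetCard K univ, f T := by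
  refine sum_bij (fun (T : KeyRing P K) _ => T.1) ?_ ?_ ?_ ?_
  · intro T _; simp [mem_powersetCard, T.2]
  · intro T _ T' _ h; exact Subtype.ext h
  · intro T hT; exact ⟨⟨T, (mem_powersetCard.1 hT).2⟩, mem_univ _, rfl⟩
  · intro T _; rfl

lemma card_filter_superset_powersetCard {α : Type*} [DecidableEq α] {A B : Finset α} {q : ℕ}
    (hB : B ⊆ A) (hq : B.card ≤ q) :
    ((powersetCard q A).filter fun Q => B ⊆ Q).card = (A.card - B.card).choose (q - B.card) := by
  rw [← card_sdiff_of_subset hB, ← card_powersetCard]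
  refine card_nbij' (fun Q => Q \ B) (fun R => R ∪ B) ?_ ?_ ?_ ?_
  · intro Q hQ
    simp only [coe_filter, mem_powersetCard, Set.mem_ofPred_eq, mem_coe] at hQ ⊢
    exact ⟨sdiff_subset_sdiff hQ.1.1 le_rfl, by rw [card_sdiff_of_subset hQ.2, hQ.1.2]⟩
  · intro R hR
    simp only [coe_filter, mem_powersetCard, Set.mem_ofPred_eq, mem_coe] at hR ⊢
    have hd : Disjoint R B := disjoint_of_subset_left hR.1 sdiff_disjoint
    refine ⟨⟨union_subset (hR.1.trans sdiff_subset) hB, ?_⟩, subset_union_right⟩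
    rw [card_union_of_disjoint hd, hR.2]; omega
  · intro Q hQ
    simp only [coe_filter, Set.mem_ofPred_eq] at hQ
    exact sdiff_union_of_subset hQ.2
  · intro R hR
    simp only [mem_powersetCard, mem_coe] at hR
    have hd : Disjoint R B := disjoint_of_subset_left hR.1 sdiff_disjoint
    exact union_sdiff_cancel_right hd

/-- Rings containing B number C(P-b, K-b), with b = |B|, and C(P,K) C(K,b) = C(P,b) C(P-b,K-b). -/
lemma ringAvg_subset {P K : ℕ} (h : K ≤ P) (B : Finset (Fin P)) :
    ringAvg (fun T : KeyRing P K => if B ⊆ T.1 then (1 : ℝ) else 0) = inclProb P K B.card := by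
  have hB : B.card ≤ P := by simpa using card_le_univ B
  have h1 : (0 : ℝ) < P.choose K := by exact_mod_cast Nat.choose_pos h
  have h2 : (0 : ℝ) < P.choose B.card := by exact_mod_cast Nat.choose_pos hB
  rw [ringAvg, sum_keyRing (fun T => if B ⊆ T then (1 : ℝ) else 0), inclProb, sum_boole,
    div_eq_div_iff h1.ne' h2.ne']
  norm_cast
  by_cases hK : B.card ≤ K
  · rw [card_filter_superset_powersetCard (subset_univ B) hK, card_univ, Fintype.card_fin,
      mul_comm, mul_comm (K.choose _), Nat.choose_mul hK]
  · rw [Nat.choose_eq_zero_of_lt (not_le.1 hK), zero_mul, card_eq_zero.2, zero_mul]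
    rw [filter_eq_empty_iff]
    intro T hT hBT
    have := card_le_card hBT
    rw [(mem_powersetCard.1 hT).2] at this
    exact hK this

lemma inclProb_nonneg (P K t : ℕ) : 0 ≤ inclProb P K t := by unfold inclProb; positivity

/-- For t < K the ratio of consecutive terms is (K - t)/(P - t), which is at most K/P because K ≤ P.
-/
lemma inclProb_succ_le {P K : ℕ} (h : K ≤ P) (t : ℕ) :
    inclProb P K (t + 1) ≤ inclProb P K t * ((K : ℝ) / P) := by
  unfold inclProb
  by_cases ht : t < K
  · have h1 : ((K.choose (t + 1) : ℕ) : ℝ) * (t + 1) = K.choose t * (K - t) := by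
      have := Nat.choose_succ_right_eq K t
      rw [← Nat.cast_sub ht.le]; exact_mod_cast this
    have h2 : ((P.choose (t + 1) : ℕ) : ℝ) * (t + 1) = P.choose t * (P - t) := by
      have := Nat.choose_succ_right_eq P t
      rw [← Nat.cast_sub (ht.le.trans h)]; exact_mod_cast this
    have hp1 : (0 : ℝ) < P.choose (t + 1) := by exact_mod_cast Nat.choose_pos (by omega)
    have hp2 : (0 : ℝ) < P.choose t := by exact_mod_cast Nat.choose_pos (by omega)
    have hP : (0 : ℝ) < P := by exact_mod_cast (by omega : 0 < P)
    have hKP : (K : ℝ) ≤ P := by exact_mod_cast h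
    rw [div_mul_div_comm, div_le_div_iff₀ hp1 (by positivity)]
    have ht1 : (0 : ℝ) < t + 1 := by positivity
    refine le_of_mul_le_mul_right ?_ ht1
    calc (K.choose (t + 1) : ℝ) * (P.choose t * P) * (t + 1)
        = (K.choose (t + 1) * (t + 1)) * (P.choose t * P) := by ring
      _ = K.choose t * P.choose t * ((K - t) * P) := by rw [h1]; ring
      _ ≤ K.choose t * P.choose t * (K * (P - t)) := by
          refine mul_le_mul_of_nonneg_left ?_ (by positivity)
          nlinarith [(Nat.cast_nonneg t : (0 : ℝ) ≤ t)]
      _ = K.choose t * K * (P.choose t * (P - t)) := by ring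
      _ = _ := by rw [← h2]; ring
  · rw [Nat.choose_eq_zero_of_lt (by omega : K < t + 1)]
    simp only [Nat.cast_zero, zero_div]
    positivity

lemma inclProb_le {P K : ℕ} (h : K ≤ P) (t : ℕ) : inclProb P K t ≤ ((K : ℝ) / P) ^ t := by
  induction t with
  | zero => simp [inclProb]
  | succ t ih =>
    refine (inclProb_succ_le h t).trans ?_
    rw [pow_succ]
    gcongr

lemma sum_powersetCard_subset {α : Type*} [DecidableEq α] (A T : Finset α) (t : ℕ) :
    ∑ B ∈ powersetCard t A, (if B ⊆ T then (1 : ℝ) else 0) = ((T ∩ A).card.choose t : ℝ) := by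
  rw [sum_boole, ← card_powersetCard]
  congr 2
  ext B
  simp only [mem_filter, mem_powersetCard, subset_inter_iff]
  tauto

lemma ringAvg_choose {P K : ℕ} (h : K ≤ P) (A : Finset (Fin P)) (t : ℕ) :
    ringAvg (fun T : KeyRing P K => ((T.1 ∩ A).card.choose t : ℝ)) =
      A.card.choose t * inclProb P K t := by
  simp only [← sum_powersetCard_subset]
  rw [ringAvg_sum, sum_congr rfl fun B _ => ringAvg_subset h B,
    sum_congr rfl fun B hB => by rw [(mem_powersetCard.1 hB).2], sum_const, card_powersetCard,
    nsmul_eq_mul]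

/-- Markov's inequality for the number of `t`-sets of common keys. -/
lemma ringAvg_le_card_inter_le {P K : ℕ} (h : K ≤ P) (A : KeyRing P K) (t : ℕ) :
    ringAvg (fun T : KeyRing P K => if t ≤ (T.1 ∩ A.1).card then (1 : ℝ) else 0) ≤
      ((K : ℝ) ^ 2 / P) ^ t := by
  calc _ ≤ ringAvg (fun T : KeyRing P K => ((T.1 ∩ A.1).card.choose t : ℝ)) := by
        refine ringAvg_mono fun T => ?_
        split_ifs with hT
        · exact_mod_cast Nat.choose_pos hT
        · positivity
    _ = K.choose t * inclProb P K t := by rw [ringAvg_choose h, A.2]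
    _ ≤ (K : ℝ) ^ t * ((K : ℝ) / P) ^ t := by
        refine mul_le_mul (by exact_mod_cast Nat.choose_le_pow K t) (inclProb_le h t)
          (inclProb_nonneg _ _ _) (by positivity)
    _ = _ := by rw [← mul_pow]; congr 1; ring

/-- The probability that the key rings of two nodes share at least `q` keys. -/
def shareProb (q P K : ℕ) : ℝ :=
  ringAvg fun A : KeyRing P K => ringAvg fun T : KeyRing P K =>
    if q ≤ (T.1 ∩ A.1).card then (1 : ℝ) else 0

/-- The expected number of `q`-sets of keys that two nodes share. -/
def shareMean (q P K : ℕ) : ℝ := K.choose q * inclProb P K q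

/-- A permutation of the pool carrying `A` to `B` preserves the uniform law of `T`. -/
lemma ringAvg_share_congr {P K : ℕ} (q : ℕ) (A B : KeyRing P K) :
    ringAvg (fun T : KeyRing P K => if q ≤ (T.1 ∩ A.1).card then (1 : ℝ) else 0) =
      ringAvg (fun T : KeyRing P K => if q ≤ (T.1 ∩ B.1).card then (1 : ℝ) else 0) := by
  classical
  unfold ringAvg
  congr 1
  let e₀ : {x // x ∈ A.1} ≃ {x // x ∈ B.1} := equivOfCardEq (A.2.trans B.2.symm)
  let e : Equiv.Perm (Fin P) := e₀.extendSubtype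
  have he : A.1.map e.toEmbedding = B.1 := by
    refine eq_of_subset_of_card_le (fun y hy => ?_) (by rw [card_map, A.2, B.2])
    obtain ⟨x, hx, rfl⟩ := mem_map.1 hy
    exact e₀.extendSubtype_mem x hx
  rw [sum_keyRing (fun T => if q ≤ (T ∩ A.1).card then (1 : ℝ) else 0),
    sum_keyRing (fun T => if q ≤ (T ∩ B.1).card then (1 : ℝ) else 0)]
  refine sum_nbij' (fun T => T.map e.toEmbedding) (fun T => T.map e.symm.toEmbedding)
    ?_ ?_ ?_ ?_ ?_
  · intro T hT; simpa [mem_powersetCard] using hT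
  · intro T hT; simpa [mem_powersetCard] using hT
  · intro T _; ext x; simp
  · intro T _; ext x; simp
  · intro T _
    rw [← he, ← map_inter, card_map]

lemma ringAvg_share {P K : ℕ} (h : K ≤ P) (q : ℕ) (A : KeyRing P K) :
    ringAvg (fun T : KeyRing P K => if q ≤ (T.1 ∩ A.1).card then (1 : ℝ) else 0) =
      shareProb q P K := by
  rw [shareProb, ← ringAvg_const h (ringAvg (fun T : KeyRing P K =>
    if q ≤ (T.1 ∩ A.1).card then (1 : ℝ) else 0))]
  congr 1
  ext B
  exact ringAvg_share_congr q A B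

lemma shareProb_nonneg (q P K : ℕ) : 0 ≤ shareProb q P K :=
  ringAvg_nonneg fun _ => ringAvg_nonneg fun _ => by split_ifs <;> norm_num

lemma shareMean_nonneg (q P K : ℕ) : 0 ≤ shareMean q P K :=
  mul_nonneg (Nat.cast_nonneg _) (inclProb_nonneg _ _ _)

/-- With h = q + j one has (q+1) C(h,q+1) = j C(h,q), and qj ≥ q + 1 once j ≥ 2. The constant 1 is
needed only for j = 0 and j = 1. -/
lemma choose_le_one_add {q : ℕ} (hq : 1 ≤ q) {h : ℕ} (hh : q ≤ h) :
    h.choose q ≤ 1 + q * h.choose (q + 1) := by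
  obtain ⟨j, rfl⟩ := Nat.exists_eq_add_of_le hh
  have key := Nat.choose_succ_right_eq (q + j) q
  rw [Nat.add_sub_cancel_left] at key
  rcases Nat.lt_or_ge j 2 with hj | hj
  · interval_cases j
    · simp
    · simp [Nat.add_comm]
  · refine le_of_mul_le_mul_right (a := q + 1) ?_ (by omega)
    have : (1 + q * (q + j).choose (q + 1)) * (q + 1) =
      q + 1 + q * ((q + j).choose q * j) := by rw [← key]; ring
    rw [this]
    have h1 : (q + j).choose q * (q + 1) ≤ (q + j).choose q * (q * j) :=
      Nat.mul_le_mul_left _ (by nlinarith)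
    nlinarith

lemma choose_mul_inclProb_succ_le {P K : ℕ} (h : K ≤ P) (q : ℕ) :
    K.choose (q + 1) * inclProb P K (q + 1) ≤ shareMean q P K * ((K : ℝ) ^ 2 / P) := by
  have h1 : (K.choose (q + 1) : ℝ) ≤ K.choose q * K := by
    have h2 := Nat.choose_succ_right_eq K q
    have : K.choose (q + 1) ≤ K.choose q * K := by
      calc K.choose (q + 1) ≤ K.choose (q + 1) * (q + 1) := Nat.le_mul_of_pos_right _ (by omega)
        _ = K.choose q * (K - q) := h2
        _ ≤ _ := Nat.mul_le_mul_left _ (Nat.sub_le _ _)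
    exact_mod_cast this
  calc _ ≤ (K.choose q * K : ℝ) * (inclProb P K q * ((K : ℝ) / P)) :=
        mul_le_mul h1 (inclProb_succ_le h q) (inclProb_nonneg _ _ _) (by positivity)
    _ = _ := by unfold shareMean; ring

/-- Averaging `choose_le_one_add` compares the mean number of shared `q`-sets with the probability
of sharing one; the correction counts shared (q+1)-sets, whose mean is smaller by a factor K²/P. -/
lemma le_shareProb {P K q : ℕ} (h : K ≤ P) (hq : 1 ≤ q) :
    (1 - q * ((K : ℝ) ^ 2 / P)) * shareMean q P K ≤ shareProb q P K := by
  obtain ⟨A⟩ := KeyRing.nonempty h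
  have h1 : ringAvg (fun T : KeyRing P K => ((T.1 ∩ A.1).card.choose q : ℝ)) ≤
      ringAvg (fun T : KeyRing P K => (if q ≤ (T.1 ∩ A.1).card then (1 : ℝ) else 0) +
        q * ((T.1 ∩ A.1).card.choose (q + 1) : ℝ)) := by
    refine ringAvg_mono fun T => ?_
    split_ifs with hT
    · exact_mod_cast choose_le_one_add hq hT
    · rw [Nat.choose_eq_zero_of_lt (not_le.1 hT)]; push_cast; positivity
  rw [ringAvg_add, ringAvg_mul_left, ringAvg_choose h, ringAvg_choose h, ringAvg_share h, A.2,
    ← shareMean] at h1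
  have h2 := mul_le_mul_of_nonneg_left (choose_mul_inclProb_succ_le h q)
    (Nat.cast_nonneg q : (0 : ℝ) ≤ q)
  linarith

/-- For K ≥ 2q the factors of K(K-1)⋯(K-q+1) are at least K/2. Two such products occur, whence 4^q.
This lets a bound on the sharing probability be turned into a bound on K²/P. -/
lemma pow_le_shareMean {P K q : ℕ} (h : K ≤ P) (hP : 0 < P) (hK : 2 * q ≤ K) :
    ((K : ℝ) ^ 2 / P) ^ q ≤ 4 ^ q * q.factorial * shareMean q P K := by
  have hPq : (0 : ℝ) < P.choose q := by exact_mod_cast Nat.choose_pos (by omega)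
  have hP' : (0 : ℝ) < P := by exact_mod_cast hP
  have hf : (0 : ℝ) < q.factorial := by exact_mod_cast q.factorial_pos
  have h1 : (K : ℝ) ^ q ≤ 2 ^ q * (q.factorial * K.choose q) := by
    have h2 : ((K + 1 - q : ℕ) : ℝ) ^ q ≤ q.factorial * K.choose q := by
      have := Nat.pow_le_choose (α := ℝ) q K
      rw [div_le_iff₀ hf] at this
      linarith
    have h3 : (K : ℝ) ≤ 2 * ((K + 1 - q : ℕ) : ℝ) := by
      exact_mod_cast (by omega : K ≤ 2 * (K + 1 - q))
    calc (K : ℝ) ^ q ≤ (2 * ((K + 1 - q : ℕ) : ℝ)) ^ q := by gcongr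
      _ = 2 ^ q * ((K + 1 - q : ℕ) : ℝ) ^ q := mul_pow _ _ _
      _ ≤ _ := by gcongr
  have h4 : (q.factorial : ℝ) * P.choose q ≤ (P : ℝ) ^ q := by
    have := Nat.choose_le_pow_div (α := ℝ) q P
    rw [le_div_iff₀ hf] at this
    linarith
  unfold shareMean inclProb
  rw [div_pow, div_le_iff₀ (by positivity)]
  calc ((K : ℝ) ^ 2) ^ q = (K : ℝ) ^ q * (K : ℝ) ^ q := by ring
    _ ≤ (2 ^ q * (q.factorial * K.choose q)) * (2 ^ q * (q.factorial * K.choose q)) := by gcongr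
    _ = 4 ^ q * q.factorial * (K.choose q * (K.choose q / P.choose q)) *
        (q.factorial * P.choose q) := by
        have : (4 : ℝ) ^ q = 2 ^ q * 2 ^ q := by rw [← mul_pow]; norm_num
        rw [this]; field_simp
    _ ≤ _ := by gcongr

/-- Union bound over the point of A ∩ B that the subset contains, with C(a-1,q-1) = C(a,q) q/a for a
= |A|. -/
lemma card_powersetCard_meeting_le {α : Type*} [DecidableEq α] (A B : Finset α) {q : ℕ}
    (hq : 1 ≤ q) (hA : 0 < A.card) :
    (((powersetCard q A).filter fun Q => (Q ∩ B).Nonempty).card : ℝ) ≤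
      A.card.choose q * (q * ((A ∩ B).card / A.card : ℝ)) := by
  have h1 : ((powersetCard q A).filter fun Q => (Q ∩ B).Nonempty) ⊆
      (A ∩ B).biUnion fun b => (powersetCard q A).filter fun Q => {b} ⊆ Q := by
    intro Q hQ
    simp only [mem_filter, mem_biUnion, mem_powersetCard] at hQ ⊢
    obtain ⟨⟨h1, h2⟩, b, hb⟩ := hQ
    rw [mem_inter] at hb
    exact ⟨b, mem_inter.2 ⟨h1 hb.1, hb.2⟩, ⟨h1, h2⟩, by simpa using hb.1⟩
  have h2 : ((powersetCard q A).filter fun Q => (Q ∩ B).Nonempty).card ≤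
      (A ∩ B).card * (A.card - 1).choose (q - 1) := by
    refine (card_le_card h1).trans (card_biUnion_le.trans (le_of_eq ?_))
    rw [← smul_eq_mul, ← sum_const]
    refine sum_congr rfl fun b hb => ?_
    rw [card_filter_superset_powersetCard (singleton_subset_iff.2 (mem_inter.1 hb).1)
      (by simpa using hq), card_singleton]
  obtain ⟨a, ha⟩ : ∃ a, A.card = a + 1 := ⟨A.card - 1, by omega⟩
  obtain ⟨p, rfl⟩ : ∃ p, q = p + 1 := ⟨q - 1, by omega⟩
  have h3 := Nat.add_one_mul_choose_eq a p
  have hA' : (0 : ℝ) < A.card := by exact_mod_cast hA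
  have h4 : (((A.card - 1).choose (p + 1 - 1) : ℕ) : ℝ) * A.card =
      A.card.choose (p + 1) * ((p + 1 : ℕ) : ℝ) := by
    rw [ha]; simp only [Nat.add_sub_cancel]
    rw [mul_comm]; exact_mod_cast h3
  calc _ ≤ ((A ∩ B).card : ℝ) * (A.card - 1).choose (p + 1 - 1) := by exact_mod_cast h2
    _ = _ := by
      rw [← eq_div_iff hA'.ne'] at h4
      rw [h4]; ring

/-- Pick a key b in T ∩ B. If b lies outside A, then T contains b together with q keys of A, that is
q + 1 prescribed keys; otherwise T contains a q-subset of A that meets B. The two terms of the bound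
come from these two cases. -/
lemma ringAvg_share_both_le {P K q : ℕ} (h : K ≤ P) (hq : 1 ≤ q) (hK : 0 < K)
    (A B : KeyRing P K) :
    ringAvg (fun T : KeyRing P K =>
      if q ≤ (T.1 ∩ A.1).card ∧ q ≤ (T.1 ∩ B.1).card then (1 : ℝ) else 0) ≤
      shareMean q P K * ((K : ℝ) ^ 2 / P + q * ((A.1 ∩ B.1).card / K : ℝ)) := by
  have h1 : ∀ T : KeyRing P K,
      (if q ≤ (T.1 ∩ A.1).card ∧ q ≤ (T.1 ∩ B.1).card then (1 : ℝ) else 0) ≤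
      ∑ Q ∈ powersetCard q A.1, ∑ b ∈ B.1 \ A.1, (if insert b Q ⊆ T.1 then (1 : ℝ) else 0) +
      ∑ Q ∈ (powersetCard q A.1).filter (fun Q => (Q ∩ B.1).Nonempty),
        (if Q ⊆ T.1 then (1 : ℝ) else 0) := by
    intro T
    have p1 : ∀ Q ∈ powersetCard q A.1,
        0 ≤ ∑ b ∈ B.1 \ A.1, (if insert b Q ⊆ T.1 then (1 : ℝ) else 0) := fun Q _ =>
      sum_nonneg fun b _ => by split_ifs <;> norm_num
    have p2 : ∀ Q ∈ (powersetCard q A.1).filter (fun Q => (Q ∩ B.1).Nonempty),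
        (0 : ℝ) ≤ (if Q ⊆ T.1 then (1 : ℝ) else 0) := fun Q _ => by split_ifs <;> norm_num
    split_ifs with hT
    · obtain ⟨hTA, hTB⟩ := hT
      obtain ⟨b, hb⟩ := card_pos.1 (lt_of_lt_of_le hq hTB)
      rw [mem_inter] at hb
      by_cases hbA : b ∈ A.1
      · obtain ⟨Q, hbQ, hQ, hQc⟩ := exists_subsuperset_card_eq
          (singleton_subset_iff.2 (mem_inter.2 ⟨hb.1, hbA⟩)) (by simpa using hq) hTA
        refine le_add_of_nonneg_of_le (sum_nonneg p1) ?_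
        have := single_le_sum p2 (mem_filter.2 ⟨mem_powersetCard.2
          ⟨hQ.trans inter_subset_right, hQc⟩,
          ⟨b, mem_inter.2 ⟨singleton_subset_iff.1 hbQ, hb.2⟩⟩⟩)
        rwa [if_pos (hQ.trans inter_subset_left)] at this
      · obtain ⟨Q, hQ, hQc⟩ := exists_subset_card_eq hTA
        refine le_add_of_le_of_nonneg ?_ (sum_nonneg p2)
        refine le_trans ?_ (single_le_sum p1 (mem_powersetCard.2
          ⟨hQ.trans inter_subset_right, hQc⟩))
        have := single_le_sum (f := fun b => if insert b Q ⊆ T.1 then (1 : ℝ) else 0)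
          (fun b _ => by split_ifs <;> norm_num) (mem_sdiff.2 ⟨hb.2, hbA⟩)
        rwa [if_pos (insert_subset hb.1 (hQ.trans inter_subset_left))] at this
    · exact add_nonneg (sum_nonneg p1) (sum_nonneg p2)
  refine (ringAvg_mono h1).trans ?_
  rw [ringAvg_add, ringAvg_sum, ringAvg_sum, mul_add]
  refine add_le_add ?_ ?_
  · calc _ = ∑ Q ∈ powersetCard q A.1, ∑ b ∈ B.1 \ A.1, inclProb P K (q + 1) := by
          refine sum_congr rfl fun Q hQ => ?_
          rw [ringAvg_sum]
          refine sum_congr rfl fun b hb => ?_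
          rw [mem_powersetCard] at hQ
          rw [ringAvg_subset h, card_insert_of_notMem fun hbQ => (mem_sdiff.1 hb).2 (hQ.1 hbQ),
            hQ.2]
      _ = K.choose q * ((B.1 \ A.1).card * inclProb P K (q + 1)) := by
          simp only [sum_const, nsmul_eq_mul, card_powersetCard, A.2]
      _ ≤ K.choose q * (K * (inclProb P K q * ((K : ℝ) / P))) := by
          gcongr
          · exact inclProb_nonneg _ _ _
          · exact (card_le_card sdiff_subset).trans B.2.le
          · exact inclProb_succ_le h q
      _ = _ := by unfold shareMean; ring
  · rw [sum_congr rfl fun Q hQ => by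
      rw [ringAvg_subset h, (mem_powersetCard.1 (mem_filter.1 hQ).1).2], sum_const, nsmul_eq_mul]
    have := card_powersetCard_meeting_le A.1 B.1 hq (by rw [A.2]; exact hK)
    rw [A.2] at this
    calc _ ≤ _ := mul_le_mul_of_nonneg_right this (inclProb_nonneg P K q)
      _ = _ := by unfold shareMean; ring

end Counting

/-! ### The law of the neighbour set of an outside node -/

section NbrWeight

open Finset

variable {ι : Type*} [Fintype ι] [DecidableEq ι]

/-- Expand the product of x i + (1 - x i), with the second summand replaced by 0 for i in B: exactly
the terms with B ⊆ A survive. -/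
lemma sum_prod_bernoulli_superset (x : ι → ℝ) (B : Finset ι) :
    ∑ A with B ⊆ A, ∏ i, (if i ∈ A then x i else 1 - x i) = ∏ i ∈ B, x i := by
  have h := prod_add x (fun i => if i ∈ B then 0 else 1 - x i) univ
  have h1 : ∏ i, (x i + if i ∈ B then 0 else 1 - x i) = ∏ i ∈ B, x i := by
    rw [← prod_subset (subset_univ B) fun i _ hi => by simp [hi]]
    exact prod_congr rfl fun i hi => by simp [hi]
  rw [h1, powerset_univ] at h
  rw [h, sum_filter]
  refine sum_congr rfl fun A _ => ?_
  have h2 := prod_piecewise univ A x (fun i => if i ∈ B then 0 else 1 - x i)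
  rw [univ_inter] at h2
  rw [← h2]
  split_ifs with hA
  · refine prod_congr rfl fun i _ => ?_
    by_cases hi : i ∈ A
    · simp [hi]
    · have : i ∉ B := fun hB => hi (hA hB)
      simp [hi, this]
  · obtain ⟨i, hiB, hiA⟩ := not_subset.1 hA
    exact (prod_eq_zero (mem_univ i) (by simp [hiA, hiB])).symm

/-- The probability that a node outside `ι` is adjacent exactly to the nodes in `A`, when the
nodes in `ι` have the key rings `s`. -/
def nbrWeight {P K : ℕ} (q : ℕ) (p : ℝ) (s : ι → KeyRing P K) (A : Finset ι) : ℝ :=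
  ringAvg fun T : KeyRing P K => ∏ i,
    (if i ∈ A then (if q ≤ (T.1 ∩ (s i).1).card then p else 0)
      else 1 - (if q ≤ (T.1 ∩ (s i).1).card then p else 0))

variable {P K : ℕ} {q : ℕ} {p : ℝ} {s : ι → KeyRing P K}

lemma nbrWeight_nonneg (hp : 0 ≤ p) (hp1 : p ≤ 1) (A : Finset ι) : 0 ≤ nbrWeight q p s A := by
  refine ringAvg_nonneg fun T => prod_nonneg fun i _ => ?_
  split_ifs <;> linarith

lemma sum_nbrWeight_superset (B : Finset ι) :
    ∑ A with B ⊆ A, nbrWeight q p s A =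
      ringAvg fun T : KeyRing P K => ∏ i ∈ B, if q ≤ (T.1 ∩ (s i).1).card then p else 0 := by
  unfold nbrWeight
  rw [← ringAvg_sum]
  simp only [sum_prod_bernoulli_superset (fun i => if q ≤ (_ ∩ (s i).1).card then p else 0)]

lemma sum_nbrWeight (h : K ≤ P) : ∑ A, nbrWeight q p s A = 1 := by
  have := sum_nbrWeight_superset (q := q) (p := p) (s := s) ∅
  simpa [ringAvg_const h] using this

lemma sum_nbrWeight_mem (h : K ≤ P) (i : ι) :
    ∑ A with i ∈ A, nbrWeight q p s A = p * shareProb q P K := by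
  have := sum_nbrWeight_superset (q := q) (p := p) (s := s) {i}
  simp only [singleton_subset_iff, prod_singleton] at this
  rw [this, ← ringAvg_share h q (s i), ← ringAvg_mul_left]
  simp

lemma sum_nbrWeight_mem_mem {i j : ι} (hij : i ≠ j) :
    ∑ A with i ∈ A ∧ j ∈ A, nbrWeight q p s A = p ^ 2 * ringAvg fun T : KeyRing P K =>
      if q ≤ (T.1 ∩ (s i).1).card ∧ q ≤ (T.1 ∩ (s j).1).card then (1 : ℝ) else 0 := by
  have := sum_nbrWeight_superset (q := q) (p := p) (s := s) {i, j}
  simp only [insert_subset_iff, singleton_subset_iff, prod_pair hij] at this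
  rw [this, ← ringAvg_mul_left]
  congr 1
  ext T
  by_cases h1 : q ≤ (T.1 ∩ (s i).1).card <;> by_cases h2 : q ≤ (T.1 ∩ (s j).1).card <;>
    simp [h1, h2, sq]

end NbrWeight

/-! ### Weights of small sets from one- and two-point marginals -/

section Marginals

open Finset

variable {ι : Type*} [Fintype ι] [DecidableEq ι] {ν : Finset ι → ℝ} {m η : ℝ}

lemma sum_mul_card (hm : ∀ i, ∑ A with i ∈ A, ν A = m) :
    ∑ A, ν A * A.card = Fintype.card ι * m := by
  have : ∀ A : Finset ι, ν A * A.card = ∑ i, if i ∈ A then ν A else 0 := fun A => by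
    rw [sum_ite_mem, univ_inter, sum_const, nsmul_eq_mul, mul_comm]
  rw [sum_congr rfl fun A _ => this A, sum_comm]
  simp only [← sum_filter, hm, sum_const, card_univ, nsmul_eq_mul]

/-- The quantity |A|(|A| - 1) counts ordered pairs of distinct elements of A. -/
lemma sum_mul_card_mul_card_sub_one (hη0 : 0 ≤ η)
    (hη : ∀ i j, i ≠ j → ∑ A with i ∈ A ∧ j ∈ A, ν A ≤ η) :
    ∑ A, ν A * (A.card * (A.card - 1)) ≤ (Fintype.card ι : ℝ) ^ 2 * η := by
  have : ∀ A : Finset ι, ν A * (A.card * (A.card - 1) : ℝ) =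
      ∑ i, ∑ j, if i ≠ j then (if i ∈ A ∧ j ∈ A then ν A else 0) else 0 := fun A => by
    have h1 : ∀ i, (∑ j, if i ≠ j then (if i ∈ A ∧ j ∈ A then ν A else 0) else 0) =
        if i ∈ A then ((A.card : ℝ) - 1) * ν A else 0 := by
      intro i
      by_cases hi : i ∈ A
      · simp only [hi, true_and, if_true, ← ite_and]
        rw [← sum_filter]
        have : (univ.filter fun j => i ≠ j ∧ j ∈ A) = A.erase i := by
          ext j; simp [mem_erase, eq_comm]
        rw [this, sum_const, card_erase_of_mem hi, nsmul_eq_mul,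
          Nat.cast_sub (card_pos.2 ⟨i, hi⟩), Nat.cast_one]
      · simp [hi]
    rw [sum_congr rfl fun i _ => h1 i, sum_ite_mem, univ_inter, sum_const, nsmul_eq_mul]
    ring
  rw [sum_congr rfl fun A _ => this A, sum_comm]
  have h2 : ∀ i : ι, ∑ A : Finset ι, ∑ j, (if i ≠ j then (if i ∈ A ∧ j ∈ A then ν A else 0) else 0)
      ≤ Fintype.card ι * η := by
    intro i
    rw [sum_comm, ← card_univ, ← nsmul_eq_mul]
    refine sum_le_card_nsmul _ _ _ fun j _ => ?_
    split_ifs with hij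
    · rw [← sum_filter]; exact hη i j hij
    · simpa using hη0
  refine (sum_le_sum fun i _ => h2 i).trans (le_of_eq ?_)
  rw [sum_const, card_univ, nsmul_eq_mul]; ring

lemma one_sub_le_weight_empty (hν : ∀ A, 0 ≤ ν A) (h1 : ∑ A, ν A = 1)
    (hm : ∀ i, ∑ A with i ∈ A, ν A = m) : 1 - Fintype.card ι * m ≤ ν ∅ := by
  rw [← sum_mul_card hm]
  have : ∑ A, ν A ≤ ∑ A, (ν A * A.card + if A = ∅ then ν A else 0) := by
    refine sum_le_sum fun A _ => ?_
    split_ifs with hA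
    · simp [hA]
    · have : (1 : ℝ) ≤ A.card := by
        exact_mod_cast card_pos.2 (nonempty_iff_ne_empty.2 hA)
      nlinarith [hν A]
  rw [sum_add_distrib, sum_ite_eq' univ ∅, if_pos (mem_univ _), h1] at this
  linarith

/-- The indicator of A = ∅ is at most 1 - |A| + |A|(|A| - 1) = (|A| - 1)². -/
lemma weight_empty_le (hν : ∀ A, 0 ≤ ν A) (h1 : ∑ A, ν A = 1)
    (hm : ∀ i, ∑ A with i ∈ A, ν A = m) (hη0 : 0 ≤ η)
    (hη : ∀ i j, i ≠ j → ∑ A with i ∈ A ∧ j ∈ A, ν A ≤ η) :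
    ν ∅ ≤ 1 - Fintype.card ι * m + (Fintype.card ι : ℝ) ^ 2 * η := by
  refine le_trans ?_ (add_le_add le_rfl (sum_mul_card_mul_card_sub_one hη0 hη))
  suffices ν ∅ ≤ ∑ A, (ν A - ν A * A.card + ν A * (A.card * (A.card - 1))) by
    rwa [sum_add_distrib, sum_sub_distrib, h1, sum_mul_card hm] at this
  have : ν ∅ = ∑ A : Finset ι, if A = ∅ then ν A else 0 := by
    rw [sum_ite_eq' univ ∅, if_pos (mem_univ _)]
  rw [this]
  refine sum_le_sum fun A _ => ?_
  split_ifs with hA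
  · simp [hA]
  · have : ν A - ν A * A.card + ν A * (A.card * (A.card - 1)) = ν A * ((A.card : ℝ) - 1) ^ 2 := by
      ring
    rw [this]
    exact mul_nonneg (hν A) (sq_nonneg _)

lemma sum_two_le_card_le (hν : ∀ A, 0 ≤ ν A) (hη0 : 0 ≤ η)
    (hη : ∀ i j, i ≠ j → ∑ A with i ∈ A ∧ j ∈ A, ν A ≤ η) :
    ∑ A with 2 ≤ A.card, ν A ≤ (Fintype.card ι : ℝ) ^ 2 * η := by
  refine le_trans ?_ (sum_mul_card_mul_card_sub_one hη0 hη)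
  rw [sum_filter]
  refine sum_le_sum fun A _ => ?_
  split_ifs with hA
  · have : (2 : ℝ) ≤ A.card := by exact_mod_cast hA
    exact le_mul_of_one_le_right (hν A) (by nlinarith)
  · rcases Nat.eq_zero_or_pos A.card with h | h
    · simp [h]
    · have : (1 : ℝ) ≤ A.card := by exact_mod_cast h
      exact mul_nonneg (hν A) (by nlinarith)

lemma weight_singleton_le (hν : ∀ A, 0 ≤ ν A) (hm : ∀ i, ∑ A with i ∈ A, ν A = m) (i : ι) :
    ν {i} ≤ m := by
  rw [← hm i]
  exact single_le_sum (fun A _ => hν A) (by simp)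

/-- A set containing i and different from {i} contains a second element j; sum the pair bound over
j. -/
lemma le_weight_singleton (hν : ∀ A, 0 ≤ ν A) (hm : ∀ i, ∑ A with i ∈ A, ν A = m) (hη0 : 0 ≤ η)
    (hη : ∀ i j, i ≠ j → ∑ A with i ∈ A ∧ j ∈ A, ν A ≤ η) (i : ι) :
    m - Fintype.card ι * η ≤ ν {i} := by
  have h : ∑ A with i ∈ A, ν A ≤ ∑ A, ((if A = {i} then ν A else 0) +
      ∑ j, if i ≠ j then (if i ∈ A ∧ j ∈ A then ν A else 0) else 0) := by
    rw [sum_filter]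
    refine sum_le_sum fun A _ => ?_
    have h0 : ∀ j ∈ univ, 0 ≤ if i ≠ j then (if i ∈ A ∧ j ∈ A then ν A else 0) else 0 := by
      intro j _
      have := hν A
      split_ifs <;> simp [this]
    split_ifs with h1 h2 h2
    · exact le_add_of_nonneg_right (sum_nonneg h0)
    · obtain ⟨j, hj, hji⟩ : ∃ j ∈ A, j ≠ i := by
        by_contra! hc
        exact h2 (eq_singleton_iff_unique_mem.2 ⟨h1, hc⟩)
      have := single_le_sum h0 (mem_univ j)
      rw [if_pos hji.symm, if_pos ⟨h1, hj⟩] at this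
      linarith
    · exact absurd (h2 ▸ mem_singleton_self i) h1
    · rw [zero_add]; exact sum_nonneg h0
  rw [sum_add_distrib, sum_ite_eq' univ ({i} : Finset ι), if_pos (mem_univ _), sum_comm, hm] at h
  have h3 : ∑ j : ι, ∑ A : Finset ι, (if i ≠ j then (if i ∈ A ∧ j ∈ A then ν A else 0) else 0) ≤
      Fintype.card ι * η := by
    rw [← card_univ, ← nsmul_eq_mul]
    refine sum_le_card_nsmul _ _ _ fun j _ => ?_
    split_ifs with hij
    · rw [← sum_filter]; exact hη i j hij
    · simpa using hη0
  linarith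

end Marginals

/-! ### From the random graph to sums over key rings -/

section Law

open Finset

/-- Distinct non-diagonal pairs are independent coordinates of the Bernoulli random set, so the
event is a cylinder. A set `t x` of truth values covers required, forbidden, free and impossible
edges at once. -/
lemma binomialRandom_real_edges {V X : Type*} [Fintype V] [Fintype X] (p : unitInterval)
    (f : X → Sym2 V) (hf : Function.Injective f) (hd : ∀ x, f x ∉ Sym2.diagSet)
    (t : X → Set Prop) [∀ x, Decidable (True ∈ t x)] [∀ x, Decidable (False ∈ t x)] :
    (SimpleGraph.binomialRandom V p).real {H | ∀ x, (f x ∈ H.edgeSet) ∈ t x} =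
      ∏ x, ((if True ∈ t x then (p : ℝ) else 0) + (if False ∈ t x then 1 - (p : ℝ) else 0)) := by
  classical
  have hmeas : MeasurableSet {H : SimpleGraph V | ∀ x, (f x ∈ H.edgeSet) ∈ t x} := by
    have : {H : SimpleGraph V | ∀ x, (f x ∈ H.edgeSet) ∈ t x} =
        SimpleGraph.edgeSet ⁻¹' {E | ∀ x, (f x ∈ E) ∈ t x} := rfl
    rw [this]
    exact SimpleGraph.measurable_edgeSet (Set.toFinite _).measurableSet
  have hset : (fun b : Sym2 V → Prop => {e | b e}) ⁻¹'
      (SimpleGraph.fromEdgeSet ⁻¹' {H : SimpleGraph V | ∀ x, (f x ∈ H.edgeSet) ∈ t x}) =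
      Set.pi (univ.map ⟨f, hf⟩ : Finset (Sym2 V))
        (fun e => {b | ∀ x, f x = e → b ∈ t x}) := by
    ext b
    simp only [Set.mem_preimage, Set.mem_ofPred_eq, SimpleGraph.edgeSet_fromEdgeSet, Set.mem_sdiff,
      hd, not_false_eq_true, and_true, Set.mem_pi, coe_map, Function.Embedding.coeFn_mk,
      Set.mem_image, coe_univ, Set.mem_univ, true_and]
    constructor
    · rintro h e ⟨x, rfl⟩ y hy
      rw [← hy]; exact h y
    · intro h x
      exact h (f x) ⟨x, rfl⟩ x rfl
  have hpi := Measure.infinitePi_pi (X := fun _ : Sym2 V => Prop)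
    (μ := fun i : Sym2 V => unitInterval.toNNReal p • Measure.dirac (i ∈ Sym2.diagSetᶜ) +
      unitInterval.toNNReal (unitInterval.symm p) • Measure.dirac False)
    (s := univ.map ⟨f, hf⟩) (t := fun e => {b | ∀ x, f x = e → b ∈ t x})
    (fun _ _ => (Set.toFinite _).measurableSet)
  rw [measureReal_def, SimpleGraph.binomialRandom_eq_map,
    Measure.map_apply SimpleGraph.measurable_fromEdgeSet hmeas, setBernoulli_apply', hset,
    hpi, prod_map, ENNReal.toReal_prod]
  refine prod_congr rfl fun x _ => ?_
  have h1 : {b : Prop | ∀ y, f y = f x → b ∈ t y} = t x := by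
    ext b
    exact ⟨fun h => h x rfl, fun h y hy => by rwa [hf hy]⟩
  have h2 : (f x ∈ (Sym2.diagSetᶜ : Set (Sym2 V))) = True := by simpa using hd x
  simp only [Function.Embedding.coeFn_mk, h1, h2]
  rw [Measure.add_apply, Measure.smul_apply, Measure.smul_apply, Measure.dirac_apply,
    Measure.dirac_apply]
  by_cases hT : True ∈ t x <;> by_cases hF : False ∈ t x <;>
    simp [hT, hF, ENNReal.toReal_add]

instance (P K : ℕ) : DecidableEq (KeyRing P K) :=
  inferInstanceAs (DecidableEq {s : Finset (Fin P) // s.card = K})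

variable {n K P : ℕ}

lemma uniformOn_real_singleton (T : KeyRing P K) :
    (uniformOn (Set.univ : Set (KeyRing P K))).real {T} = ((P.choose K : ℕ) : ℝ)⁻¹ := by
  rw [measureReal_def, uniformOn_univ]
  simp [card_keyRing]

lemma jointLaw_real (h : K ≤ P) (p : unitInterval)
    (E : Set ((Fin n → KeyRing P K) × SimpleGraph (Fin n))) :
    (jointLaw n K P p).real E = ∑ S : Fin n → KeyRing P K, (((P.choose K : ℕ) : ℝ)⁻¹) ^ n *
      (SimpleGraph.binomialRandom (Fin n) p).real {H | (S, H) ∈ E} := by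
  have := KeyRing.nonempty h
  have : IsProbabilityMeasure (uniformOn (Set.univ : Set (KeyRing P K))) :=
    isProbabilityMeasure_uniformOn Set.finite_univ Set.univ_nonempty
  have := measurableSingletonClass_simpleGraph n
  rw [measureReal_def, jointLaw, Measure.prod_apply (Set.toFinite E).measurableSet,
    lintegral_fintype, ENNReal.toReal_sum fun S _ => by finiteness]
  refine sum_congr rfl fun S _ => ?_
  rw [ENNReal.toReal_mul, mul_comm]
  congr 1
  rw [← Set.univ_pi_singleton, Measure.pi_pi, ENNReal.toReal_prod]
  simp only [← measureReal_def, uniformOn_real_singleton, prod_const, card_univ, Fintype.card_fin]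

lemma graphLaw_real (h : K ≤ P) (q : ℕ) (p : unitInterval) (E : Set (SimpleGraph (Fin n))) :
    (graphLaw q n K P p).real E = ∑ S : Fin n → KeyRing P K, (((P.choose K : ℕ) : ℝ)⁻¹) ^ n *
      (SimpleGraph.binomialRandom (Fin n) p).real {H | keyGraph q S ⊓ H ∈ E} := by
  have := measurableSingletonClass_simpleGraph n
  rw [graphLaw, map_measureReal_apply (measurable_inter q n K P) (Set.toFinite E).measurableSet,
    jointLaw_real h]
  rfl

/-- The neighbours in `R` of the nodes outside `R`. -/
def nbrsIn {n : ℕ} (R : Finset (Fin n)) (G : SimpleGraph (Fin n)) (w : {w // w ∉ R}) :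
    Finset {i // i ∈ R} :=
  open scoped Classical in univ.filter fun i => G.Adj w.1 i.1

open scoped Classical in
lemma binomialRandom_real_nbrsIn (q : ℕ) (p : unitInterval) (R : Finset (Fin n))
    (S : Fin n → KeyRing P K) (a : {w // w ∉ R} → Finset {i // i ∈ R}) :
    (SimpleGraph.binomialRandom (Fin n) p).real {H | nbrsIn R (keyGraph q S ⊓ H) = a} =
      ∏ w, ∏ i, (if i ∈ a w then (if q ≤ ((S w.1).1 ∩ (S i.1).1).card then (p : ℝ) else 0)
        else 1 - (if q ≤ ((S w.1).1 ∩ (S i.1).1).card then (p : ℝ) else 0)) := by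
  have hne : ∀ (w : {w // w ∉ R}) (i : {i // i ∈ R}), w.1 ≠ i.1 := fun w i h => w.2 (h ▸ i.2)
  have h := binomialRandom_real_edges p
    (fun x : {w // w ∉ R} × {i // i ∈ R} => s(x.1.1, x.2.1))
    (by
      rintro ⟨w, i⟩ ⟨w', i'⟩ hx
      simp only [Sym2.eq_iff] at hx
      rcases hx with ⟨h1, h2⟩ | ⟨h1, h2⟩
      · exact Prod.ext (Subtype.ext h1) (Subtype.ext h2)
      · exact absurd h1 (hne w i'))
    (fun x => by simpa using hne x.1 x.2)
    -- When the rings share fewer than q keys, this set is everything or empty, which gives the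
    -- factors 1 and 0.
    (fun x => {b | (q ≤ ((S x.1.1).1 ∩ (S x.2.1).1).card ∧ b) ↔ x.2 ∈ a x.1})
  rw [Fintype.prod_prod_type] at h
  convert h using 1
  · congr 1
    ext H
    simp only [Set.mem_ofPred_eq, funext_iff, Finset.ext_iff, nbrsIn, mem_filter, mem_univ,
      true_and, Prod.forall, SimpleGraph.mem_edgeSet, SimpleGraph.inf_adj, keyGraph, hne,
      ne_eq, not_false_eq_true]
  · refine prod_congr rfl fun w _ => prod_congr rfl fun i _ => ?_
    by_cases h1 : i ∈ a w <;> by_cases h2 : q ≤ ((S w.1).1 ∩ (S i.1).1).card <;>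
      simp [h1, h2]

lemma sum_prod_ringAvg {W : Type*} [Fintype W] [DecidableEq W] (φ : W → KeyRing P K → ℝ) :
    ∑ S : W → KeyRing P K, (((P.choose K : ℕ) : ℝ)⁻¹) ^ Fintype.card W * ∏ w, φ w (S w) =
      ∏ w, ringAvg (φ w) := by
  simp only [ringAvg, div_eq_inv_mul]
  rw [prod_mul_distrib, prod_const, card_univ, prod_univ_sum, mul_sum]
  simp

/-- The joint law of the key rings of the nodes in `R` and of the edges between `R` and the other
nodes. -/
lemma sum_real_nbrsIn (q : ℕ) (p : unitInterval) (R : Finset (Fin n))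
    (L : Finset ({w // w ∉ R} → Finset {i // i ∈ R})) (c : ({i // i ∈ R} → KeyRing P K) → ℝ) :
    ∑ S : Fin n → KeyRing P K, (((P.choose K : ℕ) : ℝ)⁻¹) ^ n * (c (fun i => S i.1) *
      (SimpleGraph.binomialRandom (Fin n) p).real {H | nbrsIn R (keyGraph q S ⊓ H) ∈ L}) =
    ∑ s : {i // i ∈ R} → KeyRing P K, (((P.choose K : ℕ) : ℝ)⁻¹) ^ R.card * (c s *
      ∑ a ∈ L, ∏ w, nbrWeight q (p : ℝ) s (a w)) := by
  have hsplit : ∀ S : Fin n → KeyRing P K,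
      (SimpleGraph.binomialRandom (Fin n) p).real {H | nbrsIn R (keyGraph q S ⊓ H) ∈ L} =
      ∑ a ∈ L, (SimpleGraph.binomialRandom (Fin n) p).real
        {H | nbrsIn R (keyGraph q S ⊓ H) = a} := by
    intro S
    have := measurableSingletonClass_simpleGraph n
    rw [← measureReal_biUnion_finset]
    · congr 1; ext H; simp
    · intro a _ b _ hab
      exact Set.disjoint_left.2 fun H h1 h2 => hab (h1.symm.trans h2)
    · exact fun a _ => (Set.toFinite _).measurableSet
  have hcard : n = R.card + Fintype.card {w // w ∉ R} := by
    have := Fintype.card_subtype_compl (fun i => i ∈ R)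
    rw [Fintype.card_fin, Fintype.card_coe] at this
    have h2 : R.card ≤ n := by simpa using card_le_univ R
    omega
  rw [← (Equiv.piEquivPiSubtypeProd (fun i => i ∈ R) fun _ => KeyRing P K).symm.sum_comp,
    Fintype.sum_prod_type]
  refine sum_congr rfl fun s _ => ?_
  have hs : ∀ (s' : {w // w ∉ R} → KeyRing P K) (i : {i // i ∈ R}),
      (Equiv.piEquivPiSubtypeProd (fun i => i ∈ R) fun _ => KeyRing P K).symm (s, s') i.1 = s i :=
    fun s' i => by simp [Equiv.piEquivPiSubtypeProd, i.2]
  have hw : ∀ (s' : {w // w ∉ R} → KeyRing P K) (w : {w // w ∉ R}),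
      (Equiv.piEquivPiSubtypeProd (fun i => i ∈ R) fun _ => KeyRing P K).symm (s, s') w.1 = s' w :=
    fun s' w => by simp [Equiv.piEquivPiSubtypeProd, w.2]
  simp only [hsplit, binomialRandom_real_nbrsIn, hs, hw]
  simp only [mul_sum]
  rw [sum_comm]
  refine sum_congr rfl fun a _ => ?_
  unfold nbrWeight
  rw [← sum_prod_ringAvg, mul_sum, mul_sum]
  refine sum_congr rfl fun s' _ => ?_
  nth_rewrite 1 [hcard]
  rw [pow_add]
  ring

open scoped Classical in
/-- The degree of the node `i`. -/
def nodeDeg {n : ℕ} (G : SimpleGraph (Fin n)) (i : Fin n) : ℕ :=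
  (univ.filter fun j => G.Adj i j).card

lemma le_minDeg_iff {n : ℕ} (hn : 0 < n) (G : SimpleGraph (Fin n)) (k : ℕ) :
    k ≤ minDeg G ↔ ∀ i, k ≤ nodeDeg G i := by
  classical
  have : Nonempty (Fin n) := ⟨⟨0, hn⟩⟩
  have hd : ∀ i, nodeDeg G i = G.degree i := fun i => by
    rw [nodeDeg, ← SimpleGraph.card_neighborFinset_eq_degree, SimpleGraph.neighborFinset_eq_filter]
  simp only [hd]
  unfold minDeg
  constructor
  · intro h i
    refine h.trans (le_trans (le_of_eq ?_) (G.minDegree_le_degree i))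
    congr!
  · intro h
    refine (G.le_minDegree_of_forall_le_degree k h).trans (le_of_eq ?_)
    congr!

/-- All nodes in `R` have degree less than `k`. -/
def lowEvent {n : ℕ} (k : ℕ) (R : Finset (Fin n)) : Set (SimpleGraph (Fin n)) :=
  {G | ∀ i ∈ R, nodeDeg G i < k}

lemma card_nbrsIn_le (R : Finset (Fin n)) (G : SimpleGraph (Fin n)) (i : {i // i ∈ R}) :
    (univ.filter fun w => i ∈ nbrsIn R G w).card ≤ nodeDeg G i.1 := by
  classical
  rw [← card_map (Function.Embedding.subtype _)]
  refine card_le_card fun j hj => ?_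
  simp only [nbrsIn, Finset.mem_map, mem_filter, mem_univ, true_and, Function.Embedding.subtype_apply]
    at hj ⊢
  obtain ⟨w, hw, rfl⟩ := hj
  exact hw.symm

lemma nodeDeg_eq_card_nbrsIn (R : Finset (Fin n)) (G : SimpleGraph (Fin n)) (i : {i // i ∈ R})
    (h : ∀ j ∈ R, ¬ G.Adj i.1 j) :
    nodeDeg G i.1 = (univ.filter fun w => i ∈ nbrsIn R G w).card := by
  classical
  refine le_antisymm ?_ (card_nbrsIn_le R G i)
  rw [← card_map (Function.Embedding.subtype _)]
  refine card_le_card fun j hj => ?_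
  simp only [nbrsIn, Finset.mem_map, mem_filter, mem_univ, true_and, Function.Embedding.subtype_apply]
    at hj ⊢
  exact ⟨⟨j, fun hR => h j hR hj⟩, hj.symm, rfl⟩

/-- The key rings `s` are pairwise disjoint. -/
def RingsDisjoint {ι : Type*} (s : ι → KeyRing P K) : Prop :=
  ∀ i j, i ≠ j → (s i).1 ∩ (s j).1 = ∅

/-- Ignoring the edges inside `R` only lowers the degrees. -/
lemma graphLaw_lowEvent_le (h : K ≤ P) (q k : ℕ) (p : unitInterval) (R : Finset (Fin n)) :
    (graphLaw q n K P p).real (lowEvent k R) ≤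
      ∑ s : {i // i ∈ R} → KeyRing P K, (((P.choose K : ℕ) : ℝ)⁻¹) ^ R.card *
        lowSum {w // w ∉ R} k (nbrWeight q (p : ℝ) s) := by
  have := sum_real_nbrsIn q p R (lowSet {i // i ∈ R} {w // w ∉ R} k)
    (fun _ : {i // i ∈ R} → KeyRing P K => 1)
  simp only [one_mul] at this
  unfold lowSum
  rw [← this, graphLaw_real h]
  gcongr with S
  · exact measure_ne_top _ _
  · intro hH
    exact mem_lowSet.2 fun i => (card_nbrsIn_le R _ i).trans_lt (hH i.1 i.2)

open scoped Classical in
-- Disjoint rings exclude edges inside `R`, because q ≥ 1; the degrees are then exactly the numbers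
-- of outside neighbours.
lemma le_graphLaw_lowEvent (h : K ≤ P) {q : ℕ} (hq : 1 ≤ q) (k : ℕ) (p : unitInterval)
    (R : Finset (Fin n)) :
    ∑ s : {i // i ∈ R} → KeyRing P K, (((P.choose K : ℕ) : ℝ)⁻¹) ^ R.card *
      ((if RingsDisjoint s then 1 else 0) * lowSum {w // w ∉ R} k (nbrWeight q (p : ℝ) s)) ≤
    (graphLaw q n K P p).real (lowEvent k R) := by
  have := sum_real_nbrsIn q p R (lowSet {i // i ∈ R} {w // w ∉ R} k)
    (fun s : {i // i ∈ R} → KeyRing P K => if RingsDisjoint s then 1 else 0)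
  unfold lowSum
  rw [← this, graphLaw_real h]
  gcongr with S
  split_ifs with hS
  · rw [one_mul]
    refine measureReal_mono ?_ (measure_ne_top _ _)
    intro H hH i hi
    have h1 := mem_lowSet.1 hH ⟨i, hi⟩
    rwa [← nodeDeg_eq_card_nbrsIn R (keyGraph q S ⊓ H) ⟨i, hi⟩] at h1
    rintro j hj ⟨⟨hij, hadj⟩, -⟩
    have h2 := hS ⟨i, hi⟩ ⟨j, hj⟩ fun hc => hij (congrArg Subtype.val hc)
    dsimp only at h2
    rw [h2, card_empty] at hadj
    omega
  · rw [zero_mul]; exact measureReal_nonneg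

/-- This is `sum_real_nbrsIn` with R = {i}: the factor of `j` is a one-point marginal, and every
other outside node sums to 1. -/
lemma graphLaw_adj (h : K ≤ P) (q : ℕ) (p : unitInterval) {i j : Fin n} (hij : i ≠ j) :
    (graphLaw q n K P p).real {G | G.Adj i j} = p * shareProb q P K := by
  classical
  let j' : {w // w ∉ ({i} : Finset (Fin n))} := ⟨j, by simpa using hij.symm⟩
  let i' : {w // w ∈ ({i} : Finset (Fin n))} := ⟨i, by simp⟩
  have h1 := sum_real_nbrsIn q p {i} (univ.filter fun a => i' ∈ a j')
    (fun _ : {w // w ∈ ({i} : Finset (Fin n))} → KeyRing P K => 1)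
  simp only [one_mul] at h1
  have h2 : ∀ S : Fin n → KeyRing P K,
      {H | nbrsIn {i} (keyGraph q S ⊓ H) ∈ univ.filter fun a => i' ∈ a j'} =
        {H | keyGraph q S ⊓ H ∈ {G : SimpleGraph (Fin n) | G.Adj i j}} := by
    intro S
    ext H
    simp only [nbrsIn, mem_filter, mem_univ, true_and, Set.mem_ofPred_eq]
    exact SimpleGraph.adj_comm _ _ _
  simp only [h2] at h1
  rw [graphLaw_real h, h1]
  have hC : ((P.choose K : ℕ) : ℝ) ≠ 0 := by exact_mod_cast (Nat.choose_pos h).ne'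
  have h3 : ∀ s : {w // w ∈ ({i} : Finset (Fin n))} → KeyRing P K,
      ∑ a ∈ univ.filter (fun a : {w // w ∉ ({i} : Finset (Fin n))} → _ => i' ∈ a j'),
        ∏ w, nbrWeight q (p : ℝ) s (a w) = p * shareProb q P K := by
    intro s
    have h4 := prod_univ_sum (fun w : {w // w ∉ ({i} : Finset (Fin n))} =>
      if w = j' then (univ.filter fun A : Finset {w // w ∈ ({i} : Finset (Fin n))} => i' ∈ A)
        else univ)
      (fun _ A => nbrWeight q (p : ℝ) s A)
    have h5 : (Fintype.piFinset fun w : {w // w ∉ ({i} : Finset (Fin n))} =>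
        if w = j' then (univ.filter fun A : Finset {w // w ∈ ({i} : Finset (Fin n))} => i' ∈ A)
          else univ) =
        univ.filter (fun a => i' ∈ a j') := by
      ext a
      simp only [Fintype.mem_piFinset, mem_filter, mem_univ, true_and]
      constructor
      · intro ha; simpa using ha j'
      · intro ha w
        split_ifs with hw
        · rw [hw]; simpa using ha
        · exact mem_univ _
    rw [h5] at h4
    rw [← h4, ← mul_prod_erase univ _ (mem_univ j'), if_pos rfl, sum_nbrWeight_mem h,
      prod_congr rfl fun w hw => by rw [if_neg (ne_of_mem_erase hw), sum_nbrWeight h], prod_const_one,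
      mul_one]
  simp only [h3]
  rw [sum_const, card_univ, Fintype.card_fun, card_keyRing, nsmul_eq_mul, card_singleton, pow_one]
  simp only [mem_singleton, Fintype.card_unique, pow_one]
  field_simp

/-- Two nodes of `ι` share at least `t` keys with probability at most `(K ^ 2 / P) ^ t`. -/
lemma sum_card_inter_le (h : K ≤ P) {ι : Type*} [Fintype ι] [DecidableEq ι] {i j : ι}
    (hij : i ≠ j) (t : ℕ) :
    ∑ s : ι → KeyRing P K, (((P.choose K : ℕ) : ℝ)⁻¹) ^ Fintype.card ι *
      (if t ≤ ((s i).1 ∩ (s j).1).card then (1 : ℝ) else 0) ≤ ((K : ℝ) ^ 2 / P) ^ t := by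
  -- Summing over the value A of `s j` turns the indicator into products over the nodes, to which
  -- `sum_prod_ringAvg` applies.
  have h1 : ∀ s : ι → KeyRing P K, (if t ≤ ((s i).1 ∩ (s j).1).card then (1 : ℝ) else 0) =
      ∑ A : KeyRing P K, ∏ l, (if l = i then (if t ≤ ((s l).1 ∩ A.1).card then (1 : ℝ) else 0)
        else if l = j then (if s l = A then (1 : ℝ) else 0) else 1) := by
    intro s
    have h2 : ∀ A : KeyRing P K,
        ∏ l, (if l = i then (if t ≤ ((s l).1 ∩ A.1).card then (1 : ℝ) else 0)
        else if l = j then (if s l = A then (1 : ℝ) else 0) else 1) =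
        (if t ≤ ((s i).1 ∩ A.1).card then (1 : ℝ) else 0) * (if s j = A then (1 : ℝ) else 0) := by
      intro A
      rw [← mul_prod_erase univ _ (mem_univ i), if_pos rfl,
        ← mul_prod_erase (univ.erase i) _ (mem_erase.2 ⟨hij.symm, mem_univ j⟩),
        if_neg hij.symm, if_pos rfl, prod_eq_one, mul_one]
      intro l hl
      rw [mem_erase, mem_erase] at hl
      rw [if_neg hl.2.1, if_neg hl.1]
    rw [sum_congr rfl fun A _ => h2 A]
    simp
  simp only [h1, mul_sum]
  rw [sum_comm]
  have h3 : ∀ A : KeyRing P K, ∑ s : ι → KeyRing P K,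
      (((P.choose K : ℕ) : ℝ)⁻¹) ^ Fintype.card ι *
      ∏ l, (if l = i then (if t ≤ ((s l).1 ∩ A.1).card then (1 : ℝ) else 0)
        else if l = j then (if s l = A then (1 : ℝ) else 0) else 1) ≤
      ((P.choose K : ℕ) : ℝ)⁻¹ * ((K : ℝ) ^ 2 / P) ^ t := by
    intro A
    rw [sum_prod_ringAvg (fun l T => if l = i then (if t ≤ (T.1 ∩ A.1).card then (1 : ℝ) else 0)
        else if l = j then (if T = A then (1 : ℝ) else 0) else 1),
      ← mul_prod_erase univ _ (mem_univ i),
      ← mul_prod_erase (univ.erase i) _ (mem_erase.2 ⟨hij.symm, mem_univ j⟩), prod_eq_one, mul_one]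
    · simp only [if_true, hij.symm, if_false]
      rw [mul_comm]
      refine mul_le_mul (le_of_eq ?_) (ringAvg_le_card_inter_le h A t)
        (ringAvg_nonneg fun T => by split_ifs <;> norm_num) (by positivity)
      simp [ringAvg]
    · intro l hl
      rw [mem_erase, mem_erase] at hl
      simp only [if_neg hl.2.1, if_neg hl.1]
      exact ringAvg_const h 1
  refine (sum_le_sum fun A _ => h3 A).trans (le_of_eq ?_)
  have hC : ((P.choose K : ℕ) : ℝ) ≠ 0 := by exact_mod_cast (Nat.choose_pos h).ne'
  rw [sum_const, card_univ, card_keyRing, nsmul_eq_mul]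
  field_simp

end Law

/-! ### Comparison of `lowSum` with powers of the Poisson probability -/

section Bounds

open Finset

/-- The probability that a Poisson variable of mean `y` is less than `k`. -/
def poisLow (k : ℕ) (y : ℝ) : ℝ := Real.exp (-y) * ∑ d ∈ range k, y ^ d / (d.factorial : ℝ)

lemma sum_pow_div_factorial_nonneg (k : ℕ) {y : ℝ} (hy : 0 ≤ y) :
    0 ≤ ∑ d ∈ range k, y ^ d / (d.factorial : ℝ) := sum_nonneg fun _ _ => by positivity

lemma one_le_sum_pow_div_factorial {k : ℕ} (hk : 1 ≤ k) {y : ℝ} (hy : 0 ≤ y) :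
    1 ≤ ∑ d ∈ range k, y ^ d / (d.factorial : ℝ) := by
  have := single_le_sum (s := range k) (f := fun d => y ^ d / (d.factorial : ℝ))
    (fun d _ => by positivity) (mem_range.2 hk)
  simpa using this

lemma exp_neg_le_poisLow {k : ℕ} (hk : 1 ≤ k) {y : ℝ} (hy : 0 ≤ y) :
    Real.exp (-y) ≤ poisLow k y :=
  le_mul_of_one_le_right (Real.exp_pos _).le (one_le_sum_pow_div_factorial hk hy)

lemma poisLow_pos {k : ℕ} (hk : 1 ≤ k) {y : ℝ} (hy : 0 ≤ y) : 0 < poisLow k y :=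
  (Real.exp_pos _).trans_le (exp_neg_le_poisLow hk hy)

lemma binSum_nonneg (k m : ℕ) {t : ℝ} (ht : 0 ≤ t) : 0 ≤ binSum k m t :=
  sum_nonneg fun _ _ => by positivity

lemma binSum_mul_exp_le (k m : ℕ) {n : ℕ} (hmn : m ≤ n) {t c : ℝ} (ht : 0 ≤ t) (hc : 0 ≤ c) :
    binSum k m (t * Real.exp c) ≤
      Real.exp (c * k) * ∑ d ∈ range k, (n * t) ^ d / (d.factorial : ℝ) := by
  rw [binSum, mul_sum]
  refine sum_le_sum fun d hd => ?_
  have h1 : (m.choose d : ℝ) ≤ (n : ℝ) ^ d / d.factorial :=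
    (Nat.choose_le_pow_div d m).trans (by gcongr)
  have h2 : Real.exp c ^ d ≤ Real.exp (c * k) := by
    rw [← Real.exp_nat_mul]
    refine Real.exp_le_exp.2 ?_
    rw [mul_comm]
    exact mul_le_mul_of_nonneg_left (by exact_mod_cast (mem_range.1 hd).le) hc
  calc (m.choose d : ℝ) * (t * Real.exp c) ^ d = (m.choose d) * t ^ d * Real.exp c ^ d := by ring
    _ ≤ ((n : ℝ) ^ d / d.factorial) * t ^ d * Real.exp (c * k) := by gcongr
    _ = _ := by ring

/-- Here C(m,d) ≥ (m+1-d)^d/d! and m + 1 - d ≥ n - (r + k). The correction factor lies in [0,1], so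
its exponent d may be raised to k. -/
lemma le_binSum (k m : ℕ) {n r : ℕ} (hn : n = m + r) (hrk : r + k ≤ n) (hn0 : 0 < n) {t u : ℝ}
    (ht : 0 ≤ t) (hu : 0 ≤ u) (hu1 : u ≤ 1) :
    ((1 - (r + k : ℝ) / n) * u) ^ k * ∑ d ∈ range k, (n * t) ^ d / (d.factorial : ℝ) ≤
      binSum k m (t * u) := by
  have hn' : (0 : ℝ) < n := by exact_mod_cast hn0
  have hrk' : (r + k : ℝ) ≤ n := by exact_mod_cast hrk
  have h0 : 0 ≤ 1 - (r + k : ℝ) / n := by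
    rw [sub_nonneg, div_le_one hn']; exact hrk'
  have h1 : 1 - (r + k : ℝ) / n ≤ 1 := by
    have : 0 ≤ (r + k : ℝ) / n := by positivity
    linarith
  rw [binSum, mul_sum]
  refine sum_le_sum fun d hd => ?_
  have hd' := mem_range.1 hd
  have h2 : ((n : ℝ) * (1 - (r + k : ℝ) / n)) ^ d / d.factorial ≤ m.choose d := by
    refine le_trans ?_ (Nat.pow_le_choose d m)
    have : (n : ℝ) * (1 - (r + k : ℝ) / n) ≤ ((m + 1 - d : ℕ) : ℝ) := by
      have h3 : (n : ℝ) * (1 - (r + k : ℝ) / n) = ((n - (r + k) : ℕ) : ℝ) := by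
        rw [Nat.cast_sub hrk]; push_cast; field_simp
      rw [h3]; exact_mod_cast (by omega : n - (r + k) ≤ m + 1 - d)
    gcongr
  calc ((1 - (r + k : ℝ) / n) * u) ^ k * ((n * t) ^ d / d.factorial)
      ≤ ((1 - (r + k : ℝ) / n) * u) ^ d * ((n * t) ^ d / d.factorial) := by
        refine mul_le_mul_of_nonneg_right ?_ (by positivity)
        exact pow_le_pow_of_le_one (by positivity) (mul_le_one₀ h1 hu hu1) hd'.le
    _ = ((n : ℝ) * (1 - (r + k : ℝ) / n)) ^ d / d.factorial * (t * u) ^ d := by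
        rw [mul_pow, mul_pow, mul_pow, mul_pow]; ring
    _ ≤ _ := by gcongr

variable {ι W : Type*} [Fintype ι] [DecidableEq ι] [Fintype W] [DecidableEq W]
  {ν : Finset ι → ℝ} {π η : ℝ} {r n k : ℕ}

/-- This is `lowSum_le` with c = rπ - r²η, c' = rπ and ρ = π. Since |W| = n - r, multiplying by
e^{rnπ} to reach `poisLow` leaves only the displayed exponential; the bound is sharp when π and nη
are small. -/
lemma lowSum_le_poisLow (hr : Fintype.card ι = r) (hn : n = Fintype.card W + r)
    (hν : ∀ A, 0 ≤ ν A) (h1 : ∑ A, ν A = 1) (hπ0 : 0 ≤ π) (hm : ∀ i, ∑ A with i ∈ A, ν A = π)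
    (hη0 : 0 ≤ η) (hη : ∀ i j, i ≠ j → ∑ A with i ∈ A ∧ j ∈ A, ν A ≤ η) {θ : ℝ} (hθ0 : 0 ≤ θ)
    (hθ : (r : ℝ) ^ 2 * η ≤ θ * ν ∅) :
    (1 - n * θ) * lowSum W k ν ≤ poisLow k (n * π) ^ r *
      Real.exp ((r : ℝ) ^ 2 * ((k + 1) * π + n * η)) := by
  have hmn : Fintype.card W ≤ n := by omega
  have hmn' : (Fintype.card W : ℝ) = n - r := by rw [hn]; push_cast; ring
  have hr0 : (0 : ℝ) ≤ r := Nat.cast_nonneg r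
  have hc : ν ∅ ≤ Real.exp (-(r * π - (r : ℝ) ^ 2 * η)) := by
    have := weight_empty_le hν h1 hm hη0 hη
    rw [hr] at this
    have h2 := Real.add_one_le_exp (-(r * π - (r : ℝ) ^ 2 * η))
    linarith
  have h2 := sum_two_le_card_le hν hη0 hη
  rw [hr] at h2
  have key := lowSum_le (W := W) k ν hν h2 hθ hθ0 hc (c' := r * π)
    (by nlinarith [mul_nonneg (sq_nonneg (r : ℝ)) hη0]) hπ0 (weight_singleton_le hν hm)
  rw [hr] at key
  have h3 : (1 - n * θ) * lowSum W k ν ≤ (1 - Fintype.card W * θ) * lowSum W k ν := by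
    refine mul_le_mul_of_nonneg_right ?_ (lowSum_nonneg k hν)
    have : (Fintype.card W : ℝ) * θ ≤ n * θ := by gcongr
    linarith
  refine h3.trans (key.trans ?_)
  have h4 := binSum_mul_exp_le k _ hmn hπ0 (mul_nonneg hr0 hπ0)
  have h5 : 0 ≤ binSum k (Fintype.card W) (π * Real.exp (r * π)) :=
    binSum_nonneg _ _ (by positivity)
  calc _ ≤ Real.exp (-((r * π - (r : ℝ) ^ 2 * η) * Fintype.card W)) *
        (Real.exp (r * π * k) * ∑ d ∈ range k, (n * π) ^ d / (d.factorial : ℝ)) ^ r := by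
        gcongr
    _ = Real.exp (-((r * π - (r : ℝ) ^ 2 * η) * Fintype.card W) + r * (r * π * k) + r * (n * π)) *
        poisLow k (n * π) ^ r := by
        rw [poisLow, mul_pow, mul_pow, ← Real.exp_nat_mul, ← Real.exp_nat_mul, Real.exp_add,
          Real.exp_add]
        have : Real.exp (r * (n * π)) * Real.exp (r * -(n * π)) = 1 := by
          rw [← Real.exp_add, ← Real.exp_zero]; congr 1; ring
        calc _ = Real.exp (-((r * π - (r : ℝ) ^ 2 * η) * Fintype.card W)) *
            Real.exp (r * (r * π * k)) * 1 *
            (∑ d ∈ range k, (n * π) ^ d / (d.factorial : ℝ)) ^ r := by ring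
          _ = _ := by rw [← this]; ring
    _ ≤ _ := by
        rw [mul_comm]
        have hp : 0 ≤ poisLow k (n * π) := mul_nonneg (Real.exp_pos _).le
          (sum_pow_div_factorial_nonneg k (by positivity))
        refine mul_le_mul_of_nonneg_left (Real.exp_le_exp.2 ?_) (pow_nonneg hp _)
        rw [hmn']
        have : 0 ≤ (r : ℝ) ^ 3 * η := by positivity
        nlinarith

/-- The Chernoff bound with `poisLow` estimated below by e^{-nπ}. It needs no smallness of nη, at
the price of an exponential that may grow like a small power of n. -/
lemma lowSum_le_crude (hr : Fintype.card ι = r) (hn : n = Fintype.card W + r) (hk : 1 ≤ k)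
    (hν : ∀ A, 0 ≤ ν A) (h1 : ∑ A, ν A = 1) (hπ0 : 0 ≤ π) (hm : ∀ i, ∑ A with i ∈ A, ν A = π)
    (hη0 : 0 ≤ η) (hη : ∀ i j, i ≠ j → ∑ A with i ∈ A ∧ j ∈ A, ν A ≤ η) {z : ℝ} (hz : 0 < z)
    (hz1 : z ≤ 1) :
    lowSum W k ν ≤ poisLow k (n * π) ^ r * ((z⁻¹) ^ (r * k) *
      Real.exp ((r : ℝ) ^ 2 * (π + n * η) + z * r * (n * π))) := by
  have hmn' : (Fintype.card W : ℝ) = n - r := by rw [hn]; push_cast; ring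
  have hm0 : (0 : ℝ) ≤ n - r := by rw [← hmn']; positivity
  have hr0 : (0 : ℝ) ≤ r := Nat.cast_nonneg r
  have key := lowSum_le_exp (W := W) k ν hν h1 hz hz1
  rw [hr] at key
  refine key.trans ?_
  have he := weight_empty_le hν h1 hm hη0 hη
  have he2 := one_sub_le_weight_empty hν h1 hm
  rw [hr] at he he2
  have hp : Real.exp (-(r * (n * π))) ≤ poisLow k (n * π) ^ r := by
    have := pow_le_pow_left₀ (Real.exp_pos _).le
      (exp_neg_le_poisLow hk (by positivity : 0 ≤ (n : ℝ) * π)) r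
    rwa [← Real.exp_nat_mul, mul_neg] at this
  calc _ ≤ (z⁻¹) ^ (r * k) * Real.exp (-(r * (n * π)) +
        ((r : ℝ) ^ 2 * (π + n * η) + z * r * (n * π))) := by
        refine mul_le_mul_of_nonneg_left (Real.exp_le_exp.2 ?_) (by positivity)
        rw [hmn']
        have h3 : r * π - (r : ℝ) ^ 2 * η - z * (r * π) ≤ (1 - z) * (1 - ν ∅) := by nlinarith
        have h4 := mul_le_mul_of_nonneg_left h3 hm0
        have : 0 ≤ (r : ℝ) ^ 3 * η := by positivity
        have : 0 ≤ z * (r : ℝ) ^ 2 * π := by positivity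
        nlinarith
    _ = Real.exp (-(r * (n * π))) * ((z⁻¹) ^ (r * k) *
        Real.exp ((r : ℝ) ^ 2 * (π + n * η) + z * r * (n * π))) := by
        rw [Real.exp_add]; ring
    _ ≤ _ := by gcongr

lemma exp_neg_sub_le_one_sub {t : ℝ} (ht : t ≤ 1 / 2) :
    Real.exp (-(t + 2 * t ^ 2)) ≤ 1 - t := by
  have hpos : 0 < 1 - t := by linarith
  rw [← Real.le_log_iff_exp_le hpos]
  refine le_trans ?_ (Real.one_sub_inv_le_log_of_pos hpos)
  have : (1 - t)⁻¹ ≤ 1 + t + 2 * t ^ 2 := by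
    rw [inv_le_iff_one_le_mul₀ hpos]
    nlinarith [sq_nonneg t]
  linarith

/-- Pair probabilities enter only relative to π, through ϑ: the union bound ν ∅ ≥ 1 - rπ does not
involve them, and singletons have weight at least π(1 - rϑ). So nη need not be small here, in
contrast to the upper bound. -/
lemma poisLow_le_lowSum (hr : Fintype.card ι = r) (hn : n = Fintype.card W + r) (hn0 : 0 < n)
    (hrk : r + k ≤ n)
    (hν : ∀ A, 0 ≤ ν A) (h1 : ∑ A, ν A = 1) (hπ0 : 0 ≤ π) (hm : ∀ i, ∑ A with i ∈ A, ν A = π)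
    {ϑ : ℝ} (hϑ0 : 0 ≤ ϑ) (hη : ∀ i j, i ≠ j → ∑ A with i ∈ A ∧ j ∈ A, ν A ≤ ϑ * π)
    (hϑ : r * ϑ ≤ 1) (hπ : r * π ≤ 1 / 2) (hπ1 : π ≤ 1) (hsmall : n * (2 ^ r * π ^ 2) ≤ 1) :
    poisLow k (n * π) ^ r * (Real.exp (-(n * (2 * (r * π) ^ 2))) *
      ((1 - n * (2 ^ r * π ^ 2)) * (((1 - (r + k : ℝ) / n) * (1 - r * ϑ)) ^ k) ^ r)) ≤
      lowSum W k ν := by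
  have hmn' : (Fintype.card W : ℝ) ≤ n := by exact_mod_cast (by omega : Fintype.card W ≤ n)
  have hr0 : (0 : ℝ) ≤ r := Nat.cast_nonneg r
  have hu : 0 ≤ 1 - r * ϑ := by linarith
  have hu1 : 1 - r * ϑ ≤ 1 := by nlinarith
  have hrπ : 0 ≤ r * π := by positivity
  have he := one_sub_le_weight_empty hν h1 hm
  have hs := le_weight_singleton hν hm (mul_nonneg hϑ0 hπ0) hη
  rw [hr] at he hs
  have h0 : ν ∅ ≤ 1 := h1 ▸ single_le_sum (fun A _ => hν A) (mem_univ ∅)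
  have key := le_lowSum (W := W) k ν hν h0 (mul_nonneg hπ0 hu) (mul_le_one₀ hπ1 hu hu1)
    (fun i => by linarith [hs i])
  rw [hr] at key
  refine le_trans ?_ key
  have hb := le_binSum k (Fintype.card W) hn hrk hn0 hπ0 hu hu1
  have hpow : Real.exp (-(r * (n * π))) * Real.exp (-(n * (2 * (r * π) ^ 2))) ≤
      ν ∅ ^ Fintype.card W := by
    have h2 : Real.exp (-(r * π + 2 * (r * π) ^ 2)) ≤ ν ∅ :=
      (exp_neg_sub_le_one_sub hπ).trans he
    refine le_trans ?_ (pow_le_pow_left₀ (Real.exp_pos _).le h2 _)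
    rw [← Real.exp_nat_mul, ← Real.exp_add]
    refine Real.exp_le_exp.2 ?_
    have h3 : 0 ≤ r * π + 2 * (r * π) ^ 2 := by positivity
    nlinarith [mul_le_mul_of_nonneg_right hmn' h3]
  have hfac : 0 ≤ (1 - (r + k : ℝ) / n) := by
    have hn' : (0 : ℝ) < n := by exact_mod_cast hn0
    rw [sub_nonneg, div_le_one hn']; exact_mod_cast hrk
  have hS := sum_pow_div_factorial_nonneg k (y := n * π) (by positivity)
  have hq : 1 - n * (2 ^ r * π ^ 2) ≤
      1 - Fintype.card W * (2 ^ r * (π * (1 - r * ϑ)) ^ 2) := by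
    have h5 : (π * (1 - r * ϑ)) ^ 2 ≤ π ^ 2 :=
      pow_le_pow_left₀ (by positivity) (mul_le_of_le_one_right hπ0 hu1) 2
    have : (Fintype.card W : ℝ) * (2 ^ r * (π * (1 - r * ϑ)) ^ 2) ≤ n * (2 ^ r * π ^ 2) := by
      gcongr
    linarith
  have hq0 : 0 ≤ 1 - n * (2 ^ r * π ^ 2) := by linarith
  calc _ = (Real.exp (-(r * (n * π))) * Real.exp (-(n * (2 * (r * π) ^ 2)))) *
        ((1 - n * (2 ^ r * π ^ 2)) * (((1 - (r + k : ℝ) / n) * (1 - r * ϑ)) ^ k *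
          ∑ d ∈ range k, (n * π) ^ d / (d.factorial : ℝ)) ^ r) := by
        rw [poisLow, mul_pow, mul_pow _ _ r, ← Real.exp_nat_mul, mul_neg]; ring
    _ ≤ _ := by
        have := hν ∅
        have := hq0.trans hq
        gcongr

lemma lowSum_le_one (hν : ∀ A, 0 ≤ ν A) (h1 : ∑ A, ν A = 1) : lowSum W k ν ≤ 1 := by
  calc lowSum W k ν ≤ ∑ a : W → Finset ι, ∏ w, ν (a w) :=
        sum_le_sum_of_subset_of_nonneg (subset_univ _) fun a _ _ => prod_nonneg fun _ _ => hν _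
    _ = ∏ _w : W, ∑ A, ν A := by rw [prod_univ_sum]; simp
    _ = 1 := by simp [h1]

end Bounds

/-! ### Bounds for a fixed set of nodes at a fixed graph size -/

section GraphBounds

open Finset

lemma shareProb_le_one {P K : ℕ} (h : K ≤ P) (q : ℕ) : shareProb q P K ≤ 1 := by
  obtain ⟨A⟩ := KeyRing.nonempty h
  rw [← ringAvg_share h q A]
  refine le_trans (ringAvg_mono fun T => ?_) (ringAvg_const h (1 : ℝ)).le
  split_ifs <;> norm_num

section Pair

variable {ι : Type*} [Fintype ι] [DecidableEq ι] {P K q : ℕ} {s : ι → KeyRing P K} {i j : ι}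

/-- One of the two key conditions is dropped and both channels are kept: this is the bound for small
p. -/
lemma sum_nbrWeight_pair_le_mul (h : K ≤ P) {p : ℝ} (hij : i ≠ j) :
    ∑ A with i ∈ A ∧ j ∈ A, nbrWeight q p s A ≤ p ^ 2 * shareProb q P K := by
  rw [sum_nbrWeight_mem_mem hij, ← ringAvg_share h q (s i)]
  refine mul_le_mul_of_nonneg_left (ringAvg_mono fun T => ?_) (sq_nonneg p)
  split_ifs with h1 h2 h2
  · exact le_rfl
  · exact absurd h1.1 h2
  · norm_num
  · exact le_rfl

/-- One channel is dropped and both key conditions are kept: this is the bound for rings with little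
overlap, `β` measuring the overlap. -/
lemma sum_nbrWeight_pair_le (h : K ≤ P) (hq : 1 ≤ q) (hK : 0 < K) {p : ℝ} (hp0 : 0 ≤ p)
    (hp1 : p ≤ 1) (hτ : shareMean q P K ≤ 2 * shareProb q P K) (hij : i ≠ j) {β : ℝ}
    (hβ : q * (((s i).1 ∩ (s j).1).card / K : ℝ) ≤ β) :
    ∑ A with i ∈ A ∧ j ∈ A, nbrWeight q p s A ≤
      2 * ((K : ℝ) ^ 2 / P + β) * (p * shareProb q P K) := by
  rw [sum_nbrWeight_mem_mem hij]
  have hx : 0 ≤ (K : ℝ) ^ 2 / P := by positivity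
  have hβ0 : 0 ≤ β := le_trans (by positivity) hβ
  have hσ := shareProb_nonneg q P K
  calc _ ≤ p ^ 2 * (2 * shareProb q P K * ((K : ℝ) ^ 2 / P + β)) := by
        refine mul_le_mul_of_nonneg_left
          ((ringAvg_share_both_le h hq hK (s i) (s j)).trans ?_) (sq_nonneg p)
        have := shareMean_nonneg q P K
        gcongr
    _ = p * (2 * ((K : ℝ) ^ 2 / P + β) * (p * shareProb q P K)) := by ring
    _ ≤ _ := mul_le_of_le_one_left (by positivity) hp1

end Pair

lemma card_notMem {n r : ℕ} {R : Finset (Fin n)} (hR : R.card = r) :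
    n = Fintype.card {w // w ∉ R} + r := by
  have := Fintype.card_subtype_compl (fun i => i ∈ R)
  rw [Fintype.card_fin, Fintype.card_coe] at this
  have h2 : R.card ≤ n := by simpa using card_le_univ R
  omega

lemma sum_keyRing_weight {P K : ℕ} (h : K ≤ P) (ι : Type*) [Fintype ι] [DecidableEq ι] :
    ∑ _s : ι → KeyRing P K, (((P.choose K : ℕ) : ℝ)⁻¹) ^ Fintype.card ι = 1 := by
  have h1 := sum_prod_ringAvg (P := P) (K := K) (W := ι) (fun _ _ => 1)
  simpa [ringAvg_const h] using h1

variable {n K P q k r : ℕ} {p : unitInterval} {R : Finset (Fin n)}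

lemma one_sub_mul_lowEvent_le (h : K ≤ P) (hR : R.card = r) {η θ : ℝ} (hη0 : 0 ≤ η)
    (hη : ∀ (s : {i // i ∈ R} → KeyRing P K) (i j), i ≠ j →
      ∑ A with i ∈ A ∧ j ∈ A, nbrWeight q (p : ℝ) s A ≤ η) (hθ0 : 0 ≤ θ)
    (hθ : ∀ s : {i // i ∈ R} → KeyRing P K, (r : ℝ) ^ 2 * η ≤ θ * nbrWeight q (p : ℝ) s ∅)
    (hn : n * θ ≤ 1) :
    (1 - n * θ) * (graphLaw q n K P p).real (lowEvent k R) ≤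
      poisLow k (n * (p * shareProb q P K)) ^ r *
        Real.exp ((r : ℝ) ^ 2 * ((k + 1) * (p * shareProb q P K) + n * η)) := by
  have hp0 := p.2.1
  have hp1 := p.2.2
  refine (mul_le_mul_of_nonneg_left (graphLaw_lowEvent_le h q k p R) (by linarith)).trans ?_
  have hcard : Fintype.card {i // i ∈ R} = r := by rw [Fintype.card_coe, hR]
  have hw := sum_keyRing_weight h {i // i ∈ R}
  rw [Fintype.card_coe] at hw
  rw [mul_sum]
  refine le_trans (sum_le_sum (g := fun _ => (((P.choose K : ℕ) : ℝ)⁻¹) ^ R.card *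
    (poisLow k (n * (p * shareProb q P K)) ^ r *
      Real.exp ((r : ℝ) ^ 2 * ((k + 1) * (p * shareProb q P K) + n * η)))) fun s _ => ?_)
    (le_of_eq (by rw [← sum_mul, hw, one_mul]))
  rw [mul_left_comm]
  refine mul_le_mul_of_nonneg_left ?_ (by positivity)
  exact lowSum_le_poisLow hcard (card_notMem hR) (nbrWeight_nonneg hp0 hp1) (sum_nbrWeight h)
    (mul_nonneg hp0 (shareProb_nonneg _ _ _)) (sum_nbrWeight_mem h) hη0 (hη s) hθ0 (hθ s)

/-- A single node has no pairs, so η = θ = 0 is allowed. The bound holds for every size of the link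
probability, as the case α → ∞ requires. -/
lemma lowEvent_singleton_le (h : K ≤ P) (v : Fin n) :
    (graphLaw q n K P p).real (lowEvent k {v}) ≤
      poisLow k (n * (p * shareProb q P K)) * Real.exp (k + 1) := by
  have hp0 := p.2.1
  have hp1 := p.2.2
  have key := one_sub_mul_lowEvent_le (n := n) (q := q) (k := k) (p := p) h (card_singleton v)
    (η := 0) (θ := 0) le_rfl
    (fun s i j hij => absurd (Subsingleton.elim i j) hij) le_rfl (by simp) (by simp)
  simp only [mul_zero, sub_zero, one_mul, pow_one, Nat.cast_one, one_pow, add_zero] at key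
  have hπ0 : 0 ≤ (p : ℝ) * shareProb q P K := mul_nonneg hp0 (shareProb_nonneg _ _ _)
  refine key.trans (mul_le_mul_of_nonneg_left (Real.exp_le_exp.2 ?_) ?_)
  · exact mul_le_of_le_one_right (by positivity)
      (mul_le_one₀ hp1 (shareProb_nonneg _ _ _) (shareProb_le_one h q))
  · exact mul_nonneg (Real.exp_pos _).le (sum_pow_div_factorial_nonneg k (by positivity))

lemma half_le_nbrWeight_empty (h : K ≤ P) (hR : R.card = r)
    (hπ : r * ((p : ℝ) * shareProb q P K) ≤ 1 / 2) (s : {i // i ∈ R} → KeyRing P K) :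
    1 / 2 ≤ nbrWeight q (p : ℝ) s ∅ := by
  have hcard : Fintype.card {i // i ∈ R} = r := by rw [Fintype.card_coe, hR]
  have := one_sub_le_weight_empty (nbrWeight_nonneg (q := q) (s := s) p.2.1 p.2.2)
    (sum_nbrWeight h) (sum_nbrWeight_mem h)
  rw [hcard] at this
  linarith

lemma sum_sum_indicator_le (h : K ≤ P) (hR : R.card = r) (t : ℕ) :
    ∑ s : {i // i ∈ R} → KeyRing P K, (((P.choose K : ℕ) : ℝ)⁻¹) ^ R.card *
      ∑ i, ∑ j, (if i ≠ j ∧ t ≤ ((s i).1 ∩ (s j).1).card then (1 : ℝ) else 0) ≤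
    (r : ℝ) ^ 2 * ((K : ℝ) ^ 2 / P) ^ t := by
  have hcard : Fintype.card {i // i ∈ R} = r := by rw [Fintype.card_coe, hR]
  simp only [mul_sum]
  rw [sum_comm]
  have h1 : ∀ i : {i // i ∈ R}, ∑ s : {i // i ∈ R} → KeyRing P K, ∑ j : {i // i ∈ R},
      (((P.choose K : ℕ) : ℝ)⁻¹) ^ R.card *
        (if i ≠ j ∧ t ≤ ((s i).1 ∩ (s j).1).card then (1 : ℝ) else 0) ≤
      r * ((K : ℝ) ^ 2 / P) ^ t := by
    intro i
    rw [sum_comm, ← hcard, ← card_univ, ← nsmul_eq_mul]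
    refine sum_le_card_nsmul _ _ _ fun j _ => ?_
    by_cases hij : i = j
    · simp only [hij, ne_eq, not_true_eq_false, false_and, if_false, mul_zero, sum_const_zero]
      positivity
    · have := sum_card_inter_le h hij t
      rw [Fintype.card_coe] at this
      simpa only [ne_eq, hij, not_false_eq_true, true_and] using this
  refine (sum_le_card_nsmul _ _ _ fun i _ => h1 i).trans (le_of_eq ?_)
  rw [card_univ, hcard, nsmul_eq_mul]; ring

/-- The three terms belong to disjoint rings (sharp bound, η = 2xπ), to rings that meet in fewer
than t keys (crude bound, with β, and probability at most r²x), and to rings with an overlap of at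
least t keys (trivial bound 1, and probability at most r²x^t). -/
lemma lowEvent_le_of_overlap (h : K ≤ P) (hq : 1 ≤ q) (hK : 0 < K) (hk : 1 ≤ k) (hR : R.card = r)
    (hτ : shareMean q P K ≤ 2 * shareProb q P K) (hπ : r * ((p : ℝ) * shareProb q P K) ≤ 1 / 2)
    {π x y θ β z : ℝ} (hπdef : π = p * shareProb q P K) (hx : x = (K : ℝ) ^ 2 / P)
    (hy : y = n * π)
    (hθ : θ = 4 * (r : ℝ) ^ 2 * (x * y)) (hn : θ < 1) {t : ℕ} (ht : q * (t : ℝ) ≤ β * K)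
    (hz : 0 < z) (hz1 : z ≤ 1) :
    (graphLaw q n K P p).real (lowEvent k R) ≤
      poisLow k y ^ r * (Real.exp ((r : ℝ) ^ 2 * ((k + 1) * π + 2 * x * y)) / (1 - θ) +
        (r : ℝ) ^ 2 * (x * ((z⁻¹) ^ (r * k) *
          Real.exp ((r : ℝ) ^ 2 * (π + 2 * (x + β) * y) + z * r * y)))) +
      (r : ℝ) ^ 2 * x ^ t := by
  have hp0 := p.2.1
  have hp1 := p.2.2
  have hcard : Fintype.card {i // i ∈ R} = r := by rw [Fintype.card_coe, hR]
  have hπ0 : 0 ≤ π := hπdef ▸ mul_nonneg hp0 (shareProb_nonneg _ _ _)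
  have hx0 : 0 ≤ x := by rw [hx]; positivity
  have hy0 : 0 ≤ y := by rw [hy]; positivity
  have hK' : (0 : ℝ) < K := by exact_mod_cast hK
  have hβ0 : 0 ≤ β := by
    by_contra hβ
    have : β * K < 0 := mul_neg_of_neg_of_pos (not_le.1 hβ) hK'
    have : 0 ≤ (q : ℝ) * t := by positivity
    linarith
  have hw := sum_keyRing_weight h {i // i ∈ R}
  rw [Fintype.card_coe] at hw
  have hpois : 0 < poisLow k y := poisLow_pos hk hy0
  set U := Real.exp ((r : ℝ) ^ 2 * ((k + 1) * π + 2 * x * y)) / (1 - θ) with hU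
  set B := (z⁻¹) ^ (r * k) * Real.exp ((r : ℝ) ^ 2 * (π + 2 * (x + β) * y) + z * r * y) with hB
  have hU0 : 0 ≤ U := div_nonneg (Real.exp_pos _).le (by linarith)
  have hB0 : 0 ≤ B := by positivity
  have hbound : ∀ s : {i // i ∈ R} → KeyRing P K,
      lowSum {w // w ∉ R} k (nbrWeight q (p : ℝ) s) ≤ poisLow k y ^ r * U +
        poisLow k y ^ r * B *
          ∑ i, ∑ j, (if i ≠ j ∧ 1 ≤ ((s i).1 ∩ (s j).1).card then (1 : ℝ) else 0) +
        ∑ i, ∑ j, (if i ≠ j ∧ t ≤ ((s i).1 ∩ (s j).1).card then (1 : ℝ) else 0) := by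
    intro s
    have hnn : ∀ t' : ℕ, 0 ≤ ∑ i, ∑ j,
        (if i ≠ j ∧ t' ≤ ((s i).1 ∩ (s j).1).card then (1 : ℝ) else 0) := fun t' =>
      sum_nonneg fun i _ => sum_nonneg fun j _ => by split_ifs <;> norm_num
    have hone : ∀ t' : ℕ, (∃ i j, i ≠ j ∧ t' ≤ ((s i).1 ∩ (s j).1).card) → 1 ≤ ∑ i, ∑ j,
        (if i ≠ j ∧ t' ≤ ((s i).1 ∩ (s j).1).card then (1 : ℝ) else 0) := by
      rintro t' ⟨i, j, hij⟩
      have h0 : ∀ i j, (0 : ℝ) ≤ if i ≠ j ∧ t' ≤ ((s i).1 ∩ (s j).1).card then 1 else 0 :=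
        fun i j => by split_ifs <;> norm_num
      have h1 := single_le_sum (fun j _ => h0 i j) (mem_univ j)
      rw [if_pos hij] at h1
      exact h1.trans (single_le_sum (f := fun i => ∑ j,
        if i ≠ j ∧ t' ≤ ((s i).1 ∩ (s j).1).card then (1 : ℝ) else 0)
        (fun i _ => sum_nonneg fun j _ => h0 i j) (mem_univ i))
    have hνn := nbrWeight_nonneg (q := q) (s := s) hp0 hp1
    have hν1 := sum_nbrWeight (q := q) (p := (p : ℝ)) (s := s) h
    have hνm := sum_nbrWeight_mem (q := q) (p := (p : ℝ)) (s := s) h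
    rw [← hπdef] at hνm
    have hn1 := hnn 1
    have hnt := hnn t
    have hpow : 0 < poisLow k y ^ r := by positivity
    by_cases hC : ∃ i j, i ≠ j ∧ t ≤ ((s i).1 ∩ (s j).1).card
    · have h1 := hone t hC
      have h2 := lowSum_le_one (W := {w // w ∉ R}) (k := k) hνn hν1
      have : 0 ≤ poisLow k y ^ r * U := by positivity
      have : 0 ≤ poisLow k y ^ r * B * ∑ i, ∑ j,
        (if i ≠ j ∧ 1 ≤ ((s i).1 ∩ (s j).1).card then (1 : ℝ) else 0) := by positivity
      linarith
    · push Not at hC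
      by_cases hD : ∃ i j, i ≠ j ∧ 1 ≤ ((s i).1 ∩ (s j).1).card
      · have h1 := hone 1 hD
        have h2 := lowSum_le_crude (W := {w // w ∉ R}) (k := k) hcard (card_notMem hR) hk hνn hν1
          hπ0 hνm (η := 2 * (x + β) * π) (by positivity) (fun i j hij => by
            rw [hx, hπdef]
            refine sum_nbrWeight_pair_le h hq hK hp0 hp1 hτ hij ?_
            rw [← mul_div_assoc, div_le_iff₀ hK']
            refine le_trans ?_ ht
            gcongr
            exact (hC i j hij).le) hz hz1
        rw [← hy] at h2
        have h3 : (n : ℝ) * (2 * (x + β) * π) = 2 * (x + β) * y := by rw [hy]; ring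
        rw [h3, ← hB] at h2
        have h4 := mul_le_mul_of_nonneg_left h1 (by positivity : 0 ≤ poisLow k y ^ r * B)
        have : 0 ≤ poisLow k y ^ r * U := by positivity
        linarith
      · push Not at hD
        have h2 := lowSum_le_poisLow (W := {w // w ∉ R}) (k := k) hcard (card_notMem hR) hνn hν1
          hπ0 hνm (η := 2 * x * π) (by positivity) (fun i j hij => by
            have := sum_nbrWeight_pair_le (s := s) h hq hK hp0 hp1 hτ hij (β := 0) (by
              have := hD i j hij
              rw [Nat.lt_one_iff.1 this]; simp)
            -- Since `ν ∅` is at least 1/2, twice r²η = 2r²xπ is enough.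
            rwa [add_zero, ← hx, ← hπdef] at this) (θ := 4 * (r : ℝ) ^ 2 * (x * π))
            (by positivity) (by
              have h3 := half_le_nbrWeight_empty h hR hπ s
              have h4 : 0 ≤ 4 * (r : ℝ) ^ 2 * (x * π) := by positivity
              have h5 := mul_le_mul_of_nonneg_left h3 h4
              linarith)
        have h3 : (n : ℝ) * (2 * x * π) = 2 * x * y := by rw [hy]; ring
        have h4 : (n : ℝ) * (4 * (r : ℝ) ^ 2 * (x * π)) = θ := by rw [hθ, hy]; ring
        rw [h3, h4, ← hy] at h2
        have h5 : lowSum {w // w ∉ R} k (nbrWeight q (p : ℝ) s) ≤ poisLow k y ^ r * U := by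
          rw [hU, mul_div_assoc', le_div_iff₀ (by linarith), mul_comm]
          exact h2
        have : 0 ≤ poisLow k y ^ r * B * ∑ i, ∑ j,
          (if i ≠ j ∧ 1 ≤ ((s i).1 ∩ (s j).1).card then (1 : ℝ) else 0) := by positivity
        linarith
  refine (graphLaw_lowEvent_le h q k p R).trans ?_
  refine (sum_le_sum fun s _ => mul_le_mul_of_nonneg_left (hbound s) (by positivity)).trans ?_
  simp only [mul_add]
  rw [sum_add_distrib, sum_add_distrib, ← sum_mul, hw, one_mul]
  have h1 := sum_sum_indicator_le (R := R) h hR 1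
  have h2 := sum_sum_indicator_le (R := R) h hR t
  rw [← hx] at h1 h2
  have h3 := mul_le_mul_of_nonneg_left h1 (by positivity : 0 ≤ poisLow k y ^ r * B)
  rw [mul_sum] at h3
  refine add_le_add (add_le_add le_rfl ?_) h2
  refine le_trans (le_of_eq (sum_congr rfl fun s _ => ?_)) (h3.trans (le_of_eq ?_))
  · ring
  · ring

/-- Only disjoint rings are kept; a union bound over pairs gives them probability at least 1 - r²x,
and on them ϑ = 2x is admissible. -/
lemma le_lowEvent (h : K ≤ P) (hq : 1 ≤ q) (hK : 0 < K) (hk : 1 ≤ k) (hR : R.card = r)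
    (hτ : shareMean q P K ≤ 2 * shareProb q P K) (hn0 : 0 < n) (hrk : r + k ≤ n)
    {π x y : ℝ} (hπdef : π = p * shareProb q P K) (hx : x = (K : ℝ) ^ 2 / P)
    (hy : y = n * π) (hπ : r * π ≤ 1 / 2) (hϑ : r * (2 * x) ≤ 1)
    (hsmall : n * (2 ^ r * π ^ 2) ≤ 1) :
    poisLow k y ^ r * ((1 - (r : ℝ) ^ 2 * x) * (Real.exp (-(n * (2 * (r * π) ^ 2))) *
      ((1 - n * (2 ^ r * π ^ 2)) *
        (((1 - (r + k : ℝ) / n) * (1 - r * (2 * x))) ^ k) ^ r))) ≤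
      (graphLaw q n K P p).real (lowEvent k R) := by
  classical
  have hp0 := p.2.1
  have hp1 := p.2.2
  have hcard : Fintype.card {i // i ∈ R} = r := by rw [Fintype.card_coe, hR]
  have hπ0 : 0 ≤ π := hπdef ▸ mul_nonneg hp0 (shareProb_nonneg _ _ _)
  have hπ1 : π ≤ 1 := hπdef ▸ mul_le_one₀ hp1 (shareProb_nonneg _ _ _) (shareProb_le_one h q)
  have hx0 : 0 ≤ x := by rw [hx]; positivity
  have hy0 : 0 ≤ y := by rw [hy]; positivity
  have hpois : 0 < poisLow k y := poisLow_pos hk hy0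
  have hw := sum_keyRing_weight h {i // i ∈ R}
  rw [Fintype.card_coe] at hw
  refine le_trans ?_ (le_graphLaw_lowEvent h hq k p R)
  set Lo := poisLow k y ^ r * (Real.exp (-(n * (2 * (r * π) ^ 2))) *
      ((1 - n * (2 ^ r * π ^ 2)) *
        (((1 - (r + k : ℝ) / n) * (1 - r * (2 * x))) ^ k) ^ r)) with hLo
  have hLo0 : 0 ≤ Lo := by
    have hn' : (0 : ℝ) < n := by exact_mod_cast hn0
    have h1 : 0 ≤ (1 - (r + k : ℝ) / n) := by
      rw [sub_nonneg, div_le_one hn']; exact_mod_cast hrk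
    have h2 : 0 ≤ 1 - r * (2 * x) := by linarith
    have h3 : 0 ≤ 1 - n * (2 ^ r * π ^ 2) := by linarith
    positivity
  have hdis : ∀ s : {i // i ∈ R} → KeyRing P K,
      1 - ∑ i, ∑ j, (if i ≠ j ∧ 1 ≤ ((s i).1 ∩ (s j).1).card then (1 : ℝ) else 0) ≤
        if RingsDisjoint s then 1 else 0 := by
    intro s
    have h0 : ∀ i j, (0 : ℝ) ≤ if i ≠ j ∧ 1 ≤ ((s i).1 ∩ (s j).1).card then 1 else 0 :=
        fun i j => by split_ifs <;> norm_num
    split_ifs with hs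
    · have := sum_nonneg fun i (_ : i ∈ univ) => sum_nonneg fun j (_ : j ∈ univ) => h0 i j
      linarith
    · unfold RingsDisjoint at hs
      push Not at hs
      obtain ⟨i, j, hij, hne⟩ := hs
      have h1 := single_le_sum (fun j _ => h0 i j) (mem_univ j)
      rw [if_pos ⟨hij, card_pos.2 hne⟩] at h1
      have h2 := single_le_sum (f := fun i => ∑ j,
        if i ≠ j ∧ 1 ≤ ((s i).1 ∩ (s j).1).card then (1 : ℝ) else 0)
        (fun i _ => sum_nonneg fun j _ => h0 i j) (mem_univ i)
      linarith
  have hlow : ∀ s : {i // i ∈ R} → KeyRing P K, RingsDisjoint s →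
      Lo ≤ lowSum {w // w ∉ R} k (nbrWeight q (p : ℝ) s) := by
    intro s hs
    have hνm := sum_nbrWeight_mem (q := q) (p := (p : ℝ)) (s := s) h
    rw [← hπdef] at hνm
    rw [hLo, hy]
    exact poisLow_le_lowSum hcard (card_notMem hR) hn0 hrk
      (nbrWeight_nonneg (q := q) (s := s) hp0 hp1) (sum_nbrWeight h) hπ0 hνm (ϑ := 2 * x)
      (by positivity) (fun i j hij => by
        have := sum_nbrWeight_pair_le (s := s) h hq hK hp0 hp1 hτ hij (β := 0) (by
          rw [hs i j hij]; simp)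
        rwa [add_zero, ← hx, ← hπdef] at this) hϑ hπ hπ1 hsmall
  have hstep : ∀ s : {i // i ∈ R} → KeyRing P K,
      (1 - ∑ i, ∑ j, (if i ≠ j ∧ 1 ≤ ((s i).1 ∩ (s j).1).card then (1 : ℝ) else 0)) * Lo ≤
      (if RingsDisjoint s then 1 else 0) * lowSum {w // w ∉ R} k (nbrWeight q (p : ℝ) s) := by
    intro s
    refine (mul_le_mul_of_nonneg_right (hdis s) hLo0).trans ?_
    split_ifs with hs
    · simpa using hlow s hs
    · simp
  refine le_trans ?_ (sum_le_sum fun s _ => mul_le_mul_of_nonneg_left (hstep s) (by positivity))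
  have h1 := sum_sum_indicator_le (R := R) h hR 1
  rw [← hx, pow_one] at h1
  have h2 : ∑ s : {i // i ∈ R} → KeyRing P K, (((P.choose K : ℕ) : ℝ)⁻¹) ^ R.card *
      ((1 - ∑ i, ∑ j, (if i ≠ j ∧ 1 ≤ ((s i).1 ∩ (s j).1).card then (1 : ℝ) else 0)) * Lo) =
      (1 - ∑ s : {i // i ∈ R} → KeyRing P K, (((P.choose K : ℕ) : ℝ)⁻¹) ^ R.card *
      ∑ i, ∑ j, (if i ≠ j ∧ 1 ≤ ((s i).1 ∩ (s j).1).card then (1 : ℝ) else 0)) * Lo := by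
    rw [sum_congr rfl fun s _ => (by ring : (((P.choose K : ℕ) : ℝ)⁻¹) ^ R.card *
      ((1 - ∑ i, ∑ j, (if i ≠ j ∧ 1 ≤ ((s i).1 ∩ (s j).1).card then (1 : ℝ) else 0)) * Lo) =
      (((P.choose K : ℕ) : ℝ)⁻¹) ^ R.card * Lo - (((P.choose K : ℕ) : ℝ)⁻¹) ^ R.card *
      (∑ i, ∑ j, (if i ≠ j ∧ 1 ≤ ((s i).1 ∩ (s j).1).card then (1 : ℝ) else 0)) * Lo),
      sum_sub_distrib, ← sum_mul, ← sum_mul, hw]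
    ring
  rw [h2]
  calc _ = (1 - (r : ℝ) ^ 2 * x) * Lo := by rw [hLo]; ring
    _ ≤ _ := mul_le_mul_of_nonneg_right (by linarith) hLo0

end GraphBounds

/-! ### Uniform asymptotics for the event that r given nodes have low degree -/

section Asymptotics

open Finset

section SingleSize

variable {n K P q k r : ℕ} {p : unitInterval} {R : Finset (Fin n)}

/-- Here η = pπ, and n·pπ ≤ (1/l²)(2l) = 2/l, whatever the rings of `R` are. -/
lemma lowEvent_le_of_sparse (h : K ≤ P) (hk : 1 ≤ k) (hR : R.card = r) (hn : 0 < n) {l : ℝ}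
    (hl : 1 ≤ l) (hp : (p : ℝ) ≤ 1 / l ^ 2) (hy : n * ((p : ℝ) * shareProb q P K) ≤ 2 * l)
    (hπ : r * ((p : ℝ) * shareProb q P K) ≤ 1 / 2) (ha : 4 * (r : ℝ) ^ 2 / l < 1) :
    (graphLaw q n K P p).real (lowEvent k R) ≤
      poisLow k (n * (p * shareProb q P K)) ^ r *
        (Real.exp ((r : ℝ) ^ 2 * ((k + 1) * (2 * l / n) + 2 / l)) / (1 - 4 * (r : ℝ) ^ 2 / l)) := by
  have hp0 := p.2.1
  have hn' : (0 : ℝ) < n := by exact_mod_cast hn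
  have hσ0 := shareProb_nonneg q P K
  set π := (p : ℝ) * shareProb q P K with hπdef
  have hπ0 : 0 ≤ π := mul_nonneg hp0 hσ0
  have hl0 : 0 < l := by linarith
  have hnη : n * ((p : ℝ) * π) ≤ 2 / l := by
    calc n * ((p : ℝ) * π) = p * (n * π) := by ring
      _ ≤ 1 / l ^ 2 * (2 * l) := by gcongr
      _ = 2 / l := by field_simp
  have hnθ : n * (2 * (r : ℝ) ^ 2 * ((p : ℝ) * π)) ≤ 4 * (r : ℝ) ^ 2 / l := by
    calc n * (2 * (r : ℝ) ^ 2 * ((p : ℝ) * π)) = 2 * (r : ℝ) ^ 2 * (n * ((p : ℝ) * π)) := by ring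
      _ ≤ 2 * (r : ℝ) ^ 2 * (2 / l) := by gcongr
      _ = _ := by ring
  have key := one_sub_mul_lowEvent_le (q := q) (k := k) (p := p) h hR (η := p * π)
    (θ := 2 * (r : ℝ) ^ 2 * (p * π)) (by positivity)
    (fun s i j hij => by
      have := sum_nbrWeight_pair_le_mul (q := q) (s := s) (p := (p : ℝ)) h hij
      rwa [sq, mul_assoc] at this) (by positivity)
    (fun s => by
      have h3 := half_le_nbrWeight_empty h hR hπ s
      have h4 : 0 ≤ 2 * (r : ℝ) ^ 2 * (p * π) := by positivity
      have h5 := mul_le_mul_of_nonneg_left h3 h4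
      linarith) (by linarith)
  have hd : 0 < 1 - 4 * (r : ℝ) ^ 2 / l := by linarith
  rw [mul_div_assoc', le_div_iff₀ hd, mul_comm]
  refine (mul_le_mul_of_nonneg_right (by linarith) measureReal_nonneg).trans (key.trans ?_)
  have hpos := (poisLow_pos hk (by positivity : 0 ≤ n * π)).le
  have hπn : π ≤ 2 * l / n := by rw [le_div_iff₀ hn']; linarith
  rw [← hπdef]
  gcongr

lemma lowEvent_le_of_dense (h : K ≤ P) (hq : 1 ≤ q) (hK : 0 < K) (hk : 1 ≤ k) (hR : R.card = r)
    (hn : 0 < n) (hτ : shareMean q P K ≤ 2 * shareProb q P K) {l ξ x : ℝ}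
    (hl : l = Real.log n) (hl1 : 1 ≤ l)
    (hy : n * ((p : ℝ) * shareProb q P K) ≤ 2 * l)
    (hπ : r * ((p : ℝ) * shareProb q P K) ≤ 1 / 2)
    (hξ : ξ = Real.exp (-(l / (2 * q)))) (hx : x = (K : ℝ) ^ 2 / P) (hxξ : x ≤ ξ)
    (ha : 8 * (r : ℝ) ^ 2 * (ξ * l) < 1)
    (hKt : 2 * (q : ℝ) * (2 * r + 1) * (32 * q ^ 2 * (r + 1) ^ 2) ≤ K) :
    (graphLaw q n K P p).real (lowEvent k R) ≤
      poisLow k (n * (p * shareProb q P K)) ^ r *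
        (Real.exp ((r : ℝ) ^ 2 * ((k + 1) * (2 * l / n) + 4 * (ξ * l))) /
          (1 - 8 * (r : ℝ) ^ 2 * (ξ * l)) +
        (r : ℝ) ^ 2 * (16 * q * (r + 1)) ^ (r * k) *
          (Real.exp ((r : ℝ) ^ 2 * (2 * l / n + 4 * (ξ * l))) * Real.exp (-(l / (4 * q)))) +
        (r : ℝ) ^ 2 / n) := by
  have hp0 := p.2.1
  have hn' : (0 : ℝ) < n := by exact_mod_cast hn
  have hq' : (0 : ℝ) < q := by exact_mod_cast hq
  have hr0 : (0 : ℝ) ≤ r := Nat.cast_nonneg r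
  have hσ0 := shareProb_nonneg q P K
  set π := (p : ℝ) * shareProb q P K with hπdef
  have hπ0 : 0 ≤ π := mul_nonneg hp0 hσ0
  have hl0 : 0 < l := by linarith
  have hx0 : 0 ≤ x := by rw [hx]; positivity
  have hξ0 : 0 < ξ := hξ ▸ Real.exp_pos _
  have hξ1 : ξ ≤ 1 := by
    rw [hξ, Real.exp_le_one_iff]
    have : 0 ≤ l / (2 * q) := by positivity
    linarith
  have hy0 : 0 ≤ n * π := by positivity
  -- With y ≤ 2l, the choices of β and z make each of their contributions to the exponent at most
  -- l/(8q). Together they cost e^{l/(4q)}, and the factor ξ = e^{-l/(2q)} still leaves e^{-l/(4q)}.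
  set β : ℝ := 1 / (32 * q * (r + 1) ^ 2) with hβ
  set z : ℝ := 1 / (16 * q * (r + 1)) with hz
  -- This makes ξ^t = n^{-(2r+1)}, while the r-th power of `poisLow` is at least n^{-2r}; a factor
  -- 1/n remains.
  set t : ℕ := 2 * q * (2 * r + 1) with ht
  have hz0 : 0 < z := by positivity
  have hq1 : (1 : ℝ) ≤ q := by exact_mod_cast hq
  have hz1 : z ≤ 1 := by
    rw [hz, div_le_one (by positivity)]
    nlinarith
  have htβ : q * (t : ℝ) ≤ β * K := by
    rw [hβ, div_mul_eq_mul_div, le_div_iff₀ (by positivity), one_mul, ht]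
    refine le_trans (le_of_eq ?_) hKt
    push_cast; ring
  have hθ : 4 * (r : ℝ) ^ 2 * (x * (n * π)) ≤ 8 * (r : ℝ) ^ 2 * (ξ * l) := by
    calc _ ≤ 4 * (r : ℝ) ^ 2 * (ξ * (2 * l)) := by gcongr
      _ = _ := by ring
  have key := lowEvent_le_of_overlap (n := n) (p := p) (k := k) h hq hK hk hR hτ hπ hπdef hx
    rfl rfl (hθ.trans_lt ha) htβ hz0 hz1
  refine key.trans ?_
  have hpos := poisLow_pos hk hy0
  have hπn : π ≤ 2 * l / n := by rw [le_div_iff₀ hn']; linarith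
  have hxy : 2 * x * (n * π) ≤ 4 * (ξ * l) := by
    calc _ ≤ 2 * ξ * (2 * l) := by gcongr
      _ = _ := by ring
  have hU : Real.exp ((r : ℝ) ^ 2 * ((k + 1) * π + 2 * x * (n * π))) /
      (1 - 4 * (r : ℝ) ^ 2 * (x * (n * π))) ≤
      Real.exp ((r : ℝ) ^ 2 * ((k + 1) * (2 * l / n) + 4 * (ξ * l))) /
          (1 - 8 * (r : ℝ) ^ 2 * (ξ * l)) := by
    have : 0 < 1 - 8 * (r : ℝ) ^ 2 * (ξ * l) := by linarith
    gcongr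
  have hB : x * ((z⁻¹) ^ (r * k) * Real.exp ((r : ℝ) ^ 2 * (π + 2 * (x + β) * (n * π)) +
      z * r * (n * π))) ≤ (16 * q * (r + 1)) ^ (r * k) *
      (Real.exp ((r : ℝ) ^ 2 * (2 * l / n + 4 * (ξ * l))) * Real.exp (-(l / (4 * q)))) := by
    have hzi : z⁻¹ = 16 * q * (r + 1) := by rw [hz, one_div, inv_inv]
    have hex : (r : ℝ) ^ 2 * (π + 2 * (x + β) * (n * π)) + z * r * (n * π) ≤
        (r : ℝ) ^ 2 * (2 * l / n + 4 * (ξ * l)) + l / (4 * q) := by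
      have h1 : (r : ℝ) ^ 2 * (2 * β * (n * π)) ≤ l / (8 * q) := by
        calc _ ≤ ((r : ℝ) + 1) ^ 2 * (2 * β * (2 * l)) := by gcongr; linarith
          _ = l / (8 * q) := by rw [hβ]; field_simp; norm_num
      have h2 : z * r * (n * π) ≤ l / (8 * q) := by
        calc _ ≤ z * (r + 1) * (2 * l) := by gcongr; linarith
          _ = l / (8 * q) := by rw [hz]; field_simp; norm_num
      have h3 : (r : ℝ) ^ 2 * (π + 2 * x * (n * π)) ≤
          (r : ℝ) ^ 2 * (2 * l / n + 4 * (ξ * l)) := by gcongr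
      have h4 : l / (8 * q) + l / (8 * q) = l / (4 * q) := by field_simp; norm_num
      calc _ = (r : ℝ) ^ 2 * (π + 2 * x * (n * π)) + (r : ℝ) ^ 2 * (2 * β * (n * π)) +
            z * r * (n * π) := by ring
        _ ≤ _ := by linarith only [h1, h2, h3, h4]
    calc _ ≤ ξ * ((16 * q * (r + 1)) ^ (r * k) *
          Real.exp ((r : ℝ) ^ 2 * (2 * l / n + 4 * (ξ * l)) + l / (4 * q))) := by
          rw [hzi]; gcongr
      _ = (16 * q * (r + 1)) ^ (r * k) *
          (Real.exp ((r : ℝ) ^ 2 * (2 * l / n + 4 * (ξ * l))) * (ξ * Real.exp (l / (4 * q)))) := by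
          rw [Real.exp_add]; ring
      _ = _ := by
          rw [hξ, ← Real.exp_add]
          congr 3
          field_simp; norm_num
  have hT : x ^ t ≤ poisLow k (n * π) ^ r * (1 / n) := by
    have hexp : (n : ℝ) = Real.exp l := by rw [hl, Real.exp_log hn']
    have h1 : x ^ t ≤ Real.exp (-((2 * r + 1) * l)) := by
      refine (pow_le_pow_left₀ hx0 hxξ t).trans (le_of_eq ?_)
      rw [hξ, ← Real.exp_nat_mul, ht]
      congr 1
      push_cast
      field_simp
    have h2 : Real.exp (-(r * (2 * l))) ≤ poisLow k (n * π) ^ r := by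
      refine le_trans ?_ (pow_le_pow_left₀ (Real.exp_pos _).le (exp_neg_le_poisLow hk hy0) r)
      rw [← Real.exp_nat_mul]
      refine Real.exp_le_exp.2 ?_
      have := mul_le_mul_of_nonneg_left hy hr0
      linarith only [this]
    refine h1.trans ?_
    calc _ = Real.exp (-(r * (2 * l))) * (1 / n) := by
          rw [hexp, one_div, ← Real.exp_neg, ← Real.exp_add]; congr 1; ring
      _ ≤ _ := by gcongr
  calc _ ≤ poisLow k (n * π) ^ r * (Real.exp ((r : ℝ) ^ 2 * ((k + 1) * (2 * l / n) + 4 * (ξ * l))) /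
          (1 - 8 * (r : ℝ) ^ 2 * (ξ * l)) + (r : ℝ) ^ 2 * ((16 * q * (r + 1)) ^ (r * k) *
      (Real.exp ((r : ℝ) ^ 2 * (2 * l / n + 4 * (ξ * l))) * Real.exp (-(l / (4 * q)))))) +
      (r : ℝ) ^ 2 * (poisLow k (n * π) ^ r * (1 / n)) := by gcongr
    _ = _ := by ring

end SingleSize

lemma tendsto_log_natCast : Tendsto (fun n : ℕ => Real.log n) atTop atTop :=
  Real.tendsto_log_atTop.comp tendsto_natCast_atTop_atTop

lemma tendsto_log_pow_div (j : ℕ) :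
    Tendsto (fun n : ℕ => Real.log n ^ j / n) atTop (𝓝 0) :=
  ((Real.isLittleO_pow_log_id_atTop (n := j)).tendsto_div_nhds_zero).comp
    tendsto_natCast_atTop_atTop

lemma tendsto_log_mul_exp_neg {q : ℕ} (hq : 1 ≤ q) :
    Tendsto (fun n : ℕ => Real.exp (-(Real.log n / (2 * q))) * Real.log n) atTop (𝓝 0) := by
  have hq' : (0 : ℝ) < q := by exact_mod_cast hq
  have h1 : Tendsto (fun n : ℕ => Real.log n / (2 * q)) atTop atTop :=
    tendsto_log_natCast.atTop_div_const (by positivity)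
  have h2 := ((Real.tendsto_pow_mul_exp_neg_atTop_nhds_zero 1).comp h1).const_mul (2 * (q : ℝ))
  rw [mul_zero] at h2
  refine h2.congr fun n => ?_
  simp only [Function.comp_apply, pow_one]
  field_simp

section Sequences

variable {q k : ℕ} {K P : ℕ → ℕ} {p : ℕ → unitInterval}

lemma eventually_shareMean_le (hq : 1 ≤ q) (hKP : ∀ n, K n ≤ P n)
    (hKP2 : Tendsto (fun n => (K n : ℝ) ^ 2 / (P n : ℝ)) atTop (𝓝 0)) :
    ∀ᶠ n in atTop, shareMean q (P n) (K n) ≤ 2 * shareProb q (P n) (K n) := by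
  have hq' : (0 : ℝ) < q := by exact_mod_cast hq
  filter_upwards [hKP2.eventually_le_const (show (0 : ℝ) < 1 / (2 * q) by positivity)] with n hn
  have h1 := le_shareProb (hKP n) hq
  have h2 : (q : ℝ) * ((K n : ℝ) ^ 2 / P n) ≤ 1 / 2 := by
    calc _ ≤ (q : ℝ) * (1 / (2 * q)) := by gcongr
      _ = 1 / 2 := by field_simp
  nlinarith [shareMean_nonneg q (P n) (K n)]

/-- When p > 1/l², the bound nπ ≤ 2l forces the sharing probability below 2l³/n. By
`pow_le_shareMean`, x^q = O(l³/n), so x^{2q} = O(l⁶/n²) is eventually at most 1/n. -/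
lemma eventually_sq_div_le_exp (hq : 1 ≤ q) (hKP : ∀ n, K n ≤ P n)
    (hK : Tendsto K atTop atTop)
    (hKP2 : Tendsto (fun n => (K n : ℝ) ^ 2 / (P n : ℝ)) atTop (𝓝 0))
    (hy : ∀ᶠ n : ℕ in atTop, n * ((p n : ℝ) * shareProb q (P n) (K n)) ≤ 2 * Real.log n) :
    ∀ᶠ n : ℕ in atTop, 1 / Real.log n ^ 2 < (p n : ℝ) →
      (K n : ℝ) ^ 2 / P n ≤ Real.exp (-(Real.log n / (2 * q))) := by
  set C : ℝ := 2 * 4 ^ q * q.factorial with hC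
  have hC0 : 0 < C := by positivity
  have hq' : (0 : ℝ) < q := by exact_mod_cast hq
  have hlim := (tendsto_log_pow_div 6).const_mul (4 * C ^ 2)
  rw [mul_zero] at hlim
  filter_upwards [hy, eventually_shareMean_le hq hKP hKP2, hK.eventually_ge_atTop (2 * q),
    hlim.eventually_le_const one_pos, eventually_gt_atTop 0,
    tendsto_log_natCast.eventually_ge_atTop 1] with n hy hτ hKn hsm hn0 hl hp
  have hn' : (0 : ℝ) < n := by exact_mod_cast hn0
  set l := Real.log n with hldef
  have hl0 : 0 < l := by linarith
  have hσ0 := shareProb_nonneg q (P n) (K n)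
  set σ := shareProb q (P n) (K n)
  have hσ : σ ≤ 2 * l ^ 3 / n := by
    rw [le_div_iff₀ hn']
    have h1 : 1 / l ^ 2 * (σ * n) ≤ 2 * l := by
      refine le_trans ?_ hy
      rw [show n * ((p n : ℝ) * σ) = p n * (σ * n) by ring]
      gcongr
    rw [div_mul_eq_mul_div, one_mul, div_le_iff₀ (by positivity)] at h1
    calc σ * n ≤ 2 * l * l ^ 2 := h1
      _ = _ := by ring
  set x := (K n : ℝ) ^ 2 / P n with hx
  have hx0 : 0 ≤ x := by positivity
  have hxq : x ^ q ≤ C * (2 * l ^ 3 / n) := by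
    calc x ^ q ≤ 4 ^ q * q.factorial * shareMean q (P n) (K n) :=
          pow_le_shareMean (hKP n) (by have := hKP n; omega) hKn
      _ ≤ 4 ^ q * q.factorial * (2 * (2 * l ^ 3 / n)) := by
          gcongr
          exact hτ.trans (by gcongr)
      _ = _ := by rw [hC]; ring
  have h2q : x ^ (2 * q) ≤ 1 / n := by
    calc x ^ (2 * q) = (x ^ q) ^ 2 := by rw [mul_comm, pow_mul]
      _ ≤ (C * (2 * l ^ 3 / n)) ^ 2 := by gcongr
      _ = (4 * C ^ 2 * (l ^ 6 / n)) * (1 / n) := by field_simp; norm_num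
      _ ≤ 1 * (1 / n) := by gcongr
      _ = 1 / n := one_mul _
  have hξ : Real.exp (-(l / (2 * q))) ^ (2 * q) = 1 / n := by
    have : (1 : ℝ) / n = Real.exp (-l) := by rw [Real.exp_neg, hldef, Real.exp_log hn', one_div]
    rw [this, ← Real.exp_nat_mul]
    congr 1
    push_cast
    field_simp
  rw [← hξ] at h2q
  exact le_of_pow_le_pow_left₀ (by omega) (Real.exp_pos _).le h2q

lemma tendsto_linkProb
    (hy : ∀ᶠ n : ℕ in atTop, n * ((p n : ℝ) * shareProb q (P n) (K n)) ≤ 2 * Real.log n) :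
    Tendsto (fun n => (p n : ℝ) * shareProb q (P n) (K n)) atTop (𝓝 0) := by
  have h := (tendsto_log_pow_div 1).const_mul 2
  rw [mul_zero] at h
  refine squeeze_zero' (.of_forall fun n => mul_nonneg (p n).2.1 (shareProb_nonneg _ _ _)) ?_ h
  filter_upwards [hy, eventually_gt_atTop 0] with n hy hn
  have hn' : (0 : ℝ) < n := by exact_mod_cast hn
  rw [pow_one, mul_div_assoc', le_div_iff₀ hn', mul_comm]
  exact hy

theorem eventually_lowEvent_le (hq : 1 ≤ q) (hk : 1 ≤ k) (hKP : ∀ n, K n ≤ P n)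
    (hK : Tendsto K atTop atTop)
    (hKP2 : Tendsto (fun n => (K n : ℝ) ^ 2 / (P n : ℝ)) atTop (𝓝 0))
    (hy : ∀ᶠ n : ℕ in atTop, n * ((p n : ℝ) * shareProb q (P n) (K n)) ≤ 2 * Real.log n)
    (r : ℕ) {ε : ℝ} (hε : 0 < ε) :
    ∀ᶠ n : ℕ in atTop, ∀ R : Finset (Fin n), R.card = r →
      (graphLaw q n (K n) (P n) (p n)).real (lowEvent k R) ≤
        (1 + ε) * poisLow k (n * (p n * shareProb q (P n) (K n))) ^ r := by
  have hq' : (0 : ℝ) < q := by exact_mod_cast hq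
  have hlog := tendsto_log_natCast
  have hinv : Tendsto (fun n : ℕ => (Real.log n)⁻¹) atTop (𝓝 0) := hlog.inv_tendsto_atTop
  have hln : Tendsto (fun n : ℕ => Real.log n / n) atTop (𝓝 0) := by
    simpa using tendsto_log_pow_div 1
  have hξl := tendsto_log_mul_exp_neg hq
  have hn1 : Tendsto (fun n : ℕ => ((n : ℝ))⁻¹) atTop (𝓝 0) :=
    tendsto_natCast_atTop_atTop.inv_tendsto_atTop
  have hexp4 : Tendsto (fun n : ℕ => Real.exp (-(Real.log n / (4 * q)))) atTop (𝓝 0) :=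
    Real.tendsto_exp_neg_atTop_nhds_zero.comp (hlog.atTop_div_const (by positivity))
  have hrπ : Tendsto (fun n => (r : ℝ) * ((p n : ℝ) * shareProb q (P n) (K n))) atTop (𝓝 0) := by
    simpa using (tendsto_linkProb hy).const_mul (r : ℝ)
  have ha1 : Tendsto (fun n : ℕ => 4 * (r : ℝ) ^ 2 / Real.log n) atTop (𝓝 0) := by
    simpa [div_eq_mul_inv] using hinv.const_mul (4 * (r : ℝ) ^ 2)
  have ha2 : Tendsto (fun n : ℕ => 8 * (r : ℝ) ^ 2 *
      (Real.exp (-(Real.log n / (2 * q))) * Real.log n)) atTop (𝓝 0) := by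
    simpa using hξl.const_mul (8 * (r : ℝ) ^ 2)
  have hb1 : Tendsto (fun n : ℕ => (r : ℝ) ^ 2 * ((k + 1) * (2 * Real.log n / n) +
      2 / Real.log n)) atTop (𝓝 0) := by
    have := (((hln.const_mul 2).const_mul ((k : ℝ) + 1)).add (hinv.const_mul 2)).const_mul
      ((r : ℝ) ^ 2)
    simpa [div_eq_mul_inv, mul_assoc] using this
  have hb2 : Tendsto (fun n : ℕ => (r : ℝ) ^ 2 * ((k + 1) * (2 * Real.log n / n) +
      4 * (Real.exp (-(Real.log n / (2 * q))) * Real.log n))) atTop (𝓝 0) := by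
    have := (((hln.const_mul 2).const_mul ((k : ℝ) + 1)).add (hξl.const_mul 4)).const_mul
      ((r : ℝ) ^ 2)
    simpa [div_eq_mul_inv, mul_assoc] using this
  have hb3 : Tendsto (fun n : ℕ => (r : ℝ) ^ 2 * (2 * Real.log n / n +
      4 * (Real.exp (-(Real.log n / (2 * q))) * Real.log n))) atTop (𝓝 0) := by
    have := ((hln.const_mul 2).add (hξl.const_mul 4)).const_mul ((r : ℝ) ^ 2)
    simpa [div_eq_mul_inv, mul_assoc] using this
  have hF1 : Tendsto (fun n : ℕ => Real.exp ((r : ℝ) ^ 2 * ((k + 1) * (2 * Real.log n / n) +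
      2 / Real.log n)) / (1 - 4 * (r : ℝ) ^ 2 / Real.log n)) atTop (𝓝 1) := by
    have := ((Real.continuous_exp.tendsto 0).comp hb1).div
      ((tendsto_const_nhds (x := (1 : ℝ))).sub ha1) (by norm_num)
    have he : Real.exp 0 / (1 - 0) = 1 := by simp
    rw [he] at this
    exact this
  have hF2 : Tendsto (fun n : ℕ => Real.exp ((r : ℝ) ^ 2 * ((k + 1) * (2 * Real.log n / n) +
        4 * (Real.exp (-(Real.log n / (2 * q))) * Real.log n))) /
          (1 - 8 * (r : ℝ) ^ 2 * (Real.exp (-(Real.log n / (2 * q))) * Real.log n)) +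
        (r : ℝ) ^ 2 * (16 * q * (r + 1)) ^ (r * k) *
          (Real.exp ((r : ℝ) ^ 2 * (2 * Real.log n / n +
            4 * (Real.exp (-(Real.log n / (2 * q))) * Real.log n))) *
            Real.exp (-(Real.log n / (4 * q)))) +
        (r : ℝ) ^ 2 / n) atTop (𝓝 1) := by
    have h1 := ((Real.continuous_exp.tendsto 0).comp hb2).div
      ((tendsto_const_nhds (x := (1 : ℝ))).sub ha2) (by norm_num)
    have h2 := (((Real.continuous_exp.tendsto 0).comp hb3).mul hexp4).const_mul
      ((r : ℝ) ^ 2 * (16 * q * (r + 1)) ^ (r * k))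
    have h3 := hn1.const_mul ((r : ℝ) ^ 2)
    have h4 := (h1.add h2).add h3
    have he : Real.exp 0 / (1 - 0) + (r : ℝ) ^ 2 * (16 * q * (r + 1)) ^ (r * k) *
        (Real.exp 0 * 0) + (r : ℝ) ^ 2 * 0 = 1 := by simp
    rw [he] at h4
    exact h4
  have hKR : Tendsto (fun n => (K n : ℝ)) atTop atTop := tendsto_natCast_atTop_atTop.comp hK
  filter_upwards [hy, eventually_shareMean_le hq hKP hKP2,
    eventually_sq_div_le_exp hq hKP hK hKP2 hy, hK.eventually_ge_atTop 1,
    eventually_gt_atTop 0, hlog.eventually_ge_atTop 1,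
    hrπ.eventually_le_const (show (0 : ℝ) < 1 / 2 by norm_num),
    ha1.eventually_lt_const one_pos, ha2.eventually_lt_const one_pos,
    hF1.eventually_le_const (show (1 : ℝ) < 1 + ε by linarith),
    hF2.eventually_le_const (show (1 : ℝ) < 1 + ε by linarith),
    hKR.eventually_ge_atTop (2 * (q : ℝ) * (2 * r + 1) * (32 * q ^ 2 * (r + 1) ^ 2))]
    with n hy hτ hx hK1 hn hl hπ ha1 ha2 hF1 hF2 hKt R hR
  have hpos : 0 ≤ poisLow k (n * (p n * shareProb q (P n) (K n))) ^ r :=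
    pow_nonneg (poisLow_pos hk (mul_nonneg (Nat.cast_nonneg _)
      (mul_nonneg (p n).2.1 (shareProb_nonneg _ _ _)))).le _
  rw [mul_comm]
  rcases le_or_gt (p n : ℝ) (1 / Real.log n ^ 2) with hp | hp
  · exact (lowEvent_le_of_sparse (hKP n) hk hR hn hl hp hy hπ ha1).trans
      (mul_le_mul_of_nonneg_left hF1 hpos)
  · exact (lowEvent_le_of_dense (hKP n) hq hK1 hk hR hn hτ rfl hl hy hπ rfl rfl (hx hp) ha2
      hKt).trans (mul_le_mul_of_nonneg_left hF2 hpos)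

/-- No case distinction on p is needed: the correction factor tends to 1 as soon as x, π and nπ²
tend to 0, and nπ² ≤ 4l²/n. -/
theorem eventually_le_lowEvent (hq : 1 ≤ q) (hk : 1 ≤ k) (hKP : ∀ n, K n ≤ P n)
    (hK : Tendsto K atTop atTop)
    (hKP2 : Tendsto (fun n => (K n : ℝ) ^ 2 / (P n : ℝ)) atTop (𝓝 0))
    (hy : ∀ᶠ n : ℕ in atTop, n * ((p n : ℝ) * shareProb q (P n) (K n)) ≤ 2 * Real.log n)
    (r : ℕ) {ε : ℝ} (hε : 0 < ε) :
    ∀ᶠ n : ℕ in atTop, ∀ R : Finset (Fin n), R.card = r →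
      (1 - ε) * poisLow k (n * (p n * shareProb q (P n) (K n))) ^ r ≤
        (graphLaw q n (K n) (P n) (p n)).real (lowEvent k R) := by
  have hπ0 := tendsto_linkProb hy
  have hrπ : Tendsto (fun n => (r : ℝ) * ((p n : ℝ) * shareProb q (P n) (K n))) atTop (𝓝 0) := by
    simpa using hπ0.const_mul (r : ℝ)
  have hsq : Tendsto (fun n : ℕ => (n : ℝ) * ((p n : ℝ) * shareProb q (P n) (K n)) ^ 2)
      atTop (𝓝 0) := by
    have h := (tendsto_log_pow_div 2).const_mul 4
    rw [mul_zero] at h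
    refine squeeze_zero' (.of_forall fun n => by positivity) ?_ h
    filter_upwards [hy, eventually_gt_atTop 0] with n hy hn
    have hn' : (0 : ℝ) < n := by exact_mod_cast hn
    have h0 : 0 ≤ n * ((p n : ℝ) * shareProb q (P n) (K n)) :=
      mul_nonneg (Nat.cast_nonneg _) (mul_nonneg (p n).2.1 (shareProb_nonneg _ _ _))
    rw [mul_div_assoc', le_div_iff₀ hn']
    calc _ = (n * ((p n : ℝ) * shareProb q (P n) (K n))) ^ 2 := by ring
      _ ≤ (2 * Real.log n) ^ 2 := by gcongr
      _ = _ := by ring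
  have h2sq : Tendsto (fun n : ℕ => (n : ℝ) * (2 ^ r * ((p n : ℝ) * shareProb q (P n) (K n)) ^ 2))
      atTop (𝓝 0) := by
    have := hsq.const_mul (2 ^ r)
    rw [mul_zero] at this
    exact this.congr fun n => by ring
  have h3sq : Tendsto (fun n : ℕ => (n : ℝ) *
      (2 * (r * ((p n : ℝ) * shareProb q (P n) (K n))) ^ 2)) atTop (𝓝 0) := by
    have := hsq.const_mul (2 * (r : ℝ) ^ 2)
    rw [mul_zero] at this
    exact this.congr fun n => by ring
  have hrx : Tendsto (fun n => (r : ℝ) * (2 * ((K n : ℝ) ^ 2 / P n))) atTop (𝓝 0) := by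
    simpa using (hKP2.const_mul 2).const_mul (r : ℝ)
  have hr2x : Tendsto (fun n => (r : ℝ) ^ 2 * ((K n : ℝ) ^ 2 / P n)) atTop (𝓝 0) := by
    simpa using hKP2.const_mul ((r : ℝ) ^ 2)
  have hrkn : Tendsto (fun n : ℕ => (r + k : ℝ) / n) atTop (𝓝 0) :=
    tendsto_const_div_atTop_nhds_zero_nat _
  have hone := tendsto_const_nhds (x := (1 : ℝ)) (f := (atTop : Filter ℕ))
  have hF : Tendsto (fun n : ℕ => (1 - (r : ℝ) ^ 2 * ((K n : ℝ) ^ 2 / P n)) *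
      (Real.exp (-(n * (2 * (r * ((p n : ℝ) * shareProb q (P n) (K n))) ^ 2))) *
      ((1 - n * (2 ^ r * ((p n : ℝ) * shareProb q (P n) (K n)) ^ 2)) *
        (((1 - (r + k : ℝ) / n) * (1 - r * (2 * ((K n : ℝ) ^ 2 / P n)))) ^ k) ^ r)))
      atTop (𝓝 1) := by
    have h := (hone.sub hr2x).mul (((Real.continuous_exp.tendsto _).comp h3sq.neg).mul
      ((hone.sub h2sq).mul ((((hone.sub hrkn).mul (hone.sub hrx)).pow k).pow r)))
    simpa using h
  filter_upwards [eventually_shareMean_le hq hKP hKP2, hK.eventually_ge_atTop 1,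
    eventually_ge_atTop (r + k + 1), hrπ.eventually_le_const (show (0 : ℝ) < 1 / 2 by norm_num),
    hrx.eventually_le_const one_pos, h2sq.eventually_le_const one_pos,
    hF.eventually_const_le (show 1 - ε < (1 : ℝ) by linarith)]
    with n hτ hK1 hn hπ hx h2 hF R hR
  have hpos : 0 ≤ poisLow k (n * (p n * shareProb q (P n) (K n))) ^ r :=
    pow_nonneg (poisLow_pos hk (mul_nonneg (Nat.cast_nonneg _)
      (mul_nonneg (p n).2.1 (shareProb_nonneg _ _ _)))).le _
  rw [mul_comm]
  exact (mul_le_mul_of_nonneg_left hF hpos).trans (le_lowEvent (hKP n) hq hK1 hk hR hτ (by omega)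
    (by omega) rfl rfl rfl hπ hx h2)

end Sequences

end Asymptotics

/-! ### First moment, Chebyshev and Bonferroni inequalities -/

section Moments

open Finset

open scoped Classical in
/-- The nodes of degree less than `k`. -/
def lowNodes {n : ℕ} (k : ℕ) (G : SimpleGraph (Fin n)) : Finset (Fin n) :=
  univ.filter fun i => nodeDeg G i < k

/-- The `j`-th binomial moment of the number of nodes of degree less than `k`. -/
def lowMoment {n : ℕ} (μ : Measure (SimpleGraph (Fin n))) (k j : ℕ) : ℝ :=
  ∑ R ∈ powersetCard j univ, μ.real (lowEvent k R)

variable {n : ℕ} (μ : Measure (SimpleGraph (Fin n))) [IsProbabilityMeasure μ]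

open scoped Classical in
lemma measureReal_eq_sum_singleton (E : Set (SimpleGraph (Fin n))) :
    μ.real E = ∑ G, μ.real {G} * if G ∈ E then 1 else 0 := by
  have := measurableSingletonClass_simpleGraph n
  have h : E = ((univ.filter fun G => G ∈ E : Finset (SimpleGraph (Fin n))) : Set _) := by
    ext; simp
  conv_lhs => rw [h]
  rw [← sum_measureReal_singleton, sum_filter]
  exact sum_congr rfl fun G _ => by split_ifs <;> simp

lemma sum_measureReal_singleton_univ : ∑ G, μ.real {G} = 1 := by
  have := measureReal_eq_sum_singleton μ Set.univ
  simpa using this.symm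

lemma lowMoment_eq (k j : ℕ) :
    lowMoment μ k j = ∑ G, μ.real {G} * ((lowNodes k G).card.choose j : ℝ) := by
  classical
  unfold lowMoment
  rw [sum_congr rfl fun R _ => measureReal_eq_sum_singleton μ _, sum_comm]
  refine sum_congr rfl fun G _ => ?_
  rw [← mul_sum, sum_boole, ← card_powersetCard]
  congr 3
  ext R
  rw [mem_filter]
  simp only [lowEvent, lowNodes, Set.mem_ofPred_eq, mem_filter, mem_powersetCard, mem_univ,
    true_and, subset_iff]
  tauto

lemma measureReal_le_minDeg (hn : 0 < n) (k : ℕ) :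
    μ.real {G | k ≤ minDeg G} =
      ∑ G, μ.real {G} * if (lowNodes k G).card = 0 then (1 : ℝ) else 0 := by
  rw [measureReal_eq_sum_singleton]
  refine sum_congr rfl fun G _ => ?_
  have hiff : G ∈ {G : SimpleGraph (Fin n) | k ≤ minDeg G} ↔ (lowNodes k G).card = 0 := by
    simp [le_minDeg_iff hn, lowNodes, filter_eq_empty_iff]
  by_cases h : (lowNodes k G).card = 0
  · rw [if_pos h, if_pos (hiff.2 h)]
  · rw [if_neg h, if_neg (mt hiff.1 h)]

lemma one_sub_lowMoment_le (hn : 0 < n) (k : ℕ) :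
    1 - lowMoment μ k 1 ≤ μ.real {G | k ≤ minDeg G} := by
  rw [measureReal_le_minDeg μ hn, lowMoment_eq]
  refine le_trans (le_of_eq (congrArg (· - _) (sum_measureReal_singleton_univ μ).symm)) ?_
  rw [← sum_sub_distrib]
  refine sum_le_sum fun G _ => ?_
  rw [Nat.choose_one_right]
  have h0 : 0 ≤ μ.real {G} := measureReal_nonneg
  split_ifs with h
  · simp [h]
  · have : (1 : ℝ) ≤ (lowNodes k G).card := by exact_mod_cast Nat.one_le_iff_ne_zero.2 h
    nlinarith

/-- Chebyshev's inequality: (N - M)² equals M² where N = 0, and the right-hand side is the variance,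
since N² = N + 2 C(N,2). -/
lemma measureReal_mul_sq_lowMoment_le (hn : 0 < n) (k : ℕ) :
    μ.real {G | k ≤ minDeg G} * lowMoment μ k 1 ^ 2 ≤
      lowMoment μ k 1 + 2 * lowMoment μ k 2 - lowMoment μ k 1 ^ 2 := by
  set M := lowMoment μ k 1 with hM
  have h1 : ∑ G, μ.real {G} * (((lowNodes k G).card : ℝ) - M) ^ 2 =
      M + 2 * lowMoment μ k 2 - M ^ 2 := by
    have h2 : ∀ G : SimpleGraph (Fin n), μ.real {G} * (((lowNodes k G).card : ℝ) - M) ^ 2 =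
        μ.real {G} * ((lowNodes k G).card.choose 1 : ℝ) * (1 - 2 * M) +
        2 * (μ.real {G} * ((lowNodes k G).card.choose 2 : ℝ)) + M ^ 2 * μ.real {G} := by
      intro G
      rw [Nat.cast_choose_two, Nat.choose_one_right]; ring
    rw [sum_congr rfl fun G _ => h2 G, sum_add_distrib, sum_add_distrib, ← sum_mul, ← mul_sum,
      ← mul_sum, ← lowMoment_eq, ← lowMoment_eq, sum_measureReal_singleton_univ, ← hM]
    ring
  rw [← h1, measureReal_le_minDeg μ hn, sum_mul]
  refine sum_le_sum fun G _ => ?_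
  rw [mul_assoc]
  refine mul_le_mul_of_nonneg_left ?_ measureReal_nonneg
  split_ifs with h
  · simp [h]
  · rw [zero_mul]; positivity

/-- For N ≥ 1 the truncated alternating sum equals (-1)^J C(N-1,J); for N = 0 it equals 1 and there
is no error. -/
lemma abs_ite_sub_alternating_sum_choose_le (N J : ℕ) :
    |(if N = 0 then (1 : ℝ) else 0) - ∑ j ∈ range (J + 1), (-1 : ℝ) ^ j * (N.choose j : ℝ)| ≤
      (N.choose (J + 1) + if N = 0 then 0 else (N.choose J : ℝ)) := by
  rcases N with _ | N
  · simp [sum_range_succ']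
  · have h := Int.alternating_sum_range_choose_eq_choose (n := N) (m := J)
    have h' : ∑ j ∈ range (J + 1), (-1 : ℝ) ^ j * ((N + 1).choose j : ℝ) =
        (-1) ^ J * (N.choose J : ℝ) := by exact_mod_cast h
    rw [h']
    simp only [Nat.add_eq_zero_iff, one_ne_zero, and_false, if_false, zero_sub, abs_neg, abs_mul,
      abs_pow, abs_one, one_pow, one_mul, Nat.abs_cast]
    have : N.choose J ≤ (N + 1).choose J := Nat.choose_le_choose J (by omega)
    have : (N.choose J : ℝ) ≤ ((N + 1).choose J : ℝ) := by exact_mod_cast this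
    have : (0 : ℝ) ≤ ((N + 1).choose (J + 1) : ℝ) := by positivity
    linarith

/-- Bonferroni's inequalities for the number of nodes of degree less than `k`. -/
lemma abs_measureReal_sub_alternating_sum_le (hn : 0 < n) (k J : ℕ) :
    |μ.real {G | k ≤ minDeg G} - ∑ j ∈ range (J + 1), (-1 : ℝ) ^ j * lowMoment μ k j| ≤
      lowMoment μ k (J + 1) + lowMoment μ k J := by
  have h1 : ∑ j ∈ range (J + 1), (-1 : ℝ) ^ j * lowMoment μ k j =
      ∑ G, μ.real {G} * ∑ j ∈ range (J + 1), (-1 : ℝ) ^ j * ((lowNodes k G).card.choose j : ℝ) := by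
    simp only [lowMoment_eq, mul_sum]
    rw [sum_comm]
    exact sum_congr rfl fun G _ => sum_congr rfl fun j _ => by ring
  rw [h1, measureReal_le_minDeg μ hn, ← sum_sub_distrib, lowMoment_eq, lowMoment_eq,
    ← sum_add_distrib]
  refine (abs_sum_le_sum_abs _ _).trans (sum_le_sum fun G _ => ?_)
  have h0 : 0 ≤ μ.real {G} := measureReal_nonneg
  rw [← mul_sub, abs_mul, abs_of_nonneg h0, ← mul_add]
  refine mul_le_mul_of_nonneg_left
    ((abs_ite_sub_alternating_sum_choose_le _ J).trans ?_) h0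
  gcongr
  split_ifs
  · positivity
  · exact le_rfl

end Moments

/-! ### Asymptotics of the binomial moments -/

section MomentLimits

open Finset

variable {q k : ℕ} {K P : ℕ → ℕ} {p : ℕ → unitInterval}

lemma tendsto_choose_div_pow (j : ℕ) :
    Tendsto (fun n : ℕ => (n.choose j : ℝ) / (n : ℝ) ^ j) atTop (𝓝 (1 / (j.factorial : ℝ))) := by
  have h1 := isEquivalent_choose j
  have hf : (j.factorial : ℝ) ≠ 0 := by exact_mod_cast j.factorial_ne_zero
  have h2 := (Asymptotics.isEquivalent_iff_tendsto_one (by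
    filter_upwards [eventually_gt_atTop 0] with n hn
    have : (n : ℝ) ≠ 0 := by exact_mod_cast hn.ne'
    positivity)).1 h1
  have h3 := h2.mul_const (1 / (j.factorial : ℝ))
  rw [one_mul] at h3
  refine h3.congr fun n => ?_
  simp only [Pi.div_apply]
  field_simp

/-- The moment is a sum of C(n,j) terms, each within a factor 1 ± ε/2 of `poisLow` to the power j by
the uniform estimates, and C(n,j) is asymptotic to n^j/j!. -/
lemma tendsto_lowMoment_div (hq : 1 ≤ q) (hk : 1 ≤ k) (hKP : ∀ n, K n ≤ P n)
    (hK : Tendsto K atTop atTop)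
    (hKP2 : Tendsto (fun n => (K n : ℝ) ^ 2 / (P n : ℝ)) atTop (𝓝 0))
    (hy : ∀ᶠ n : ℕ in atTop, n * ((p n : ℝ) * shareProb q (P n) (K n)) ≤ 2 * Real.log n)
    (j : ℕ) :
    Tendsto (fun n : ℕ => lowMoment (graphLaw q n (K n) (P n) (p n)) k j /
      (n * poisLow k (n * (p n * shareProb q (P n) (K n)))) ^ j) atTop
      (𝓝 (1 / (j.factorial : ℝ))) := by
  have hpos : ∀ n : ℕ, 0 < poisLow k (n * (p n * shareProb q (P n) (K n))) := fun n =>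
    poisLow_pos hk (mul_nonneg (Nat.cast_nonneg _) (mul_nonneg (p n).2.1 (shareProb_nonneg _ _ _)))
  have hratio : Tendsto (fun n : ℕ => lowMoment (graphLaw q n (K n) (P n) (p n)) k j /
      (n.choose j * poisLow k (n * (p n * shareProb q (P n) (K n))) ^ j)) atTop (𝓝 1) := by
    rw [Metric.tendsto_nhds]
    intro ε hε
    filter_upwards [eventually_lowEvent_le hq hk hKP hK hKP2 hy j (half_pos hε),
      eventually_le_lowEvent hq hk hKP hK hKP2 hy j (half_pos hε), eventually_ge_atTop j]
      with n hU hL hn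
    have hC : (0 : ℝ) < n.choose j := by exact_mod_cast Nat.choose_pos hn
    have hD : 0 < (n.choose j : ℝ) * poisLow k (n * (p n * shareProb q (P n) (K n))) ^ j :=
      mul_pos hC (pow_pos (hpos n) j)
    have hcard : ((powersetCard j (univ : Finset (Fin n))).card : ℝ) = n.choose j := by
      rw [card_powersetCard, card_univ, Fintype.card_fin]
    have h1 := sum_le_card_nsmul (powersetCard j (univ : Finset (Fin n))) _ _
      fun R hR => hU R (mem_powersetCard.1 hR).2
    have h2 := card_nsmul_le_sum (powersetCard j (univ : Finset (Fin n))) _ _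
      fun R hR => hL R (mem_powersetCard.1 hR).2
    rw [nsmul_eq_mul, hcard] at h1 h2
    rw [Real.dist_eq, abs_lt, lt_sub_iff_add_lt, sub_lt_iff_lt_add, lt_div_iff₀ hD, div_lt_iff₀ hD]
    unfold lowMoment
    constructor <;> nlinarith [mul_pos hε hD]
  have h := hratio.mul (tendsto_choose_div_pow j)
  rw [one_mul] at h
  refine h.congr' ?_
  filter_upwards [eventually_ge_atTop j, eventually_gt_atTop 0] with n hn hn0
  have hC : (n.choose j : ℝ) ≠ 0 := by exact_mod_cast (Nat.choose_pos hn).ne'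
  have hn' : (n : ℝ) ≠ 0 := by exact_mod_cast hn0.ne'
  have := (hpos n).ne'
  rw [mul_pow]
  field_simp

end MomentLimits

/-! ### The expected number of low-degree nodes at the threshold -/

section PoissonLimit

open Finset

variable {k : ℕ} {α y : ℕ → ℝ}

/-- By the scaling, n e^{-y} = e^{-a} l^{-(k-1)}. Distributing the powers of l over the sum shows
that only d = k - 1 survives when y/l → 1. -/
lemma mul_poisLow_eq (hk : 1 ≤ k) {n : ℕ} {a y : ℝ} (hn : 0 < n) (hl : 0 < Real.log n)
    (hy : y = Real.log n + ((k : ℝ) - 1) * Real.log (Real.log n) + a) :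
    n * poisLow k y = Real.exp (-a) * ∑ d ∈ range k,
      (y / Real.log n) ^ d * (Real.log n)⁻¹ ^ (k - 1 - d) / (d.factorial : ℝ) := by
  have hn' : (0 : ℝ) < n := by exact_mod_cast hn
  set l := Real.log n with hldef
  have h1 : n * Real.exp (-y) = Real.exp (-a) * l⁻¹ ^ (k - 1) := by
    have h2 : l⁻¹ ^ (k - 1) = Real.exp (-(((k : ℝ) - 1) * Real.log l)) := by
      rw [Real.exp_neg, inv_pow]
      congr 1
      have : ((k : ℝ) - 1) = ((k - 1 : ℕ) : ℝ) := by rw [Nat.cast_sub hk]; simp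
      rw [this, Real.exp_nat_mul, Real.exp_log hl]
    have h3 : (n : ℝ) = Real.exp l := by rw [hldef, Real.exp_log hn']
    rw [h2, h3, ← Real.exp_add, ← Real.exp_add, hy]
    congr 1; ring
  rw [poisLow, ← mul_assoc, h1, mul_assoc, mul_sum]
  congr 1
  refine sum_congr rfl fun d hd => ?_
  have hd' := mem_range.1 hd
  have h4 : l⁻¹ ^ (k - 1) = l⁻¹ ^ d * l⁻¹ ^ (k - 1 - d) := by
    rw [← pow_add]; congr 1; omega
  rw [h4, div_pow, inv_pow l d]
  field_simp

lemma tendsto_log_log_div :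
    Tendsto (fun n : ℕ => Real.log (Real.log n) / Real.log n) atTop (𝓝 0) := by
  have h := (Real.isLittleO_pow_log_id_atTop (n := 1)).tendsto_div_nhds_zero.comp
    tendsto_log_natCast
  simpa [Function.comp_def] using h

/-- The scaled link probability of a sequence that is asymptotically a deviation `α n` away from
the threshold. -/
def IsScaled (k : ℕ) (α y : ℕ → ℝ) : Prop :=
  ∀ᶠ n : ℕ in atTop, y n = Real.log n + ((k : ℝ) - 1) * Real.log (Real.log n) + α n

lemma IsScaled.eventually_le (h : IsScaled k α y) {A : ℝ} (hA : ∀ᶠ n in atTop, α n ≤ A) :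
    ∀ᶠ n : ℕ in atTop, y n ≤ 2 * Real.log n := by
  have h1 : Tendsto (fun n : ℕ => ((k : ℝ) - 1) * (Real.log (Real.log n) / Real.log n)) atTop
      (𝓝 0) := by simpa using tendsto_log_log_div.const_mul ((k : ℝ) - 1)
  filter_upwards [h, hA, h1.eventually_le_const (show (0 : ℝ) < 1 / 2 by norm_num),
    tendsto_log_natCast.eventually_ge_atTop 1,
    tendsto_log_natCast.eventually_ge_atTop (2 * A)] with n hy hA h1 hl1 hlA
  have hl0 : 0 < Real.log n := by linarith
  rw [← mul_div_assoc, div_le_iff₀ hl0] at h1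
  linarith

lemma IsScaled.tendsto (hk : 1 ≤ k) (h : IsScaled k α y) {a : ℝ} (hα : Tendsto α atTop (𝓝 a)) :
    Tendsto (fun n : ℕ => n * poisLow k (y n)) atTop
      (𝓝 (Real.exp (-a) / ((k - 1).factorial : ℝ))) := by
  have hinv : Tendsto (fun n : ℕ => (Real.log n)⁻¹) atTop (𝓝 0) :=
    tendsto_log_natCast.inv_tendsto_atTop
  have hratio : Tendsto (fun n : ℕ => y n / Real.log n) atTop (𝓝 1) := by
    have h1 := ((tendsto_const_nhds (x := (1 : ℝ))).add
      (tendsto_log_log_div.const_mul ((k : ℝ) - 1))).add (hα.mul hinv)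
    have e : (1 : ℝ) + (k - 1) * 0 + a * 0 = 1 := by ring
    rw [e] at h1
    refine h1.congr' ?_
    filter_upwards [h, tendsto_log_natCast.eventually_ge_atTop 1] with n hy hl
    have hl0 : Real.log n ≠ 0 := by linarith
    rw [hy]
    field_simp
  have hsum : Tendsto (fun n : ℕ => Real.exp (-α n) * ∑ d ∈ range k,
      (y n / Real.log n) ^ d * (Real.log n)⁻¹ ^ (k - 1 - d) / (d.factorial : ℝ)) atTop
      (𝓝 (Real.exp (-a) * ∑ d ∈ range k, 1 ^ d * 0 ^ (k - 1 - d) / (d.factorial : ℝ))) :=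
    ((Real.continuous_exp.tendsto _).comp hα.neg).mul (tendsto_finsetSum _ fun d _ =>
      ((hratio.pow d).mul (hinv.pow (k - 1 - d))).div_const _)
  have hlim : ∑ d ∈ range k, (1 : ℝ) ^ d * 0 ^ (k - 1 - d) / (d.factorial : ℝ) =
      1 / ((k - 1).factorial : ℝ) := by
    rw [sum_eq_single (k - 1)]
    · simp
    · intro d hd hne
      have := mem_range.1 hd
      rw [zero_pow (by omega)]; simp
    · intro hd
      exact absurd (mem_range.2 (by omega)) hd
  rw [hlim, mul_one_div] at hsum
  refine hsum.congr' ?_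
  filter_upwards [h, eventually_gt_atTop 0, tendsto_log_natCast.eventually_ge_atTop 1]
    with n hy hn hl
  exact (mul_poisLow_eq hk hn (by linarith) hy).symm

/-- Here y/l need not be bounded, but it is eventually at most 2 + α, so the sum is at most k(2 +
α)^k, which e^{-α} overcomes. -/
lemma IsScaled.tendsto_of_atTop (hk : 1 ≤ k) (h : IsScaled k α y) (hα : Tendsto α atTop atTop) :
    Tendsto (fun n : ℕ => n * poisLow k (y n)) atTop (𝓝 0) := by
  have h1 : Tendsto (fun n : ℕ => ((k : ℝ) - 1) * (Real.log (Real.log n) / Real.log n)) atTop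
      (𝓝 0) := by simpa using tendsto_log_log_div.const_mul ((k : ℝ) - 1)
  have h2 : Tendsto (fun n : ℕ => k * Real.exp 2 * ((2 + α n) ^ k * Real.exp (-(2 + α n)))) atTop
      (𝓝 0) := by
    have := ((Real.tendsto_pow_mul_exp_neg_atTop_nhds_zero k).comp
      (tendsto_atTop_add_const_left atTop 2 hα)).const_mul (k * Real.exp 2)
    simpa [Function.comp_def] using this
  have hev : ∀ᶠ n : ℕ in atTop, 0 ≤ n * poisLow k (y n) ∧ n * poisLow k (y n) ≤
      k * Real.exp 2 * ((2 + α n) ^ k * Real.exp (-(2 + α n))) := by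
    have hk1 : (0 : ℝ) ≤ (k : ℝ) - 1 := by
      have : (1 : ℝ) ≤ k := by exact_mod_cast hk
      linarith
    filter_upwards [h, h1.eventually_le_const one_pos, hα.eventually_ge_atTop 0,
      tendsto_log_natCast.eventually_ge_atTop 1, eventually_gt_atTop 0] with n hy h1 hα0 hl hn
    have hl0 : 0 < Real.log n := by linarith
    have hll : 0 ≤ Real.log (Real.log n) := Real.log_nonneg hl
    have hy0 : 0 ≤ y n := by rw [hy]; positivity
    refine ⟨mul_nonneg (Nat.cast_nonneg _) (poisLow_pos hk hy0).le, ?_⟩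
    rw [mul_poisLow_eq hk hn hl0 hy]
    have hu : y n / Real.log n ≤ 2 + α n := by
      rw [← mul_div_assoc, div_le_iff₀ hl0] at h1
      rw [div_le_iff₀ hl0]
      nlinarith
    have hterm : ∀ d ∈ range k, (y n / Real.log n) ^ d * (Real.log n)⁻¹ ^ (k - 1 - d) /
        (d.factorial : ℝ) ≤ (2 + α n) ^ k := by
      intro d hd
      have hf : (1 : ℝ) ≤ d.factorial := by exact_mod_cast d.factorial_pos
      have h3 : (y n / Real.log n) ^ d ≤ (2 + α n) ^ k :=
        (pow_le_pow_left₀ (by positivity) hu d).trans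
          (pow_le_pow_right₀ (by linarith) (mem_range.1 hd).le)
      have h4 : (Real.log n)⁻¹ ^ (k - 1 - d) ≤ 1 :=
        pow_le_one₀ (by positivity) (inv_le_one_of_one_le₀ hl)
      refine div_le_of_le_mul₀ (by positivity) (by positivity) ?_
      have h5 : (0 : ℝ) ≤ (2 + α n) ^ k := by positivity
      calc _ ≤ (2 + α n) ^ k * 1 := mul_le_mul h3 h4 (by positivity) h5
        _ ≤ _ := mul_le_mul_of_nonneg_left hf h5
    calc _ ≤ Real.exp (-α n) * (k * (2 + α n) ^ k) := by
          refine mul_le_mul_of_nonneg_left ?_ (Real.exp_pos _).le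
          refine (sum_le_card_nsmul _ _ _ hterm).trans (le_of_eq ?_)
          rw [card_range, nsmul_eq_mul]
      _ = _ := by
          have : Real.exp (-α n) = Real.exp 2 * Real.exp (-(2 + α n)) := by
            rw [← Real.exp_add]; congr 1; ring
          rw [this]; ring
  exact squeeze_zero' (hev.mono fun _ h => h.1) (hev.mono fun _ h => h.2) h2

/-- If y ≤ l/2, then already n e^{-y} ≥ √n. Otherwise y/l > 1/2, and the term d = k - 1 contributes
at least a constant times e^{-α}. -/
lemma IsScaled.tendsto_of_atBot (hk : 1 ≤ k) (h : IsScaled k α y) (hy0 : ∀ n, 0 ≤ y n)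
    (hα : Tendsto α atTop atBot) : Tendsto (fun n : ℕ => n * poisLow k (y n)) atTop atTop := by
  set c : ℝ := (1 / 2) ^ (k - 1) / ((k - 1).factorial : ℝ) with hc
  have hc0 : 0 < c := by positivity
  rw [tendsto_atTop]
  intro B
  have h1 : Tendsto (fun n : ℕ => Real.exp (Real.log n / 2)) atTop atTop :=
    Real.tendsto_exp_atTop.comp (tendsto_log_natCast.atTop_div_const (by norm_num))
  have h2 : Tendsto (fun n : ℕ => Real.exp (-α n) * c) atTop atTop :=
    (Real.tendsto_exp_atTop.comp (tendsto_neg_atBot_atTop.comp hα)).atTop_mul_const hc0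
  filter_upwards [h, h1.eventually_ge_atTop B, h2.eventually_ge_atTop B,
    tendsto_log_natCast.eventually_ge_atTop 1, eventually_gt_atTop 0] with n hy h1 h2 hl hn
  have hl0 : 0 < Real.log n := by linarith
  have hn' : (0 : ℝ) < n := by exact_mod_cast hn
  rcases le_or_gt (y n) (Real.log n / 2) with hle | hgt
  · refine h1.trans ?_
    calc Real.exp (Real.log n / 2) ≤ n * Real.exp (-y n) := by
          conv_rhs => rw [← Real.exp_log hn', ← Real.exp_add]
          exact Real.exp_le_exp.2 (by linarith)
      _ ≤ _ := by gcongr; exact exp_neg_le_poisLow hk (hy0 n)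
  · refine h2.trans ?_
    rw [mul_poisLow_eq hk hn hl0 hy]
    refine mul_le_mul_of_nonneg_left ?_ (Real.exp_pos _).le
    have h3 := single_le_sum (s := range k) (f := fun d => (y n / Real.log n) ^ d *
      (Real.log n)⁻¹ ^ (k - 1 - d) / (d.factorial : ℝ))
      (fun d _ => by have := hy0 n; positivity) (mem_range.2 (by omega : k - 1 < k))
    refine le_trans ?_ h3
    simp only [Nat.sub_self, pow_zero, mul_one]
    exact div_le_div_of_nonneg_right (pow_le_pow_left₀ (by norm_num)
      (by rw [le_div_iff₀ hl0]; linarith) _) (by positivity)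

end PoissonLimit

/-! ### The three limits of the minimum degree probability -/

section MinDegree

open Finset

variable {q k : ℕ} {K P : ℕ → ℕ} {p : ℕ → unitInterval} {α : ℕ → ℝ}

lemma isScaled_of_link (hKP : ∀ n, K n ≤ P n)
    (hlink : ∀ᶠ n : ℕ in atTop, ∀ i j : Fin n, i ≠ j →
      (graphLaw q n (K n) (P n) (p n)).real {G | G.Adj i j} =
        (Real.log n + ((k : ℝ) - 1) * Real.log (Real.log n) + α n) / n) :
    IsScaled k α fun n => n * (p n * shareProb q (P n) (K n)) := by
  filter_upwards [hlink, eventually_ge_atTop 2] with n h hn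
  have hn' : (n : ℝ) ≠ 0 := by
    have : n ≠ 0 := by omega
    exact_mod_cast this
  have h1 := h ⟨0, by omega⟩ ⟨1, by omega⟩ (by simp)
  rw [graphLaw_adj (hKP n) q (p n) (by simp)] at h1
  rw [h1]
  field_simp

lemma tendsto_alternating_sum_pow_div_factorial (c : ℝ) :
    Tendsto (fun J : ℕ => ∑ j ∈ range (J + 1), (-1 : ℝ) ^ j * (c ^ j / (j.factorial : ℝ))) atTop
      (𝓝 (Real.exp (-c))) := by
  have h := (NormedSpace.expSeries_div_hasSum_exp (-c)).tendsto_sum_nat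
  rw [← Real.exp_eq_exp_ℝ] at h
  refine ((tendsto_add_atTop_iff_nat 1).2 h).congr fun J => sum_congr rfl fun j _ => ?_
  rw [neg_pow]; ring

theorem tendsto_minDeg_of_tendsto (hq : 1 ≤ q) (hk : 1 ≤ k) (hKP : ∀ n, K n ≤ P n)
    (hK : Tendsto K atTop atTop)
    (hKP2 : Tendsto (fun n => (K n : ℝ) ^ 2 / (P n : ℝ)) atTop (𝓝 0))
    (hs : IsScaled k α fun n => n * (p n * shareProb q (P n) (K n))) {a : ℝ}
    (hα : Tendsto α atTop (𝓝 a)) :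
    Tendsto (fun n => (graphLaw q n (K n) (P n) (p n)).real {G | k ≤ minDeg G}) atTop
      (𝓝 (Real.exp (-(Real.exp (-a) / ((k - 1).factorial : ℝ))))) := by
  set c := Real.exp (-a) / ((k - 1).factorial : ℝ) with hc
  have hy := hs.eventually_le (hα.eventually_le_const (lt_add_one a))
  have hX := hs.tendsto hk hα
  have hpos : ∀ n : ℕ, 0 < poisLow k (n * (p n * shareProb q (P n) (K n))) := fun n =>
    poisLow_pos hk (mul_nonneg (Nat.cast_nonneg _) (mul_nonneg (p n).2.1 (shareProb_nonneg _ _ _)))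
  have hM : ∀ j : ℕ, Tendsto (fun n : ℕ => lowMoment (graphLaw q n (K n) (P n) (p n)) k j) atTop
      (𝓝 (c ^ j / (j.factorial : ℝ))) := by
    intro j
    have h := (tendsto_lowMoment_div hq hk hKP hK hKP2 hy j).mul (hX.pow j)
    rw [one_div_mul_eq_div] at h
    refine h.congr' ?_
    filter_upwards [eventually_gt_atTop 0] with n hn
    have hn' : (0 : ℝ) < n := by exact_mod_cast hn
    exact div_mul_cancel₀ _ (pow_pos (mul_pos hn' (hpos n)) j).ne'
  rw [Metric.tendsto_nhds]
  intro ε hε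
  have hfac := FloorSemiring.tendsto_pow_div_factorial_atTop c
  have hfac1 := (tendsto_add_atTop_iff_nat 1).2 hfac
  -- J is fixed before n grows: the two Bonferroni error moments tend to c^J/J! and c^{J+1}/(J+1)!,
  -- each below ε/8, and the truncated exponential series is within ε/4 of e^{-c}.
  obtain ⟨J, hJ1, hJ2, hJ3⟩ := ((hfac.eventually_lt_const (show 0 < ε / 8 by positivity)).and
    ((hfac1.eventually_lt_const (show 0 < ε / 8 by positivity)).and
    (Metric.tendsto_nhds.1 (tendsto_alternating_sum_pow_div_factorial c) (ε / 4)
      (by positivity)))).exists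
  have hsum : Tendsto (fun n : ℕ => ∑ j ∈ range (J + 1), (-1 : ℝ) ^ j *
      lowMoment (graphLaw q n (K n) (P n) (p n)) k j) atTop
      (𝓝 (∑ j ∈ range (J + 1), (-1 : ℝ) ^ j * (c ^ j / (j.factorial : ℝ)))) :=
    tendsto_finsetSum _ fun j _ => (hM j).const_mul _
  filter_upwards [Metric.tendsto_nhds.1 hsum (ε / 4) (by positivity),
    (hM J).eventually_lt_const hJ1, (hM (J + 1)).eventually_lt_const hJ2,
    eventually_gt_atTop 0] with n h1 h2 h3 hn
  have := isProbabilityMeasure_graphLaw q n (hKP n) (p n)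
  have h4 := abs_measureReal_sub_alternating_sum_le (graphLaw q n (K n) (P n) (p n)) hn k J
  rw [← Real.dist_eq] at h4
  have h5 := dist_triangle4 ((graphLaw q n (K n) (P n) (p n)).real {G | k ≤ minDeg G})
    (∑ j ∈ range (J + 1), (-1 : ℝ) ^ j * lowMoment (graphLaw q n (K n) (P n) (p n)) k j)
    (∑ j ∈ range (J + 1), (-1 : ℝ) ^ j * (c ^ j / (j.factorial : ℝ))) (Real.exp (-c))
  linarith

theorem tendsto_minDeg_of_atTop (hk : 1 ≤ k) (hKP : ∀ n, K n ≤ P n)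
    (hs : IsScaled k α fun n => n * (p n * shareProb q (P n) (K n)))
    (hα : Tendsto α atTop atTop) :
    Tendsto (fun n => (graphLaw q n (K n) (P n) (p n)).real {G | k ≤ minDeg G}) atTop (𝓝 1) := by
  have hX := (hs.tendsto_of_atTop hk hα).mul_const (Real.exp (k + 1))
  have hlow := (tendsto_const_nhds (x := (1 : ℝ))).sub hX
  rw [zero_mul, sub_zero] at hlow
  have hprob := fun n => isProbabilityMeasure_graphLaw q n (hKP n) (p n)
  refine tendsto_of_tendsto_of_tendsto_of_le_of_le' hlow tendsto_const_nhds ?_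
    (.of_forall fun n => measureReal_le_one)
  filter_upwards [eventually_gt_atTop 0] with n hn
  refine le_trans (sub_le_sub_left ?_ 1)
    (one_sub_lowMoment_le (graphLaw q n (K n) (P n) (p n)) hn k)
  have h1 := sum_le_card_nsmul (powersetCard 1 (univ : Finset (Fin n)))
    (fun R => (graphLaw q n (K n) (P n) (p n)).real (lowEvent k R)) _ fun R hR => by
      obtain ⟨v, rfl⟩ := card_eq_one.1 (mem_powersetCard.1 hR).2
      exact lowEvent_singleton_le (n := n) (q := q) (k := k) (p := p n) (hKP n) v
  rw [nsmul_eq_mul, card_powersetCard, card_univ, Fintype.card_fin, Nat.choose_one_right,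
    ← mul_assoc] at h1
  exact h1

theorem tendsto_minDeg_of_atBot (hq : 1 ≤ q) (hk : 1 ≤ k) (hKP : ∀ n, K n ≤ P n)
    (hK : Tendsto K atTop atTop)
    (hKP2 : Tendsto (fun n => (K n : ℝ) ^ 2 / (P n : ℝ)) atTop (𝓝 0))
    (hs : IsScaled k α fun n => n * (p n * shareProb q (P n) (K n)))
    (hα : Tendsto α atTop atBot) :
    Tendsto (fun n => (graphLaw q n (K n) (P n) (p n)).real {G | k ≤ minDeg G}) atTop (𝓝 0) := by
  have hy := hs.eventually_le (hα.eventually_le_atBot 0)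
  have hX := hs.tendsto_of_atBot hk (fun n => mul_nonneg (Nat.cast_nonneg _)
    (mul_nonneg (p n).2.1 (shareProb_nonneg _ _ _))) hα
  set X : ℕ → ℝ := fun n => n * poisLow k (n * (p n * shareProb q (P n) (K n))) with hXdef
  have h1 := tendsto_lowMoment_div hq hk hKP hK hKP2 hy 1
  have h2 := tendsto_lowMoment_div hq hk hKP hK hKP2 hy 2
  simp only [pow_one, Nat.factorial_one, Nat.factorial_two, Nat.cast_one, Nat.cast_ofNat,
    div_one] at h1 h2
  -- With M₁ and M₂ the first two binomial moments, Chebyshev's bound divided by M₁² is 1/M₁ +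
  -- 2M₂/M₁² - 1, which tends to 0 + 1 - 1 because M₁ is asymptotic to X and M₂ to X²/2.
  have hup := ((hX.inv_tendsto_atTop.mul (h1.inv₀ one_ne_zero)).add
    ((h2.const_mul 2).div (h1.pow 2) (by norm_num))).sub (tendsto_const_nhds (x := (1 : ℝ)))
  have e : (0 : ℝ) * 1⁻¹ + 2 * (1 / 2) / 1 ^ 2 - 1 = 0 := by norm_num
  rw [e] at hup
  refine squeeze_zero' (.of_forall fun n => measureReal_nonneg) ?_ hup
  filter_upwards [hX.eventually_gt_atTop 0, h1.eventually_const_lt (show (0 : ℝ) < 1 by norm_num),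
    eventually_gt_atTop 0] with n hXn hMX hn
  have := isProbabilityMeasure_graphLaw q n (hKP n) (p n)
  have key := measureReal_mul_sq_lowMoment_le (graphLaw q n (K n) (P n) (p n)) hn k
  have hM : 0 < lowMoment (graphLaw q n (K n) (P n) (p n)) k 1 := (div_pos_iff_of_pos_right hXn).1 hMX
  rw [← le_div_iff₀ (by positivity)] at key
  refine key.trans (le_of_eq ?_)
  have hX' : X n ≠ 0 := hXn.ne'
  change _ = (X n)⁻¹ * (lowMoment (graphLaw q n (K n) (P n) (p n)) k 1 / X n)⁻¹ +
    2 * (lowMoment (graphLaw q n (K n) (P n) (p n)) k 2 / X n ^ 2) /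
      (lowMoment (graphLaw q n (K n) (P n) (p n)) k 1 / X n) ^ 2 - 1
  field_simp

end MinDegree

end QComposite

end

theorem theorem1 (q : ℕ) (hq : 1 ≤ q) (k : ℕ) (hk : 1 ≤ k)
    (K P : ℕ → ℕ) (p : ℕ → unitInterval) (α : ℕ → ℝ)
    (hKP : ∀ n, K n ≤ P n)
    (hK : Tendsto K atTop atTop)
    (hKP2 : Tendsto (fun n => (K n : ℝ) ^ 2 / (P n : ℝ)) atTop (𝓝 0))
    (hlink : ∀ᶠ n : ℕ in atTop, ∀ i j : Fin n, i ≠ j →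
      (QComposite.graphLaw q n (K n) (P n) (p n)).real {G | G.Adj i j} =
        (Real.log n + ((k : ℝ) - 1) * Real.log (Real.log n) + α n) / n) :
    (∀ a : ℝ, Tendsto α atTop (𝓝 a) →
      Tendsto (fun n => (QComposite.graphLaw q n (K n) (P n) (p n)).real
          {G | k ≤ QComposite.minDeg G})
        atTop (𝓝 (Real.exp (-(Real.exp (-a) / ((k - 1).factorial : ℝ)))))) ∧
    (Tendsto α atTop atTop →
      Tendsto (fun n => (QComposite.graphLaw q n (K n) (P n) (p n)).real
          {G | k ≤ QComposite.minDeg G})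
        atTop (𝓝 1)) ∧
    (Tendsto α atTop atBot →
      Tendsto (fun n => (QComposite.graphLaw q n (K n) (P n) (p n)).real
          {G | k ≤ QComposite.minDeg G})
        atTop (𝓝 0)) := by
  have hs := QComposite.isScaled_of_link hKP hlink
  exact ⟨fun a ha => QComposite.tendsto_minDeg_of_tendsto hq hk hKP hK hKP2 hs ha,
    fun ha => QComposite.tendsto_minDeg_of_atTop hk hKP hs ha,
    fun ha => QComposite.tendsto_minDeg_of_atBot hq hk hKP hK hKP2 hs ha⟩
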